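/- Let $\mathbb H$ be the upper half-plane, and for $\gamma=\begin{pmatrix}a&b\\c&d\end{pmatrix}\in\mathrm{SL}(2,\mathbb R)$ and $k\in\mathbb Z$ put $(f|_k\gamma)(z)=(cz+d)^{-k}f\left(\frac{az+b}{cz+d}\right)$. For a prime $N$ let $W_N$ be the set of matrices $\frac1{\sqrt N}\begin{pmatrix}aN&b\\cN&dN\end{pmatrix}$ of determinant $1$ with $a,b,c,d\in\mathbb Z$, and let $\Gamma_0^+(N)=\Gamma_0(N)\cup W_N$, a subgroup of $\mathrm{SL}(2,\mathbb R)$. For a subgroup $\Gamma$ of $\mathrm{SL}(2,\mathbb R)$ commensurable with $\mathrm{SL}(2,\mathbb Z)$ and a character $\chi$ of $\Gamma$ of finite order, a nearly holomorphic modular form of weight $k$ and depth $\le r$ on $\Gamma$ with character $\chi$ is a function $$f(z)=\sum_{j=0}^r\frac{f_j(z)}{(z-\overline z)^j},\qquad f_j:\mathbb H\to\mathbb C\text{ holomorphic},$$ such that $f|_k\gamma=\chi(\gamma)f$ for all $\gamma\in\Gamma$ and $f$ has a finite limit at every cusp (that is, for every $\gamma\in\mathrm{SL}(2,\mathbb Z)$,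 $(f|_k\gamma)(z)$ has a finite limit as $\mathrm{Im}\,z\to\infty$). Its holomorphic part is $f_0$. Let $\widetilde{\mathscr M}_k^{\le r}(\Gamma,\chi)$ be the space of the holomorphic parts of these functions. For a prime $N$, let $\widetilde{\mathscr M}_k^{\le r}(\Gamma_0^+(N),\pm)$ be the space of the holomorphic parts of those nearly holomorphic modular forms $f$ of weight $k$ and depth $\le r$ on $\Gamma_0(N)$ (with trivial character) that satisfy $f|_kw=\pm f$ for all $w\in W_N$. Let $\chi$ be the character of $\Gamma_0^+(3)$ with $\chi(S)=\chi(R)=-i$, where $S=\frac1{\sqrt3}\begin{pmatrix}0&-1\\3&0\end{pmatrix}$ and $R=\frac1{\sqrt3}\begin{pmatrix}3&-1\\3&0\end{pmatrix}$ generate $\Gamma_0^+(3)$, and let $\overline\chi$ be its complex conjugate. An element $f$ of one of these spaces $\widetilde{\mathscr M}$ is called extremal if its vanishing order at $\infty$ (the order in $q=e^{2\pi iz}$ of its Fourier expansion) is equal to $\dim\widetilde{\mathscr M}-1$. Then the following hold. (i) Let $N=2$ or $N=3$. For every positive even integer $k$, extremal quasimodular forms exist in $\widetilde{\mathscr M}_k^{\le1}(\Gamma_0^+(N),+)$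 and in $\widetilde{\mathscr M}_k^{\le1}(\Gamma_0^+(N),-)$, and in each of these spaces they are unique up to scalars. (ii) For every odd integer $k\ge1$, extremal quasimodular forms exist in $\widetilde{\mathscr M}_k^{\le1}(\Gamma_0^+(3),\chi)$ and are unique up to scalars. (iii) For every odd integer $k\ge3$, extremal quasimodular forms exist in $\widetilde{\mathscr M}_k^{\le1}(\Gamma_0^+(3),\overline\chi)$ and are unique up to scalars. -/

import Mathlib

open UpperHalfPlane ModularForm Filter Topology
open scoped MatrixGroups Manifold

noncomputable section

namespace QuasiModular

/-! ### The groups `Γ₀(N)` and `Γ₀⁺(N)` inside `SL(2, ℝ)` -/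

/-- `Γ₀(N)`, as a subgroup of `SL(2, ℝ)`. -/
def Gamma0R (N : ℕ) : Subgroup SL(2, ℝ) :=
  (CongruenceSubgroup.Gamma0 N).map (Matrix.SpecialLinearGroup.map (Int.castRingHom ℝ))

/-- The set `W_N` of matrices `(1/√N) (aN, b; cN, dN)` of determinant `1`, with `a, b, c, d ∈ ℤ`. -/
def atkinLehnerSet (N : ℕ) : Set SL(2, ℝ) :=
  {g | ∃ a b c d : ℤ, (g : Matrix (Fin 2) (Fin 2) ℝ) =
    (1 / √(N : ℝ)) • !![(a : ℝ) * N, (b : ℝ); (c : ℝ) * N, (d : ℝ) * N]}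

theorem mem_Gamma0R {N : ℕ} {g : SL(2, ℝ)} :
    g ∈ Gamma0R N ↔ ∃ a b c d : ℤ, (g : Matrix (Fin 2) (Fin 2) ℝ) =
      !![(a : ℝ), (b : ℝ); (c : ℝ) * N, (d : ℝ)] := by
  constructor
  · rintro ⟨γ, hγ, rfl⟩
    have h : ((γ 1 0 : ℤ) : ZMod N) = 0 := CongruenceSubgroup.Gamma0_mem.1 hγ
    obtain ⟨c, hc⟩ := (ZMod.intCast_zmod_eq_zero_iff_dvd _ _).1 h
    refine ⟨γ 0 0, γ 0 1, c, γ 1 1, ?_⟩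
    ext i j
    fin_cases i <;> fin_cases j <;> simp [hc, mul_comm]
  · rintro ⟨a, b, c, d, h⟩
    have hdet : a * d - b * (c * N) = 1 := by
      have h1 := g.det_coe
      rw [h, Matrix.det_fin_two_of] at h1
      exact_mod_cast h1
    refine ⟨⟨!![a, b; c * N, d], by rw [Matrix.det_fin_two_of, hdet]⟩, ?_, ?_⟩
    · change ((c * N : ℤ) : ZMod N) = 0
      simp
    · ext i j
      rw [h]
      change ((!![a, b; c * N, d] i j : ℤ) : ℝ) = _
      fin_cases i <;> fin_cases j <;> simp

theorem mem_atkinLehnerSet {N : ℕ} {g : SL(2, ℝ)} (hg : g ∈ atkinLehnerSet N) :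
    0 < √(N : ℝ) ∧ ∃ a b c d : ℤ, N * (a * d) - b * c = 1 ∧
      g 0 0 = √(N : ℝ) * a ∧ g 0 1 = b / √(N : ℝ) ∧
      g 1 0 = √(N : ℝ) * c ∧ g 1 1 = √(N : ℝ) * d := by
  obtain ⟨a, b, c, d, h⟩ := hg
  have hs0 : 0 ≤ √(N : ℝ) := Real.sqrt_nonneg _
  have hsq : √(N : ℝ) * √(N : ℝ) = N := Real.mul_self_sqrt (Nat.cast_nonneg N)
  have hdet := g.det_coe
  have hs : √(N : ℝ) ≠ 0 := by
    intro h0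
    rw [h, h0] at hdet
    simp at hdet
  have e00 : g 0 0 = √(N : ℝ) * a := by
    have := congrFun (congrFun h 0) 0
    simp only [Matrix.smul_apply, smul_eq_mul] at this
    rw [this]; simp; field_simp; linear_combination (-(a : ℝ)) * hsq
  have e01 : g 0 1 = b / √(N : ℝ) := by
    have := congrFun (congrFun h 0) 1
    simp only [Matrix.smul_apply, smul_eq_mul] at this
    rw [this]; simp; field_simp
  have e10 : g 1 0 = √(N : ℝ) * c := by
    have := congrFun (congrFun h 1) 0
    simp only [Matrix.smul_apply, smul_eq_mul] at this
    rw [this]; simp; field_simp; linear_combination (-(c : ℝ)) * hsq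
  have e11 : g 1 1 = √(N : ℝ) * d := by
    have := congrFun (congrFun h 1) 1
    simp only [Matrix.smul_apply, smul_eq_mul] at this
    rw [this]; simp; field_simp; linear_combination (-(d : ℝ)) * hsq
  refine ⟨lt_of_le_of_ne hs0 hs.symm, a, b, c, d, ?_, e00, e01, e10, e11⟩
  rw [Matrix.det_fin_two, e00, e01, e10, e11] at hdet
  field_simp at hdet
  have : (N : ℝ) * (a * d) - b * c = 1 := by
    linear_combination hdet - (a * d : ℝ) * hsq
  exact_mod_cast this

theorem mem_atkinLehnerSet_of {N : ℕ} {g : SL(2, ℝ)} (hs : 0 < √(N : ℝ)) {a b c d : ℤ}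
    (h00 : g 0 0 = √(N : ℝ) * a) (h01 : g 0 1 = b / √(N : ℝ))
    (h10 : g 1 0 = √(N : ℝ) * c) (h11 : g 1 1 = √(N : ℝ) * d) : g ∈ atkinLehnerSet N := by
  have hsq : √(N : ℝ) * √(N : ℝ) = N := Real.mul_self_sqrt (Nat.cast_nonneg N)
  refine ⟨a, b, c, d, ?_⟩
  have hs' := hs.ne'
  ext i j
  fin_cases i <;> fin_cases j
  · simp [h00]; field_simp; linear_combination (a : ℝ) * hsq
  · simp [h01]; field_simp
  · simp [h10]; field_simp; linear_combination (c : ℝ) * hsq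
  · simp [h11]; field_simp; linear_combination (d : ℝ) * hsq

theorem mem_Gamma0R_entries {N : ℕ} {g : SL(2, ℝ)} (hg : g ∈ Gamma0R N) :
    ∃ a b c d : ℤ, a * d - b * (c * N) = 1 ∧
      g 0 0 = a ∧ g 0 1 = b ∧ g 1 0 = c * N ∧ g 1 1 = d := by
  obtain ⟨a, b, c, d, h⟩ := mem_Gamma0R.1 hg
  refine ⟨a, b, c, d, ?_, by simp [h], by simp [h], by simp [h], by simp [h]⟩
  have h1 := g.det_coe
  rw [h, Matrix.det_fin_two_of] at h1
  exact_mod_cast h1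

theorem mem_Gamma0R_of {N : ℕ} {g : SL(2, ℝ)} {a b c d : ℤ}
    (h00 : g 0 0 = a) (h01 : g 0 1 = b) (h10 : g 1 0 = c * N) (h11 : g 1 1 = d) :
    g ∈ Gamma0R N := by
  refine mem_Gamma0R.2 ⟨a, b, c, d, ?_⟩
  ext i j
  fin_cases i <;> fin_cases j <;> simp [h00, h01, h10, h11]

theorem sl_mul_apply (g h : SL(2, ℝ)) (i j : Fin 2) :
    (g * h) i j = g i 0 * h 0 j + g i 1 * h 1 j := by
  simp [Matrix.mul_apply, Fin.sum_univ_two]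

/-- The group `Γ₀⁺(N) = Γ₀(N) ∪ W_N`, for `N` a prime power (so that the Hall divisors of `N`
are `1` and `N`). -/
def Gamma0Plus (N : ℕ) : Subgroup SL(2, ℝ) where
  carrier := {g | g ∈ Gamma0R N ∨ g ∈ atkinLehnerSet N}
  one_mem' := Or.inl (one_mem _)
  mul_mem' := by
    rintro g h (hg | hg) (hh | hh)
    · exact Or.inl (mul_mem hg hh)
    · right
      obtain ⟨a, b, c, d, -, g00, g01, g10, g11⟩ := mem_Gamma0R_entries hg
      obtain ⟨hs, a', b', c', d', -, h00, h01, h10, h11⟩ := mem_atkinLehnerSet hh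
      have hsq : √(N : ℝ) * √(N : ℝ) = N := Real.mul_self_sqrt (Nat.cast_nonneg N)
      refine mem_atkinLehnerSet_of hs (a := a * a' + b * c') (b := a * b' + b * d' * N)
        (c := c * N * a' + d * c') (d := c * b' + d * d') ?_ ?_ ?_ ?_ <;>
      · rw [sl_mul_apply]
        simp only [g00, g01, g10, g11, h00, h01, h10, h11]
        push_cast
        generalize √(N : ℝ) = t at hs hsq ⊢
        try rw [← hsq]
        field_simp
    · right
      obtain ⟨a, b, c, d, -, g00, g01, g10, g11⟩ := mem_Gamma0R_entries hh
      obtain ⟨hs, a', b', c', d', -, h00, h01, h10, h11⟩ := mem_atkinLehnerSet hg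
      have hsq : √(N : ℝ) * √(N : ℝ) = N := Real.mul_self_sqrt (Nat.cast_nonneg N)
      refine mem_atkinLehnerSet_of hs (a := a' * a + b' * c) (b := a' * b * N + b' * d)
        (c := c' * a + d' * c * N) (d := c' * b + d' * d) ?_ ?_ ?_ ?_ <;>
      · rw [sl_mul_apply]
        simp only [g00, g01, g10, g11, h00, h01, h10, h11]
        push_cast
        generalize √(N : ℝ) = t at hs hsq ⊢
        try rw [← hsq]
        field_simp
    · left
      obtain ⟨hs, a, b, c, d, -, g00, g01, g10, g11⟩ := mem_atkinLehnerSet hg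
      obtain ⟨-, a', b', c', d', -, h00, h01, h10, h11⟩ := mem_atkinLehnerSet hh
      have hsq : √(N : ℝ) * √(N : ℝ) = N := Real.mul_self_sqrt (Nat.cast_nonneg N)
      refine mem_Gamma0R_of (a := a * a' * N + b * c') (b := a * b' + b * d')
        (c := c * a' + d * c') (d := c * b' + d * d' * N) ?_ ?_ ?_ ?_ <;>
      · rw [sl_mul_apply]
        simp only [g00, g01, g10, g11, h00, h01, h10, h11]
        push_cast
        generalize √(N : ℝ) = t at hs hsq ⊢
        try rw [← hsq]
        field_simp
  inv_mem' := by
    rintro g (hg | hg)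
    · exact Or.inl (inv_mem hg)
    · right
      obtain ⟨hs, a, b, c, d, -, g00, g01, g10, g11⟩ := mem_atkinLehnerSet hg
      refine mem_atkinLehnerSet_of hs (a := d) (b := -b) (c := -c) (d := a) ?_ ?_ ?_ ?_ <;>
        simp [Matrix.SpecialLinearGroup.SL2_inv_expl, g00, g01, g10, g11, neg_div]

/-! ### The character `χ` of `Γ₀⁺(3)` -/

theorem sqrt_three_irr (x y : ℤ) (h : √((3 : ℕ) : ℝ) * x = y) : x = 0 := by
  by_contra hx
  have hirr : Irrational (√((3 : ℕ) : ℝ)) := Nat.prime_three.irrational_sqrt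
  exact (hirr.mul_intCast hx).ne_int y h

theorem not_mem_both (g : SL(2, ℝ)) (hg : g ∈ Gamma0R 3) : g ∉ atkinLehnerSet 3 := by
  intro hw
  obtain ⟨a, b, c, d, -, g00, g01, g10, g11⟩ := mem_Gamma0R_entries hg
  obtain ⟨hs, a', b', c', d', hdet, h00, h01, h10, h11⟩ := mem_atkinLehnerSet hw
  have ha : a' = 0 := sqrt_three_irr a' a (by rw [← h00, g00])
  have hc : c' = 0 := sqrt_three_irr c' (c * 3) (by rw [← h10, g10]; push_cast; ring)
  subst ha; subst hc
  simp at hdet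

open Classical in
/-- `χ(γ) = (d/3)` for `γ = (a, b; 3c, d) ∈ Γ₀(3)`, and `χ(γ) = -i (c/3)` for
`γ = (1/√3)(3a, b; 3c, 3d) ∈ W₃`. -/
def chiFun (g : SL(2, ℝ)) : ℂ :=
  if g ∈ Gamma0R 3 then (legendreSym 3 ⌊g 1 1⌋ : ℂ)
  else -Complex.I * (legendreSym 3 ⌊g 1 0 / √3⌋ : ℂ)

theorem chiFun_left {g : SL(2, ℝ)} (hg : g ∈ Gamma0R 3) {d : ℤ} (h : g 1 1 = d) :
    chiFun g = (legendreSym 3 d : ℂ) := by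
  simp [chiFun, hg, h]

theorem chiFun_right {g : SL(2, ℝ)} (hg : g ∈ atkinLehnerSet 3) {c : ℤ}
    (h : g 1 0 = √((3 : ℕ) : ℝ) * c) : chiFun g = -Complex.I * (legendreSym 3 c : ℂ) := by
  have h' : g ∉ Gamma0R 3 := fun h => not_mem_both g h hg
  have h3 : √(3 : ℝ) ≠ 0 := by positivity
  have : g 1 0 / √3 = (c : ℝ) := by rw [h]; push_cast; field_simp
  simp [chiFun, h', this]

theorem legendre_three_eq (x y : ℤ) (h : (x : ZMod 3) = y) : legendreSym 3 x = legendreSym 3 y := by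
  simp [legendreSym, h]

theorem legendre_three_of_mul (x y z : ℤ) (h : x * y = 1 + 3 * z) :
    legendreSym 3 x = legendreSym 3 y := by
  have h3 : (3 : ZMod 3) = 0 := by decide
  have h1 : (x : ZMod 3) * y = 1 := by
    have := congrArg (fun t : ℤ => (t : ZMod 3)) h
    push_cast at this
    rw [this, h3]; ring
  apply legendre_three_eq
  generalize (x : ZMod 3) = u at *
  generalize (y : ZMod 3) = v at *
  revert u v; decide

theorem chiFun_mul (g h : SL(2, ℝ)) (hg : g ∈ Gamma0Plus 3) (hh : h ∈ Gamma0Plus 3) :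
    chiFun (g * h) = chiFun g * chiFun h := by
  have h3 : (3 : ZMod 3) = 0 := by decide
  have hgh := mul_mem hg hh
  have hsq : √((3 : ℕ) : ℝ) * √((3 : ℕ) : ℝ) = (3 : ℕ) := Real.mul_self_sqrt (Nat.cast_nonneg 3)
  rcases hg with hg | hg <;> rcases hh with hh | hh
  · obtain ⟨a, b, c, d, -, g00, g01, g10, g11⟩ := mem_Gamma0R_entries hg
    obtain ⟨a', b', c', d', -, h00, h01, h10, h11⟩ := mem_Gamma0R_entries hh
    have e : (g * h) 1 1 = ((3 * (c * b') + d * d' : ℤ) : ℝ) := by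
      rw [sl_mul_apply, g10, g11, h01, h11]; push_cast; ring
    rw [chiFun_left (mul_mem hg hh) e, chiFun_left hg g11, chiFun_left hh h11,
      legendre_three_eq _ (d * d') (by push_cast; rw [h3]; ring), legendreSym.mul]
    push_cast; rfl
  · obtain ⟨a, b, c, d, -, g00, g01, g10, g11⟩ := mem_Gamma0R_entries hg
    obtain ⟨hs, a', b', c', d', -, h00, h01, h10, h11⟩ := mem_atkinLehnerSet hh
    have e : (g * h) 1 0 = √((3 : ℕ) : ℝ) * ((3 * (c * a') + d * c' : ℤ) : ℝ) := by
      rw [sl_mul_apply, g10, g11, h00, h10]; push_cast; ring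
    have hm : g * h ∈ atkinLehnerSet 3 := by
      rcases hgh with hgh | hgh
      · exact absurd hh (not_mem_both h (by simpa using mul_mem (inv_mem hg) hgh))
      · exact hgh
    rw [chiFun_right hm e, chiFun_left hg g11, chiFun_right hh h10,
      legendre_three_eq _ (d * c') (by push_cast; rw [h3]; ring), legendreSym.mul]
    push_cast; ring
  · obtain ⟨hs, a, b, c, d, -, g00, g01, g10, g11⟩ := mem_atkinLehnerSet hg
    obtain ⟨a', b', c', d', hdet, h00, h01, h10, h11⟩ := mem_Gamma0R_entries hh
    have e : (g * h) 1 0 = √((3 : ℕ) : ℝ) * ((c * a' + 3 * (d * c') : ℤ) : ℝ) := by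
      rw [sl_mul_apply, g10, g11, h00, h10]; push_cast; ring
    have hm : g * h ∈ atkinLehnerSet 3 := by
      rcases hgh with hgh | hgh
      · exact absurd hg (not_mem_both g (by simpa using mul_mem hgh (inv_mem hh)))
      · exact hgh
    have had : legendreSym 3 a' = legendreSym 3 d' :=
      legendre_three_of_mul a' d' (b' * c') (by push_cast at hdet; linear_combination hdet)
    rw [chiFun_right hm e, chiFun_right hg g10, chiFun_left hh h11, ← had,
      legendre_three_eq _ (c * a') (by push_cast; rw [h3]; ring), legendreSym.mul]
    push_cast; ring
  · obtain ⟨hs, a, b, c, d, -, g00, g01, g10, g11⟩ := mem_atkinLehnerSet hg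
    obtain ⟨-, a', b', c', d', hdet, h00, h01, h10, h11⟩ := mem_atkinLehnerSet hh
    have e : (g * h) 1 1 = ((c * b' + 3 * (d * d') : ℤ) : ℝ) := by
      rw [sl_mul_apply, g10, g11, h01, h11]
      push_cast at hsq ⊢
      field_simp
      linear_combination (d * d' : ℝ) * hsq
    have e0 : (g * h) 1 0 = ((c * a' + d * c' : ℤ) : ℝ) * (3 : ℕ) := by
      rw [sl_mul_apply, g10, g11, h00, h10]
      push_cast at hsq ⊢
      linear_combination (c * a' + d * c' : ℝ) * hsq
    have hm : g * h ∈ Gamma0R 3 := by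
      rcases hgh with hgh | hgh
      · exact hgh
      · obtain ⟨-, a'', b'', c'', d'', hdet'', -, -, k10, k11⟩ := mem_atkinLehnerSet hgh
        have hd : d'' = 0 := sqrt_three_irr d'' _ (by rw [← k11, e])
        have hc : c'' = 0 := sqrt_three_irr c'' ((c * a' + d * c') * 3)
          (by rw [← k10, e0]; push_cast; ring)
        subst hd; subst hc
        simp at hdet''
    have hbc : legendreSym 3 (-b') = legendreSym 3 c' :=
      legendre_three_of_mul (-b') c' (-(a' * d')) (by push_cast at hdet; linear_combination hdet)
    have hb : legendreSym 3 (-b') = - legendreSym 3 b' := by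
      rw [neg_eq_neg_one_mul, legendreSym.mul]
      have : legendreSym 3 (-1) = -1 := by decide
      rw [this]; ring
    rw [chiFun_left hm e, chiFun_right hg g10, chiFun_right hh h10, ← hbc, hb,
      legendre_three_eq _ (c * b') (by push_cast; rw [h3]; ring), legendreSym.mul]
    push_cast
    linear_combination ((legendreSym 3 c : ℂ) * legendreSym 3 b') * Complex.I_mul_I

/-- The character `χ` of `Γ₀⁺(3)` with `χ(S) = χ(R) = -i` (see `chi_S` and `chi_R`; the matrices
`S` and `R` generate `Γ₀⁺(3)`). -/
def chi : Gamma0Plus 3 →* ℂˣ :=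
  MonoidHom.toHomUnits
    { toFun := fun g => chiFun g
      map_one' := by
        change chiFun 1 = 1
        rw [chiFun_left (d := 1) (one_mem _) (by simp)]
        simp
      map_mul' := fun g h => chiFun_mul g h g.2 h.2 }

/-- The complex conjugate character `χ̄`. -/
def chiBar : Gamma0Plus 3 →* ℂˣ :=
  (Units.map ((starRingEnd ℂ : ℂ →+* ℂ) : ℂ →* ℂ)).comp chi

theorem chi_S (S : Gamma0Plus 3) (hS : ((S : SL(2, ℝ)) : Matrix (Fin 2) (Fin 2) ℝ) =
    (1 / √3) • !![0, -1; 3, 0]) : (chi S : ℂ) = -Complex.I := by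
  have hm : (S : SL(2, ℝ)) ∈ atkinLehnerSet 3 := ⟨0, -1, 1, 0, by simp [hS]⟩
  have h3 : √(3 : ℝ) * √3 = 3 := Real.mul_self_sqrt (by norm_num)
  have e : (S : SL(2, ℝ)) 1 0 = √((3 : ℕ) : ℝ) * ((1 : ℤ) : ℝ) := by
    rw [hS]; simp; field_simp; linear_combination -h3
  change chiFun S = _
  rw [chiFun_right hm e]; simp

theorem chi_R (R : Gamma0Plus 3) (hR : ((R : SL(2, ℝ)) : Matrix (Fin 2) (Fin 2) ℝ) =
    (1 / √3) • !![3, -1; 3, 0]) : (chi R : ℂ) = -Complex.I := by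
  have hm : (R : SL(2, ℝ)) ∈ atkinLehnerSet 3 := ⟨1, -1, 1, 0, by simp [hR]⟩
  have h3 : √(3 : ℝ) * √3 = 3 := Real.mul_self_sqrt (by norm_num)
  have e : (R : SL(2, ℝ)) 1 0 = √((3 : ℕ) : ℝ) * ((1 : ℤ) : ℝ) := by
    rw [hR]; simp; field_simp; linear_combination -h3
  change chiFun R = _
  rw [chiFun_right hm e]; simp

/-! ### Nearly holomorphic modular forms and quasimodular forms -/

theorem smul_slash_SL (k : ℤ) (γ : SL(2, ℝ)) (f : ℍ → ℂ) (c : ℂ) :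
    (c • f) ∣[k] (γ : GL (Fin 2) ℝ) = c • f ∣[k] (γ : GL (Fin 2) ℝ) := by
  rw [ModularForm.smul_slash]
  simp [UpperHalfPlane.σ]

/-- The function `z ↦ ∑_{j ≤ r} f_j(z) / (z - z̄)^j`. -/
def nearlySum (r : ℕ) (F : ℕ → ℍ → ℂ) : ℍ → ℂ := fun z =>
  ∑ j ∈ Finset.range (r + 1), F j z / ((z : ℂ) - (starRingEnd ℂ) (z : ℂ)) ^ j

/-- `f(γz) = χ(γ) (cz + d)^k f(z)` for `γ ∈ Γ`, and `f` has a finite limit at every cusp. Here `Γ`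
is commensurable with `SL(2, ℤ)`, so that its cusps are the points `γ∞`, `γ ∈ SL(2, ℤ)`. -/
def modularFunctions (Γ : Subgroup SL(2, ℝ)) (χ : Γ →* ℂˣ) (k : ℤ) : Submodule ℂ (ℍ → ℂ) where
  carrier := {f | (∀ γ : Γ, f ∣[k] ((γ : SL(2, ℝ)) : GL (Fin 2) ℝ) = (χ γ : ℂ) • f) ∧
    ∀ γ : SL(2, ℤ), ∃ L : ℂ, Tendsto (f ∣[k] γ) atImInfty (𝓝 L)}
  zero_mem' := ⟨fun γ => by simp, fun γ => ⟨0, by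
    rw [SlashAction.zero_slash]; exact tendsto_const_nhds⟩⟩
  add_mem' := by
    rintro f g ⟨hf, hf'⟩ ⟨hg, hg'⟩
    refine ⟨fun γ => by rw [SlashAction.add_slash, hf, hg, smul_add], fun γ => ?_⟩
    obtain ⟨L, hL⟩ := hf' γ
    obtain ⟨M, hM⟩ := hg' γ
    exact ⟨L + M, by rw [SlashAction.add_slash]; exact hL.add hM⟩
  smul_mem' := by
    rintro c f ⟨hf, hf'⟩
    refine ⟨fun γ => by rw [smul_slash_SL, hf, smul_comm], fun γ => ?_⟩
    obtain ⟨L, hL⟩ := hf' γ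
    exact ⟨c • L, by rw [ModularForm.SL_smul_slash]; exact hL.const_smul c⟩

/-- For a space `V` of functions on `ℍ`, the space of holomorphic parts `f_0` of the nearly
holomorphic functions `∑_{j ≤ r} f_j(z) / (z - z̄)^j` (all `f_j` holomorphic) that lie in `V`. -/
def holomorphicParts (V : Submodule ℂ (ℍ → ℂ)) (r : ℕ) : Submodule ℂ (ℍ → ℂ) where
  carrier := {f | ∃ F : ℕ → ℍ → ℂ, (∀ j, MDiff (F j)) ∧ F 0 = f ∧ nearlySum r F ∈ V}
  zero_mem' := by
    refine ⟨fun _ => 0, fun _ => mdifferentiable_const, rfl, ?_⟩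
    convert V.zero_mem using 1
    ext z; simp [nearlySum]
  add_mem' := by
    rintro f g ⟨F, hF, rfl, hFV⟩ ⟨G, hG, rfl, hGV⟩
    refine ⟨fun j => F j + G j, fun j => (hF j).add (hG j), rfl, ?_⟩
    convert V.add_mem hFV hGV using 1
    ext z; simp [nearlySum, add_div, Finset.sum_add_distrib]
  smul_mem' := by
    rintro c f ⟨F, hF, rfl, hFV⟩
    refine ⟨fun j => c • F j, fun j => (hF j).const_smul c, rfl, ?_⟩
    convert V.smul_mem c hFV using 1
    ext z; simp [nearlySum, Finset.mul_sum, mul_div_assoc]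

/-- The space `M̃_k^{≤ r}(Γ, χ)` of quasimodular forms of weight `k` and depth `≤ r` on `Γ` with
character `χ`. -/
def quasimodularForms (Γ : Subgroup SL(2, ℝ)) (χ : Γ →* ℂˣ) (k : ℤ) (r : ℕ) :
    Submodule ℂ (ℍ → ℂ) :=
  holomorphicParts (modularFunctions Γ χ k) r

/-- For `N` a prime power and a sign `s`, the functions `f` of weight `k` on `Γ₀(N)`, with finite
limits at the cusps, such that `f|_k w = s f` for all `w ∈ W_N`. -/
def atkinLehnerFunctions (N : ℕ) (s : ℤˣ) (k : ℤ) : Submodule ℂ (ℍ → ℂ) :=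
  modularFunctions (Gamma0R N) 1 k ⊓
  { carrier := {f | ∀ w ∈ atkinLehnerSet N, f ∣[k] (w : GL (Fin 2) ℝ) = ((s : ℤ) : ℂ) • f}
    zero_mem' := fun w _ => by simp
    add_mem' := fun {f g} hf hg w hw => by
      rw [SlashAction.add_slash, hf w hw, hg w hw, smul_add]
    smul_mem' := fun c f hf w hw => by rw [smul_slash_SL, hf w hw, smul_comm] }

/-- For `N` a prime power, the Atkin-Lehner eigenspaces `M̃_k^{≤ r}(Γ₀⁺(N), ±)` of quasimodular
forms: the holomorphic parts of the nearly holomorphic modular forms of weight `k` and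
depth `≤ r` on `Γ₀(N)` that have eigenvalue `s = ±1` under the Atkin-Lehner involution. -/
def quasimodularEigenspace (N : ℕ) (s : ℤˣ) (k : ℤ) (r : ℕ) : Submodule ℂ (ℍ → ℂ) :=
  holomorphicParts (atkinLehnerFunctions N s k) r

/-! ### Extremal quasimodular forms -/

/-- `f ∈ M` is extremal if its vanishing order at `∞`, i.e. the order of its Fourier expansion in
`q = exp(2πiz)`, is equal to `dim M - 1`. (Since `finrank` is `0` in infinite dimension, the
condition includes that `M` is finite-dimensional and nonzero.) -/
def IsExtremal (M : Submodule ℂ (ℍ → ℂ)) (f : ℍ → ℂ) : Prop :=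
  f ∈ M ∧ ∃ m : ℕ, (qExpansion 1 f).order = m ∧ Module.finrank ℂ M = m + 1

/-- Extremal elements of `M` exist and are unique up to scalars. -/
def ExtremalExistsUnique (M : Submodule ℂ (ℍ → ℂ)) : Prop :=
  (∃ f, IsExtremal M f) ∧
    ∀ f g, IsExtremal M f → IsExtremal M g → ∃ c : ℂ, c ≠ 0 ∧ g = c • f

end QuasiModular

end

noncomputable section

namespace QuasiModular

open Asymptotics Function

/-! For `N = 2, 3` the group `Γ₀⁺(N)` is generated by the translation `T` and the Fricke involution
`S`, and it has a single cusp. Being modular therefore means having period 1, obeying the law under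
`S` and being bounded at `i∞` (`IsForm`). Comparing the holomorphic components of `f₀ + f₁ / (z -
z̄)` turns depth-one forms into pairs in which `f₁` is modular of weight `k - 2` and `f₀ = g₀ + φ
f₁` with `g₀` modular of weight `k` (`IsQuasi`); here `φ` is a multiple of the logarithmic
derivative of `Δ(z) Δ(N z)`. So the dimension of the quasimodular space is governed by two spaces of
modular forms.

A nonzero modular form of weight `k` vanishes at `i∞` to order at most `k (N + 1) / 24`: otherwise
its 24th power divided by a power of `Δ(z) Δ(N z)` would be a weight-zero form vanishing at the
cusp, while weight-zero forms are constant by the maximum principle. For quasimodular forms, the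
Wronskian of `f₀` and `z f₀ + f₁` is a nonzero modular form of weight `2 k` that vanishes at least
as fast as `f₀`. Hence `f₀` has order at most `k (N + 1) / 12`.

In most weights this bound, even rounded down, exceeds the dimension minus one. The correction comes
from a generator `a` of smallest weight with value 1 at the cusp: `2 E₂(2z) - E₂(z)` for `N = 2` and
the theta series of the hexagonal lattice for `N = 3`. Its Serre derivative has the opposite sign
under `S`, and a combination `genDisc` of the two has a simple zero at the cusp and none in `ℍ`.
Division by `genDisc` shows that all forms of a given weight and sign share a factor `a ^ r`.
Quasimodular forms inherit such a factor, which does not change the order at the cusp, and after it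
is removed the Wronskian bound in the lower weight is sharp.

Multiplication by `genDisc` also yields a lower bound `d + 1` for the dimension, with the same `d`
as in the order bound. The first `d + 1` Fourier coefficients then map the space isomorphically onto
`ℂ ^ (d + 1)`, which gives existence and uniqueness together. -/

/-- The local parameter `q = exp (2 π i z)` at the cusp `∞`. -/
def qPar (z : ℍ) : ℂ := Periodic.qParam 1 z

theorem qPar_ne_zero (z : ℍ) : qPar z ≠ 0 := Periodic.qParam_ne_zero _

theorem norm_qPar (z : ℍ) : ‖qPar z‖ = Real.exp (-2 * Real.pi * z.im) := by
  simp [qPar, Periodic.norm_qParam]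

theorem norm_qPar_zpow (z : ℍ) (m : ℤ) :
    ‖qPar z ^ m‖ = Real.exp (-2 * Real.pi * m * z.im) := by
  rw [norm_zpow, norm_qPar, ← Real.rpow_intCast, ← Real.exp_mul]
  ring_nf

theorem tendsto_qPar : Tendsto qPar atImInfty (𝓝 0) := qParam_tendsto_atImInfty one_pos

theorem qPar_vadd (z : ℍ) : qPar ((1 : ℝ) +ᵥ z) = qPar z := by
  simp only [qPar, Periodic.qParam, coe_vadd]
  rw [Complex.exp_eq_exp_iff_exists_int]
  exact ⟨1, by push_cast; ring⟩

theorem mdifferentiable_qPar : MDiff qPar := by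
  rw [UpperHalfPlane.mdifferentiable_iff]
  refine (Periodic.differentiable_qParam (h := 1)).differentiableOn.congr fun z hz => ?_
  simp [qPar, ofComplex_apply_of_im_pos hz]

theorem qPar_pow_isBigO {m n : ℤ} (h : m ≤ n) :
    (fun z => qPar z ^ n) =O[atImInfty] fun z => qPar z ^ m := by
  refine .of_bound 1 ?_
  refine Eventually.of_forall fun z => ?_
  rw [one_mul, norm_zpow, norm_zpow]
  refine zpow_le_zpow_right_of_le_one₀ (norm_pos_iff.2 (qPar_ne_zero z)) ?_ h
  rw [norm_qPar, Real.exp_le_one_iff]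
  nlinarith [Real.pi_pos, z.im_pos]

theorem mdifferentiable_div {f g : ℍ → ℂ} (hf : MDiff f) (hg : MDiff g) (h0 : ∀ z, g z ≠ 0) :
    MDiff (fun z => f z / g z) := by
  rw [UpperHalfPlane.mdifferentiable_iff] at *
  exact hf.div hg fun z _ => h0 _

/-! ### Periodic holomorphic functions that are bounded at the cusp -/

/-- Holomorphic functions with period `1` that are bounded at `i∞`. -/
structure Regular (f : ℍ → ℂ) : Prop where
  holo : MDiff f
  vadd : ∀ z, f ((1 : ℝ) +ᵥ z) = f z
  bdd : IsBoundedAtImInfty f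

theorem periodic_comp_ofComplex {f : ℍ → ℂ} (hf : ∀ z, f ((1 : ℝ) +ᵥ z) = f z) :
    Periodic (f ∘ ofComplex) (1 : ℝ) := by
  intro w
  rcases lt_or_ge 0 w.im with hw | hw
  · have : 0 < (w + (1 : ℝ)).im := by simpa using hw
    simp only [comp_apply, ofComplex_apply_of_im_pos this, ofComplex_apply_of_im_pos hw]
    rw [← hf ⟨w, hw⟩]
    congr 1
    ext
    simp [add_comm]
  · have : (w + (1 : ℝ)).im ≤ 0 := by simpa using hw
    rw [comp_apply, comp_apply, ofComplex_apply_of_im_nonpos hw, ofComplex_apply_of_im_nonpos this]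

namespace Regular

variable {f g : ℍ → ℂ}

theorem const (c : ℂ) : Regular fun _ => c :=
  ⟨mdifferentiable_const, fun _ => rfl, const_boundedAtFilter _ _⟩

theorem add (hf : Regular f) (hg : Regular g) : Regular (f + g) :=
  ⟨hf.holo.add hg.holo, fun z => by simp [hf.vadd, hg.vadd], hf.bdd.add hg.bdd⟩

theorem mul (hf : Regular f) (hg : Regular g) : Regular (f * g) :=
  ⟨hf.holo.mul hg.holo, fun z => by simp [hf.vadd, hg.vadd], hf.bdd.mul hg.bdd⟩

theorem smul (c : ℂ) (hf : Regular f) : Regular (c • f) := (const c).mul hf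

theorem sub (hf : Regular f) (hg : Regular g) : Regular (f - g) := by
  simpa [sub_eq_add_neg] using hf.add (hg.smul (-1))

theorem analyticAt (hf : Regular f) : AnalyticAt ℂ (cuspFunction 1 f) 0 :=
  analyticAt_cuspFunction_zero one_pos (periodic_comp_ofComplex hf.vadd) hf.holo hf.bdd

theorem exists_limit (hf : Regular f) :
    ∃ c : ℂ, (fun z => f z - c) =O[atImInfty] qPar := by
  refine ⟨valueAtInfty f, ?_⟩
  have := exp_decay_sub_atImInfty one_pos (periodic_comp_ofComplex hf.vadd) hf.holo hf.bdd
  refine this.trans (.of_bound 1 (Eventually.of_forall fun z => ?_))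
  simp [norm_qPar]

theorem isBigO_qPar_of_tendsto (hf : Regular f) (h0 : Tendsto f atImInfty (𝓝 0)) :
    f =O[atImInfty] qPar := by
  obtain ⟨c, hc⟩ := hf.exists_limit
  have h1 : Tendsto (fun z => f z - c) atImInfty (𝓝 0) := hc.trans_tendsto tendsto_qPar
  have h2 : Tendsto (fun z => f z - c) atImInfty (𝓝 (0 - c)) := h0.sub_const c
  have : c = 0 := by simpa using tendsto_nhds_unique h1 h2
  simpa [this] using hc

theorem isBigO_of_coeff (hf : Regular f) (m : ℕ)
    (h : ∀ i < m, (qExpansion 1 f).coeff i = 0) : f =O[atImInfty] fun z => qPar z ^ (m : ℤ) := by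
  have hper := periodic_comp_ofComplex hf.vadd
  have hs := hasFPowerSeriesOnBall_cuspFunction one_pos hf.analyticAt
    (hasSum_qExpansion one_pos hper hf.holo hf.bdd)
  have h1 := hs.hasFPowerSeriesAt.isBigO_sub_partialSum_pow m
  have h2 : ∀ y, (FormalMultilinearSeries.ofScalars ℂ
      fun m => (qExpansion 1 f).coeff m).partialSum m y = 0 := by
    intro y
    refine Finset.sum_eq_zero fun i hi => ?_
    simp [FormalMultilinearSeries.ofScalars, h i (Finset.mem_range.1 hi)]
  simp only [h2, sub_zero, zero_add] at h1
  have h3 := h1.comp_tendsto tendsto_qPar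
  refine h3.congr' (Eventually.of_forall fun z => ?_) EventuallyEq.rfl |>.trans
    (.of_bound 1 (Eventually.of_forall fun z => ?_))
  · exact eq_cuspFunction z one_ne_zero hper
  · simp

theorem eq_zero_of_mul_eq_zero (hf : MDiff f) (hg : MDiff g) (h : f * g = 0) : f = 0 ∨ g = 0 :=
  (UpperHalfPlane.mul_eq_zero_iff hf hg).1 h

end Regular

/-! ### The Fricke involution -/

/-- The map `z ↦ -1 / (N z)`. -/
def fricke (N : ℕ) [NeZero N] (z : ℍ) : ℍ :=
  ⟨-1 / (N * z), by
    have hN : (0 : ℝ) < N := by exact_mod_cast Nat.pos_of_ne_zero (NeZero.ne N)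
    have : ((-1 : ℂ) / (N * z)) = ((1 / N : ℝ) : ℂ) * (-(z : ℂ))⁻¹ := by
      have := z.ne_zero
      have : (N : ℂ) ≠ 0 := NeZero.ne _
      push_cast
      field_simp
    rw [this, Complex.im_ofReal_mul]
    exact mul_pos (by positivity) z.im_inv_neg_coe_pos⟩

theorem coe_fricke (N : ℕ) [NeZero N] (z : ℍ) : (fricke N z : ℂ) = -1 / (N * z) := rfl

/-- The automorphy factor of the Fricke involution. -/
def frickeFactor (N : ℕ) (z : ℍ) : ℂ := (√(N : ℝ) : ℝ) * (z : ℂ)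

theorem sqrt_mul_sqrt (N : ℕ) : ((√(N : ℝ) : ℝ) : ℂ) * ((√(N : ℝ) : ℝ) : ℂ) = N := by
  rw [← Complex.ofReal_mul, Real.mul_self_sqrt (Nat.cast_nonneg N), Complex.ofReal_natCast]

theorem sqrt_ne_zero (N : ℕ) [NeZero N] : ((√(N : ℝ) : ℝ) : ℂ) ≠ 0 := by
  intro h
  have := sqrt_mul_sqrt N
  rw [h, mul_zero] at this
  exact NeZero.ne (N : ℂ) this.symm

theorem frickeFactor_ne_zero (N : ℕ) [NeZero N] (z : ℍ) : frickeFactor N z ≠ 0 :=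
  mul_ne_zero (sqrt_ne_zero N) z.ne_zero

theorem frickeFactor_sq (N : ℕ) (z : ℍ) : frickeFactor N z ^ 2 = N * (z : ℂ) ^ 2 := by
  rw [frickeFactor, mul_pow, sq (((√(N : ℝ) : ℝ) : ℂ)), sqrt_mul_sqrt]

/-- Regular functions with the behaviour of a modular form of weight `k` and eigenvalue `σ` under
the Fricke involution. -/
structure IsForm (N : ℕ) [NeZero N] (k : ℤ) (σ : ℂ) (f : ℍ → ℂ) : Prop extends Regular f where
  fricke : ∀ z, f (fricke N z) = σ * frickeFactor N z ^ k * f z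

/-- Pairs `(f₀, f₁)` such that `f₀ + f₁ / (z - z̄)` behaves like a modular form of weight `k`
and eigenvalue `σ` under the Fricke involution. -/
structure IsQuasi (N : ℕ) [NeZero N] (k : ℤ) (σ : ℂ) (f₀ f₁ : ℍ → ℂ) : Prop extends
    Regular f₀ where
  snd : IsForm N (k - 2) σ f₁
  fricke : ∀ z, f₀ (fricke N z) = σ * frickeFactor N z ^ k * (f₀ z + f₁ z / z)

namespace IsForm

variable {N : ℕ} [NeZero N] {k l : ℤ} {σ τ : ℂ} {f g : ℍ → ℂ}

theorem mul (hf : IsForm N k σ f) (hg : IsForm N l τ g) : IsForm N (k + l) (σ * τ) (f * g) where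
  toRegular := hf.toRegular.mul hg.toRegular
  fricke z := by
    rw [Pi.mul_apply, hf.fricke, hg.fricke, zpow_add₀ (frickeFactor_ne_zero N z), Pi.mul_apply]
    ring

theorem smul (c : ℂ) (hf : IsForm N k σ f) : IsForm N k σ (c • f) where
  toRegular := hf.toRegular.smul c
  fricke z := by simp [hf.fricke]; ring

theorem add (hf : IsForm N k σ f) (hg : IsForm N k σ g) : IsForm N k σ (f + g) where
  toRegular := hf.toRegular.add hg.toRegular
  fricke z := by simp [hf.fricke, hg.fricke]; ring

theorem sub (hf : IsForm N k σ f) (hg : IsForm N k σ g) : IsForm N k σ (f - g) := by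
  simpa [sub_eq_add_neg] using hf.add (hg.smul (-1))

theorem const (c : ℂ) : IsForm N 0 1 fun _ => c where
  toRegular := .const c
  fricke z := by simp

theorem zero : IsForm N k σ 0 where
  toRegular := .const 0
  fricke z := by simp

theorem pow (hf : IsForm N k σ f) (n : ℕ) : IsForm N (k * n) (σ ^ n) (f ^ n) := by
  induction n with
  | zero => simpa using! const 1
  | succ n ih =>
    rw [pow_succ, pow_succ]
    convert ih.mul hf using 1
    push_cast; ring

theorem div (hf : IsForm N k σ f) (hg : IsForm N l τ g) (h0 : ∀ z, g z ≠ 0) (hfg : f =O[atImInfty] g) :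
    IsForm N (k - l) (σ / τ) fun z => f z / g z where
  holo := mdifferentiable_div hf.holo hg.holo h0
  vadd z := by rw [hf.vadd, hg.vadd]
  bdd := by
    obtain ⟨c, hc⟩ := hfg.bound
    refine .of_bound c ?_
    filter_upwards [hc] with z hz
    simp only [norm_div, Pi.one_apply, norm_one, mul_one]
    rwa [div_le_iff₀ (norm_pos_iff.2 (h0 z))]
  fricke z := by
    rw [hf.fricke, hg.fricke, zpow_sub₀ (frickeFactor_ne_zero N z), mul_div_mul_comm, mul_div_mul_comm]

end IsForm

/-! ### Derivatives -/

open scoped Derivative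

theorem D_apply (f : ℍ → ℂ) (z : ℍ) :
    D f z = (2 * Real.pi * Complex.I)⁻¹ * deriv (f ∘ ofComplex) z := rfl

theorem hasDerivAt_comp_ofComplex {f : ℍ → ℂ} (hf : MDiff f) (z : ℍ) :
    HasDerivAt (f ∘ ofComplex) (2 * Real.pi * Complex.I * D f z) z := by
  rw [D_apply, mul_inv_cancel_left₀ Complex.two_pi_I_ne_zero]
  exact (UpperHalfPlane.mdifferentiableAt_iff.mp (hf z)).hasDerivAt

theorem D_eq_of_hasDerivAt {f : ℍ → ℂ} {z : ℍ} {d : ℂ} (h : HasDerivAt (f ∘ ofComplex) d z) :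
    D f z = (2 * Real.pi * Complex.I)⁻¹ * d := by
  rw [D_apply, h.deriv]

/-- Differentiating a function composed with the Fricke involution. -/
theorem D_comp_fricke (N : ℕ) [NeZero N] {f : ℍ → ℂ} (hf : MDiff f) (z : ℍ) :
    D f (fricke N z) = N * (z : ℂ) ^ 2 * D (fun z => f (fricke N z)) z := by
  have hz := z.ne_zero
  have hN : (N : ℂ) ≠ 0 := NeZero.ne _
  have h1 := hasDerivAt_comp_ofComplex hf (fricke N z)
  rw [coe_fricke] at h1
  have h2 : HasDerivAt (fun w : ℂ => -1 / (N * w)) (1 / (N * (z : ℂ) ^ 2)) z := by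
    have h := (((hasDerivAt_id (z : ℂ)).const_mul (N : ℂ)).inv (mul_ne_zero hN hz)).neg
    have e1 : (fun w : ℂ => -1 / (N * w)) = -(fun y => (N : ℂ) * id y)⁻¹ := by
      ext w; simp [neg_div]
    have e2 : 1 / (N * (z : ℂ) ^ 2) = -(-((N : ℂ) * 1) / (N * id (z : ℂ)) ^ 2) := by
      simp only [id, mul_one]; field_simp
    rw [e1, e2]
    exact h
  have h3 := h1.comp (z : ℂ) h2
  have h4 : HasDerivAt ((fun z => f (fricke N z)) ∘ ofComplex)
      (2 * Real.pi * Complex.I * D f (fricke N z) * (1 / (N * (z : ℂ) ^ 2))) z := by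
    refine h3.congr_of_eventuallyEq ?_
    filter_upwards [isOpen_upperHalfPlaneSet.mem_nhds z.im_pos] with w hw
    have : (-1 / (N * w) : ℂ) = (fricke N ⟨w, hw⟩ : ℂ) := rfl
    simp only [comp_apply, this, ofComplex_apply, ofComplex_apply_of_im_pos hw]
  rw [D_eq_of_hasDerivAt h4]
  have := Complex.two_pi_I_ne_zero
  field_simp

theorem D_vadd {f : ℍ → ℂ} (hf : ∀ z, f ((1 : ℝ) +ᵥ z) = f z) (z : ℍ) :
    D f ((1 : ℝ) +ᵥ z) = D f z := by
  have h := periodic_comp_ofComplex hf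
  have : deriv (f ∘ ofComplex) (((1 : ℝ) +ᵥ z : ℍ) : ℂ) = deriv (f ∘ ofComplex) (z : ℂ) := by
    have h2 : (fun w => (f ∘ ofComplex) (w + (1 : ℝ))) = f ∘ ofComplex := funext h
    conv_rhs => rw [← h2, deriv_comp_add_const]
    congr 1
    simp [add_comm]
  rw [D_apply, this, D_apply]

/-- Cauchy's estimate: `D` preserves the vanishing order at `i∞`. -/
theorem D_isBigO {f : ℍ → ℂ} (hf : MDiff f) {m : ℤ}
    (h : f =O[atImInfty] fun z => qPar z ^ m) :
    D f =O[atImInfty] fun z => qPar z ^ m := by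
  obtain ⟨c, hc⟩ := h.bound
  obtain ⟨A, hA⟩ := (atImInfty_mem _).1 hc
  have hc0 : ∀ z : ℍ, A ≤ z.im → ‖f z‖ ≤ |c| * Real.exp (-2 * Real.pi * m * z.im) := by
    intro z hz
    refine (hA z hz).trans ?_
    rw [norm_qPar_zpow]
    exact mul_le_mul_of_nonneg_right (le_abs_self c) (Real.exp_pos _).le
  -- On the unit disc about `z` the imaginary part moves by at most 1, so `‖q ^ m‖` changes by a
  -- factor of at most `exp (2 π |m|)`.
  refine .of_bound (‖(2 * Real.pi * Complex.I : ℂ)⁻¹‖ * (|c| * Real.exp (2 * Real.pi * |m|))) ?_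
  refine (atImInfty_mem _).2 ⟨max (A + 1) 2, fun z hz => ?_⟩
  have hzA : A + 1 ≤ z.im := (le_max_left _ _).trans hz
  have hz2 : 2 ≤ z.im := (le_max_right _ _).trans hz
  have him : ∀ w ∈ Metric.closedBall (z : ℂ) 1, z.im - 1 ≤ w.im ∧ w.im ≤ z.im + 1 := by
    intro w hw
    have h1 : |(w - z).im| ≤ 1 := (Complex.abs_im_le_norm _).trans (by simpa [dist_eq_norm] using hw)
    rw [Complex.sub_im, abs_le, coe_im] at h1
    constructor <;> linarith [h1.1, h1.2]
  have hpos : ∀ w ∈ Metric.closedBall (z : ℂ) 1, 0 < w.im := fun w hw => by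
    linarith [(him w hw).1]
  have hd : DiffContOnCl ℂ (f ∘ ofComplex) (Metric.ball (z : ℂ) 1) := by
    refine DifferentiableOn.diffContOnCl ?_
    rw [closure_ball _ one_ne_zero]
    exact (UpperHalfPlane.mdifferentiable_iff.1 hf).mono hpos
  have hb := Complex.norm_deriv_le_of_forall_mem_sphere_norm_le (C := |c| *
    Real.exp (2 * Real.pi * |m|) * Real.exp (-2 * Real.pi * m * z.im)) one_pos hd (by
      intro w hw
      have hw' := Metric.sphere_subset_closedBall hw
      have h1 := him w hw'
      rw [comp_apply, ofComplex_apply_of_im_pos (hpos w hw')]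
      refine (hc0 ⟨w, _⟩ (show A ≤ w.im by linarith)).trans ?_
      rw [mul_assoc |c|, ← Real.exp_add]
      refine mul_le_mul_of_nonneg_left (Real.exp_le_exp.2 ?_) (abs_nonneg c)
      change -2 * Real.pi * m * w.im ≤ _
      have h2 : (m : ℝ) * (z.im - w.im) ≤ |(m : ℝ)| * 1 := by
        refine (le_abs_self _).trans ?_
        rw [abs_mul]
        refine mul_le_mul_of_nonneg_left ?_ (abs_nonneg _)
        rw [abs_le]; constructor <;> linarith [h1.1, h1.2]
      push_cast
      nlinarith [Real.pi_pos])
  change ‖D f z‖ ≤ _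
  rw [div_one] at hb
  rw [D_apply, norm_mul, norm_qPar_zpow]
  exact (mul_le_mul_of_nonneg_left hb (norm_nonneg _)).trans_eq (by ring)

theorem isBoundedAtImInfty_iff_isBigO {f : ℍ → ℂ} :
    IsBoundedAtImInfty f ↔ f =O[atImInfty] fun z => qPar z ^ (0 : ℤ) := by
  simp only [zpow_zero]
  have h1 : (1 : ℍ → ℝ) =O[atImInfty] fun _ : ℍ => (1 : ℂ) := .of_bound 1 (by simp)
  have h2 : (fun _ : ℍ => (1 : ℂ)) =O[atImInfty] (1 : ℍ → ℝ) := .of_bound 1 (by simp)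
  unfold IsBoundedAtImInfty BoundedAtFilter
  exact ⟨fun h => h.trans h1, fun h => h.trans h2⟩

theorem Regular.isBigO_one {f : ℍ → ℂ} (hf : Regular f) :
    f =O[atImInfty] fun z => qPar z ^ (0 : ℤ) :=
  isBoundedAtImInfty_iff_isBigO.1 hf.bdd

theorem Regular.D {f : ℍ → ℂ} (hf : Regular f) : Regular (D f) where
  holo := Derivative.normalizedDerivOfComplex_mdifferentiable hf.holo
  vadd := D_vadd hf.vadd
  bdd := isBoundedAtImInfty_iff_isBigO.2 (D_isBigO hf.holo hf.isBigO_one)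

/-- The derivative of a regular function vanishes at `i∞`. -/
theorem Regular.D_isBigO_qPar {f : ℍ → ℂ} (hf : Regular f) :
    Derivative.normalizedDerivOfComplex f =O[atImInfty] qPar := by
  obtain ⟨c, hc⟩ := hf.exists_limit
  have h := D_isBigO (f := f - fun _ => c) (m := 1) (hf.holo.sub mdifferentiable_const)
    (by simpa using! hc)
  rw [Derivative.normalizedDerivOfComplex_sub _ _ hf.holo mdifferentiable_const,
    Derivative.normalizedDerivOfComplex_const, sub_zero] at h
  simpa using h

/-! ### Generators and cosets of `Γ₀⁺(N)` -/

/-- The Fricke matrix `(1/√N) (0, -1; N, 0)`. -/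
def frickeS (N : ℕ) [NeZero N] : SL(2, ℝ) :=
  ⟨!![0, -1 / √(N : ℝ); √(N : ℝ), 0], by
    have : √(N : ℝ) ≠ 0 := Real.sqrt_ne_zero'.2 (by exact_mod_cast Nat.pos_of_ne_zero (NeZero.ne N))
    rw [Matrix.det_fin_two_of]
    field_simp
    ring⟩

/-- The translation matrix `(1, 1; 0, 1)`. -/
def transT : SL(2, ℝ) := ⟨!![1, 1; 0, 1], by simp⟩

theorem slash_apply_SL (f : ℍ → ℂ) (k : ℤ) (g : SL(2, ℝ)) (z : ℍ) :
    (f ∣[k] (g : GL (Fin 2) ℝ)) z = f (g • z) * ((g 1 0 : ℂ) * z + g 1 1) ^ (-k) := by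
  rw [ModularForm.slash_apply]
  simp [UpperHalfPlane.σ, denom]
  exact Or.inl rfl

theorem transT_mem {N : ℕ} : transT ∈ Gamma0R N :=
  mem_Gamma0R_of (a := 1) (b := 1) (c := 0) (d := 1)
    (by simp [transT]) (by simp [transT]) (by simp [transT]) (by simp [transT])

theorem natCast_sqrt_sq {N : ℕ} : √(N : ℝ) * √(N : ℝ) = N := Real.mul_self_sqrt (Nat.cast_nonneg N)

section

variable {N : ℕ} [NeZero N]

theorem natCast_sqrt_pos : 0 < √(N : ℝ) :=
  Real.sqrt_pos.2 (by exact_mod_cast Nat.pos_of_ne_zero (NeZero.ne N))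

theorem frickeS_smul (z : ℍ) : frickeS N • z = fricke N z := by
  have h := sqrt_ne_zero N
  have h2 := sqrt_mul_sqrt N
  have hz := z.ne_zero
  have hN : (N : ℂ) ≠ 0 := NeZero.ne _
  ext
  rw [coe_specialLinearGroup_apply, coe_fricke]
  simp [frickeS]
  rw [← h2]
  field_simp

theorem transT_smul (z : ℍ) : transT • z = (1 : ℝ) +ᵥ z := by
  ext
  rw [coe_specialLinearGroup_apply]
  simp [transT, add_comm]

theorem frickeS_mem : frickeS N ∈ atkinLehnerSet N :=
  mem_atkinLehnerSet_of natCast_sqrt_pos (a := 0) (b := -1) (c := 1) (d := 0)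
    (by simp [frickeS]) (by simp [frickeS]) (by simp [frickeS]) (by simp [frickeS])

theorem frickeS_mul_self : frickeS N * frickeS N = -1 := by
  have h := (natCast_sqrt_pos (N := N)).ne'
  ext i j
  rw [sl_mul_apply]
  fin_cases i <;> fin_cases j <;> simp [frickeS] <;> field_simp

theorem transT_zpow (m : ℤ) :
    ((transT ^ m : SL(2, ℝ)) : Matrix (Fin 2) (Fin 2) ℝ) = !![1, (m : ℝ); 0, 1] := by
  have h : ∀ n : ℕ, ((transT ^ n : SL(2, ℝ)) : Matrix (Fin 2) (Fin 2) ℝ) = !![1, (n : ℝ); 0, 1] := by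
    intro n
    induction n with
    | zero => ext i j; fin_cases i <;> fin_cases j <;> simp
    | succ n ih =>
      rw [pow_succ, Matrix.SpecialLinearGroup.coe_mul, ih]
      ext i j
      fin_cases i <;> fin_cases j <;> simp [transT, Matrix.mul_apply, Fin.sum_univ_two, add_comm]
  obtain ⟨n, rfl | rfl⟩ := m.eq_nat_or_neg
  · simpa using h n
  · rw [zpow_neg, zpow_natCast, Matrix.SpecialLinearGroup.coe_inv, h, Matrix.adjugate_fin_two_of]
    simp

omit [NeZero N] in
theorem exists_nat_of_mem {g : SL(2, ℝ)} (hg : g ∈ Gamma0Plus N) :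
    ∃ m : ℕ, g 1 0 ^ 2 = N * m := by
  rcases hg with hg | hg
  · obtain ⟨a, b, c, d, -, -, -, h, -⟩ := mem_Gamma0R_entries hg
    refine ⟨N * c.natAbs ^ 2, ?_⟩
    rw [h]; push_cast [Nat.cast_natAbs]; rw [sq_abs]; ring
  · obtain ⟨hs, a, b, c, d, -, -, -, h, -⟩ := mem_atkinLehnerSet hg
    refine ⟨c.natAbs ^ 2, ?_⟩
    rw [h, mul_pow, sq √(N : ℝ), natCast_sqrt_sq]; push_cast [Nat.cast_natAbs]; rw [sq_abs]

/-- This is the Euclidean algorithm on the bottom row. Right multiplication by `T ^ t` and then by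
`S` replaces the lower left entry `c` by `√N (d + t c)`, and `t` can be chosen with `|d + t c| ≤ |c|
/ 2`. So `c²` shrinks by the factor `N / 4 < 1`, and the descent stops because `c² / N` is a natural
number. -/
theorem Gamma0Plus_induction (h1 : 1 < N) (h4 : N < 4) {p : SL(2, ℝ) → Prop} (one : p 1)
    (mulS : ∀ g ∈ Gamma0Plus N, p g → p (g * frickeS N))
    (mulT : ∀ g ∈ Gamma0Plus N, p g → ∀ m : ℤ, p (g * transT ^ m)) :
    ∀ g ∈ Gamma0Plus N, p g := by
  have hS : frickeS N ∈ Gamma0Plus N := Or.inr frickeS_mem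
  have hT : ∀ m : ℤ, transT ^ m ∈ Gamma0Plus N := fun m => Or.inl (zpow_mem transT_mem m)
  have key : ∀ m : ℕ, ∀ g ∈ Gamma0Plus N, g 1 0 ^ 2 = N * m → p g := by
    intro m
    induction m using Nat.strong_induction_on with
    | _ m ih =>
    intro g hg hm
    rcases Nat.eq_zero_or_pos m with rfl | hpos
    · have h0 : g 1 0 = 0 := by simpa using hm
      rcases hg with hg | hg
      · obtain ⟨a, b, c, d, hdet, g00, g01, g10, g11⟩ := mem_Gamma0R_entries hg
        have hc : c * N = 0 := by exact_mod_cast g10.symm.trans h0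
        rw [hc, mul_zero, sub_zero] at hdet
        -- With lower left entry zero the matrix is `T ^ b` or `-T ^ (-b)`, and `-1 = S²`.
        have hp1 := mulT 1 (one_mem _) one b
        have hp2 := mulT _ (mul_mem (mul_mem (one_mem _) hS) hS)
          (mulS _ (mul_mem (one_mem _) hS) (mulS 1 (one_mem _) one)) (-b)
        rw [one_mul, frickeS_mul_self] at hp2
        rw [one_mul] at hp1
        rcases Int.mul_eq_one_iff_eq_one_or_neg_one.1 hdet with ⟨rfl, rfl⟩ | ⟨rfl, rfl⟩
        · convert hp1
          ext i j
          rw [transT_zpow]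
          fin_cases i <;> fin_cases j <;> simp [g00, g01, h0, g11]
        · convert hp2
          ext i j
          rw [neg_one_mul, Matrix.SpecialLinearGroup.coe_neg, transT_zpow]
          fin_cases i <;> fin_cases j <;> simp [g00, g01, h0, g11]
      · obtain ⟨hs, a, b, c, d, hdet, -, -, g10, -⟩ := mem_atkinLehnerSet hg
        have hc : c = 0 := by
          have : √(N : ℝ) * c = 0 := g10.symm.trans h0
          simpa [hs.ne'] using this
        rw [hc, mul_zero, sub_zero] at hdet
        have := Int.eq_one_or_neg_one_of_mul_eq_one hdet
        omega
    · have hu : g 1 0 ≠ 0 := by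
        intro h0
        rw [h0] at hm
        have : (N : ℝ) * m ≠ 0 := mul_ne_zero (NeZero.ne _) (by exact_mod_cast hpos.ne')
        exact this (by rw [← hm]; ring)
      set t : ℤ := -round (g 1 1 / g 1 0) with ht
      set g' := g * transT ^ t * frickeS N with hg'
      have hgT : g * transT ^ t ∈ Gamma0Plus N := mul_mem hg (hT t)
      have hmem : g' ∈ Gamma0Plus N := mul_mem hgT hS
      have e : g' 1 0 = √(N : ℝ) * (g 1 1 + t * g 1 0) := by
        rw [hg', sl_mul_apply, sl_mul_apply, sl_mul_apply, transT_zpow]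
        simp [frickeS]; ring
      obtain ⟨m', hm'⟩ := exists_nat_of_mem hmem
      have hN : (0 : ℝ) < N := by exact_mod_cast Nat.pos_of_ne_zero (NeZero.ne N)
      have hv : (g 1 1 + t * g 1 0) ^ 2 = m' := by
        rw [e, mul_pow, sq √(N : ℝ), natCast_sqrt_sq] at hm'
        exact mul_left_cancel₀ hN.ne' hm'
      have hle : (g 1 1 + t * g 1 0) ^ 2 ≤ g 1 0 ^ 2 / 4 := by
        have h2 := abs_sub_round (g 1 1 / g 1 0)
        have h3 : g 1 1 + t * g 1 0 = (g 1 1 / g 1 0 - round (g 1 1 / g 1 0)) * g 1 0 := by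
          rw [ht]; push_cast; field_simp; ring
        rw [h3, mul_pow, ← sq_abs (_ - _)]
        have : |g 1 1 / g 1 0 - round (g 1 1 / g 1 0)| ^ 2 ≤ (1 / 2) ^ 2 :=
          pow_le_pow_left₀ (abs_nonneg _) h2 2
        nlinarith [sq_nonneg (g 1 0)]
      have hlt : m' < m := by
        rw [hv, hm] at hle
        have : (N : ℝ) < 4 := by exact_mod_cast h4
        have hmp : (0 : ℝ) < m := by exact_mod_cast hpos
        have : (m' : ℝ) < m := by nlinarith
        exact_mod_cast this
      have hp := ih m' hlt g' hmem hm'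
      -- Only multiplication by `S` itself is available, so `S⁻¹` is applied as `S³`, using `S⁴ =
      -- 1`.
      have hp2 := mulS _ (mul_mem (mul_mem hmem hS) hS)
        (mulS _ (mul_mem hmem hS) (mulS _ hmem hp))
      have e2 : g' * frickeS N * frickeS N * frickeS N = g * transT ^ t := by
        have h := frickeS_mul_self (N := N)
        rw [hg']
        simp only [mul_assoc, h]
        simp
      rw [e2] at hp2
      have hp3 := mulT _ hgT hp2 (-t)
      rwa [mul_assoc, ← zpow_add, add_neg_cancel, zpow_zero, mul_one] at hp3
  intro g hg
  obtain ⟨m, hm⟩ := exists_nat_of_mem hg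
  exact key m g hg hm

theorem slash_zpow_eq {f : ℍ → ℂ} {k : ℤ} {g : SL(2, ℝ)} (hf : f ∣[k] (g : GL (Fin 2) ℝ) = f)
    (m : ℤ) : f ∣[k] ((g ^ m : SL(2, ℝ)) : GL (Fin 2) ℝ) = f := by
  have h : ∀ n : ℕ, f ∣[k] ((g ^ n : SL(2, ℝ)) : GL (Fin 2) ℝ) = f := by
    intro n
    induction n with
    | zero => rw [pow_zero, map_one, SlashAction.slash_one]
    | succ n ih => rw [pow_succ, map_mul, SlashAction.slash_mul, ih, hf]
  obtain ⟨n, rfl | rfl⟩ := m.eq_nat_or_neg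
  · rw [zpow_natCast, h]
  · conv_lhs => rw [← h n]
    rw [← SlashAction.slash_mul, ← map_mul, zpow_neg, zpow_natCast, mul_inv_cancel, map_one,
      SlashAction.slash_one]

/-- A function that transforms by a multiplicative `ψ` under the generators of `Γ₀⁺(N)` does so
under the whole group. -/
theorem slash_eq_of_generators (h1 : 1 < N) (h4 : N < 4) {f : ℍ → ℂ} {k : ℤ} {σ : ℂ}
    {ψ : SL(2, ℝ) → ℂ} (ψ1 : ψ 1 = 1)
    (ψS : ∀ g ∈ Gamma0Plus N, ψ (g * frickeS N) = ψ g * σ)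
    (ψT : ∀ g ∈ Gamma0Plus N, ∀ m : ℤ, ψ (g * transT ^ m) = ψ g)
    (fS : f ∣[k] (frickeS N : GL (Fin 2) ℝ) = σ • f) (fT : f ∣[k] (transT : GL (Fin 2) ℝ) = f) :
    ∀ g ∈ Gamma0Plus N, f ∣[k] (g : GL (Fin 2) ℝ) = ψ g • f := by
  refine Gamma0Plus_induction h1 h4 ?_ ?_ ?_
  · rw [map_one, SlashAction.slash_one, ψ1, one_smul]
  · intro g hg h
    rw [map_mul, SlashAction.slash_mul, h, smul_slash_SL, fS, ψS g hg, smul_smul]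
  · intro g hg h m
    rw [map_mul, SlashAction.slash_mul, h, smul_slash_SL, slash_zpow_eq fT, ψT g hg]

/-- For `N` prime, an element of `SL(2, ℤ)` is in `Γ₀⁺(N)` up to an upper triangular matrix. -/
theorem exists_coset (hN : N.Prime) (γ : SL(2, ℤ)) :
    ∃ g ∈ Gamma0Plus N, ∃ u : SL(2, ℝ), u 1 0 = 0 ∧ (u 1 1 = 1 ∨ u 1 1 = √(N : ℝ)) ∧
      (Matrix.SpecialLinearGroup.map (Int.castRingHom ℝ) γ : SL(2, ℝ)) = g * u := by
  by_cases h : (N : ℤ) ∣ γ 1 0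
  · refine ⟨_, Or.inl ⟨γ, ?_, rfl⟩, 1, by simp, Or.inl (by simp), by simp⟩
    exact CongruenceSubgroup.Gamma0_mem.2 ((ZMod.intCast_zmod_eq_zero_iff_dvd _ _).2 h)
  · have hdet : γ 0 0 * γ 1 1 - γ 0 1 * γ 1 0 = 1 := by
      rw [← Matrix.det_fin_two]; exact γ.det_coe
    have hco : IsCoprime ((N : ℤ) * γ 0 0) (γ 1 0) := by
      refine IsCoprime.mul_left ?_ ⟨γ 1 1, -γ 0 1, by linear_combination hdet⟩
      exact (Nat.prime_iff_prime_int.1 hN).coprime_iff_not_dvd.2 h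
    obtain ⟨t, y, hty⟩ := hco
    have hs := natCast_sqrt_pos (N := N)
    have hsq := natCast_sqrt_sq (N := N)
    have hdw : (√(N : ℝ) * γ 0 0) * (√(N : ℝ) * t) - (-y / √(N : ℝ)) * (√(N : ℝ) * γ 1 0) = 1 := by
      have : ((t * (N * γ 0 0) + y * γ 1 0 : ℤ) : ℝ) = 1 := by rw [hty]; simp
      push_cast at this
      field_simp
      rw [← this, sq, hsq]; ring
    -- The first column of `w` is `√N` times that of `γ`, so `w⁻¹ γ` is upper triangular; the Bézout
    -- coefficients supply the second column.
    let w : SL(2, ℝ) := ⟨!![√(N : ℝ) * γ 0 0, -y / √(N : ℝ); √(N : ℝ) * γ 1 0, √(N : ℝ) * t], by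
      rw [Matrix.det_fin_two_of]; exact hdw⟩
    have hw : w ∈ atkinLehnerSet N :=
      mem_atkinLehnerSet_of hs (a := γ 0 0) (b := -y) (c := γ 1 0) (d := t)
        (by simp [w]) (by simp [w]) (by simp [w]) (by simp [w])
    have i10 : w⁻¹ 1 0 = -(√(N : ℝ) * γ 1 0) := by
      rw [Matrix.SpecialLinearGroup.SL2_inv_expl]; rfl
    have i11 : w⁻¹ 1 1 = √(N : ℝ) * γ 0 0 := by
      rw [Matrix.SpecialLinearGroup.SL2_inv_expl]; rfl
    refine ⟨w, Or.inr hw, w⁻¹ * Matrix.SpecialLinearGroup.map (Int.castRingHom ℝ) γ, ?_, Or.inr ?_,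
      by simp⟩
    · rw [sl_mul_apply, i10, i11]
      simp
      ring
    · have hdet' : (γ 0 0 : ℝ) * γ 1 1 - γ 0 1 * γ 1 0 = 1 := by exact_mod_cast hdet
      rw [sl_mul_apply, i10, i11]
      simp
      linear_combination √(N : ℝ) * hdet'

end

section

variable {N : ℕ} [NeZero N]

theorem natCast_pos : (0 : ℝ) < N := by exact_mod_cast Nat.pos_of_ne_zero (NeZero.ne N)

/-! ### Forms of weight zero are constant -/

theorem slash_frickeS (f : ℍ → ℂ) (k : ℤ) (z : ℍ) :
    (f ∣[k] (frickeS N : GL (Fin 2) ℝ)) z = f (fricke N z) * frickeFactor N z ^ (-k) := by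
  rw [slash_apply_SL, frickeS_smul]
  simp [frickeS, frickeFactor]

theorem slash_transT (f : ℍ → ℂ) (k : ℤ) (z : ℍ) :
    (f ∣[k] (transT : GL (Fin 2) ℝ)) z = f ((1 : ℝ) +ᵥ z) := by
  rw [slash_apply_SL, transT_smul]
  simp [transT]

theorem slash_frickeS_eq_smul_iff {f : ℍ → ℂ} {k : ℤ} {σ : ℂ} :
    f ∣[k] (frickeS N : GL (Fin 2) ℝ) = σ • f ↔
      ∀ z, f (fricke N z) = σ * frickeFactor N z ^ k * f z := by
  refine ⟨fun h z => ?_, fun h => funext fun z => ?_⟩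
  · have h1 := congrFun h z
    have h2 := zpow_ne_zero k (frickeFactor_ne_zero N z)
    rw [slash_frickeS, zpow_neg, ← div_eq_mul_inv, div_eq_iff h2] at h1
    rw [h1, Pi.smul_apply, smul_eq_mul]; ring
  · have h2 := zpow_ne_zero k (frickeFactor_ne_zero N z)
    rw [slash_frickeS, h, zpow_neg, Pi.smul_apply, smul_eq_mul]
    field_simp

theorem slash_transT_eq_iff {f : ℍ → ℂ} {k : ℤ} :
    f ∣[k] (transT : GL (Fin 2) ℝ) = f ↔ ∀ z, f ((1 : ℝ) +ᵥ z) = f z := by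
  rw [funext_iff]
  simp_rw [slash_transT]

theorem im_smul_of_upper {u : SL(2, ℝ)} (h : u 1 0 = 0) (z : ℍ) :
    (u • z).im * u 1 1 ^ 2 = z.im := by
  have hdet : u 0 0 * u 1 1 = 1 := by
    have := u.det_coe
    rwa [Matrix.det_fin_two, h, mul_zero, sub_zero] at this
  have h1 : u 1 1 ≠ 0 := right_ne_zero_of_mul_eq_one hdet
  have e : ((u • z : ℍ) : ℂ) = ((u 0 0 / u 1 1 : ℝ) : ℂ) * z + ((u 0 1 / u 1 1 : ℝ) : ℂ) := by
    have : ((u 1 1 : ℝ) : ℂ) ≠ 0 := Complex.ofReal_ne_zero.2 h1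
    rw [coe_specialLinearGroup_apply]
    simp [h]
    field_simp
  have e2 : (u • z).im = u 0 0 / u 1 1 * z.im := by
    rw [← coe_im, e, Complex.add_im, Complex.im_ofReal_mul, Complex.ofReal_im, add_zero, coe_im]
  rw [e2]
  field_simp
  linear_combination hdet

/-- The `SL(2, ℤ)`-orbit of `τ` reaches height `1/2`. Passing from `SL(2, ℤ)` to `Γ₀⁺(N)` costs an
upper triangular matrix, which divides heights by at most `N`. -/
theorem exists_im_ge (hN : N.Prime) {f : ℍ → ℂ} (hf : ∀ g ∈ Gamma0Plus N, ∀ z, f (g • z) = f z)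
    (τ : ℍ) : ∃ ξ : ℍ, 1 / (2 * N) ≤ ξ.im ∧ f τ = f ξ := by
  obtain ⟨γ, hγ, -⟩ := ModularGroup.exists_one_half_le_im_smul_and_norm_denom_le τ
  obtain ⟨g, hg, u, hu0, hu, hgu⟩ := exists_coset hN γ⁻¹
  refine ⟨u • γ • τ, ?_, ?_⟩
  · have h1 := im_smul_of_upper hu0 (γ • τ)
    have hN1 : (1 : ℝ) ≤ N := by exact_mod_cast hN.one_lt.le
    have hu2 : 0 < u 1 1 ^ 2 ∧ u 1 1 ^ 2 ≤ N := by
      rcases hu with hu | hu <;> rw [hu]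
      · simpa using hN1
      · rw [sq, natCast_sqrt_sq]; exact ⟨natCast_pos, le_rfl⟩
    rw [div_le_iff₀ (by positivity)]
    nlinarith [(u • γ • τ).im_pos]
  · rw [← hf g hg (u • γ • τ), ← mul_smul, ← hgu]
    have : (Matrix.SpecialLinearGroup.map (Int.castRingHom ℝ) γ⁻¹ : SL(2, ℝ)) • (γ • τ) =
        γ⁻¹ • (γ • τ) := by
      generalize γ⁻¹ = δ
      generalize γ • τ = w
      ext; simp only [coe_specialLinearGroup_apply]; simp
    rw [this, inv_smul_smul]

/-- As a function of `q`, the form takes every one of its values already on a closed disc of radius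
less than 1, so the maximum principle applies. -/
theorem IsForm.exists_const (h4 : N < 4) (hN : N.Prime) {f : ℍ → ℂ} (hf : IsForm N 0 1 f) :
    ∃ c : ℂ, f = fun _ => c := by
  have hper := periodic_comp_ofComplex hf.vadd
  have hinv : ∀ g ∈ Gamma0Plus N, ∀ z, f (g • z) = f z := by
    intro g hg z
    have := slash_eq_of_generators (N := N) hN.one_lt h4 (f := f) (k := 0) (σ := 1) (ψ := fun _ => 1) rfl
      (fun _ _ => by simp) (fun _ _ _ => rfl) (slash_frickeS_eq_smul_iff.2 hf.fricke)
      (slash_transT_eq_iff.2 hf.vadd) g hg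
    have := congrFun this z
    rw [slash_apply_SL] at this
    simpa using this
  -- The radius `exp (-π / N)` is `‖q‖` at height `1 / (2 N)`, the height guaranteed by
  -- `exists_im_ge`.
  have hconst := Complex.eq_const_of_exists_le (f := cuspFunction 1 f) (b := 1)
    (r := Real.exp (-Real.pi / N))
    (differentiableOn_cuspFunction_ball one_pos hper hf.holo hf.bdd) (Real.exp_pos _).le
    (by
      rw [Real.exp_lt_one_iff]
      exact div_neg_of_neg_of_pos (neg_lt_zero.2 Real.pi_pos) natCast_pos)
    (by
      intro q hq
      rcases eq_or_ne q 0 with rfl | hq'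
      · exact ⟨0, by simp [(Real.exp_pos _).le], le_rfl⟩
      · have him := Periodic.im_invQParam_pos_of_norm_lt_one one_pos (mem_ball_zero_iff.mp hq) hq'
        obtain ⟨ξ, hξ, hξ'⟩ := exists_im_ge hN hinv ⟨_, him⟩
        refine ⟨qPar ξ, ?_, ?_⟩
        · rw [mem_closedBall_zero_iff, norm_qPar, Real.exp_le_exp, le_div_iff₀ natCast_pos]
          rw [div_le_iff₀ (by have := natCast_pos (N := N); positivity)] at hξ
          nlinarith [Real.pi_pos]
        · have e1 := eq_cuspFunction ξ one_ne_zero hper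
          have e2 := eq_cuspFunction ⟨_, him⟩ one_ne_zero hper
          rw [Periodic.qParam_right_inv one_ne_zero hq'] at e2
          rw [e2, hξ', ← e1]
          rfl)
  refine ⟨cuspFunction 1 f 0, funext fun z => ?_⟩
  rw [← eq_cuspFunction z one_ne_zero hper]
  refine hconst ?_
  simpa using Periodic.norm_qParam_lt_one one_pos z.im_pos

/-! ### The product `Δ(z) Δ(N z)` -/

/-- The map `z ↦ N z`. -/
def natScale (N : ℕ) [NeZero N] (z : ℍ) : ℍ :=
  ⟨N * z, by
    have : (N : ℂ) = ((N : ℝ) : ℂ) := by simp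
    rw [this, Complex.im_ofReal_mul]
    exact mul_pos natCast_pos z.im_pos⟩

theorem coe_natScale (z : ℍ) : (natScale N z : ℂ) = N * z := rfl

theorem im_natScale (z : ℍ) : (natScale N z).im = N * z.im := by
  have : (N : ℂ) = ((N : ℝ) : ℂ) := by simp
  rw [← coe_im, coe_natScale, this, Complex.im_ofReal_mul, coe_im]

theorem tendsto_natScale : Tendsto (natScale N) atImInfty atImInfty := by
  rw [atImInfty, tendsto_comap_iff]
  have : (im ∘ natScale N) = fun z => (N : ℝ) * z.im := funext fun z => im_natScale z
  rw [this]
  exact tendsto_comap.const_mul_atTop natCast_pos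

theorem qPar_natScale (z : ℍ) : qPar (natScale N z) = qPar z ^ N := by
  simp only [qPar, Periodic.qParam, coe_natScale, ← Complex.exp_nat_mul]
  congr 1
  push_cast
  ring

theorem discriminant_eq_of_qPar_eq {z w : ℍ} (h : qPar z = qPar w) :
    discriminant z = discriminant w := by
  have h' : Periodic.qParam 1 z = Periodic.qParam 1 w := h
  simp only [discriminant_eq_q_prod, eta_q, h']

theorem discriminant_of_coe_eq {z w : ℍ} (h : (w : ℂ) = -1 / z) :
    discriminant w = (z : ℂ) ^ 12 * discriminant z := by
  have h1 := congrFun discriminant_S_invariant z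
  rw [SL_slash_apply, UpperHalfPlane.modular_S_smul, ModularGroup.denom_S] at h1
  have e : w = (UpperHalfPlane.mk (-z : ℂ)⁻¹ z.im_inv_neg_coe_pos) := by
    ext
    change (w : ℂ) = (-z : ℂ)⁻¹
    rw [h, neg_div, one_div, inv_neg]
  rw [e, ← h1]
  have := z.ne_zero
  rw [zpow_neg, zpow_ofNat]
  field_simp

theorem discriminant_isTheta : discriminant =Θ[atImInfty] qPar := by
  have h1 : Tendsto (fun z => discriminant z / qPar z) atImInfty (𝓝 1) := by
    refine tendsto_atImInfty_tprod_one_sub_eta_q_pow.congr fun z => ?_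
    rw [eq_div_iff (qPar_ne_zero z), discriminant_eq_q_prod, mul_comm]
    rfl
  have h2 := isEquivalent_of_tendsto_one h1
  exact h2.isTheta

theorem mdifferentiable_discriminant : MDiff discriminant := CuspForm.discriminant.holo'

theorem mdifferentiable_comp_natScale {f : ℍ → ℂ} (hf : MDiff f) :
    MDiff (fun z => f (natScale N z)) := by
  rw [UpperHalfPlane.mdifferentiable_iff] at hf ⊢
  have h1 : DifferentiableOn ℂ (fun w : ℂ => (f ∘ ofComplex) (N * w)) upperHalfPlaneSet := by
    refine hf.comp (by fun_prop) fun w hw => ?_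
    exact (natScale N ⟨w, hw⟩).im_pos
  refine h1.congr fun w hw => ?_
  have : (N * w : ℂ) = (natScale N ⟨w, hw⟩ : ℂ) := rfl
  simp only [comp_apply, this, ofComplex_apply, ofComplex_apply_of_im_pos hw]

theorem qPar_natScale_vadd (z : ℍ) : qPar (natScale N ((1 : ℝ) +ᵥ z)) = qPar (natScale N z) := by
  rw [qPar_natScale, qPar_vadd, qPar_natScale]

/-- `Δ(N z)`. -/
def discScale (N : ℕ) [NeZero N] (z : ℍ) : ℂ := discriminant (natScale N z)

theorem discScale_isTheta : discScale N =Θ[atImInfty] fun z => qPar z ^ N := by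
  have h1 := discriminant_isTheta.1.comp_tendsto (tendsto_natScale (N := N))
  have h2 := discriminant_isTheta.2.comp_tendsto (tendsto_natScale (N := N))
  simp only [comp_def, qPar_natScale] at h1 h2
  exact ⟨h1, h2⟩

theorem discriminant_fricke (z : ℍ) :
    discriminant (fricke N z) = N ^ 12 * (z : ℂ) ^ 12 * discScale N z := by
  rw [discriminant_of_coe_eq (z := natScale N z) (by rw [coe_fricke, coe_natScale]), coe_natScale,
    discScale, mul_pow]

theorem discScale_fricke (z : ℍ) :
    discScale N (fricke N z) = (z : ℂ) ^ 12 * discriminant z := by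
  refine discriminant_of_coe_eq ?_
  have hz := z.ne_zero
  have hN : (N : ℂ) ≠ 0 := NeZero.ne _
  rw [coe_natScale, coe_fricke]
  field_simp

/-- `Δ(z) Δ(N z)`. -/
def discProd (N : ℕ) [NeZero N] : ℍ → ℂ := discriminant * discScale N

theorem discProd_ne_zero (z : ℍ) : discProd N z ≠ 0 :=
  mul_ne_zero (discriminant_ne_zero _) (discriminant_ne_zero _)

theorem discProd_isTheta : discProd N =Θ[atImInfty] fun z => qPar z ^ ((N : ℤ) + 1) := by
  have h : (fun z => qPar z ^ ((N : ℤ) + 1)) = fun z => qPar z * qPar z ^ N := by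
    ext z
    rw [zpow_add_one₀ (qPar_ne_zero z), zpow_natCast, mul_comm]
  rw [h]
  exact discriminant_isTheta.mul discScale_isTheta

/-- The Fricke involution exchanges the two factors, up to automorphy factors whose product is `(√N
z) ^ 24`. -/
theorem discProd_isForm : IsForm N 24 1 (discProd N) where
  holo := mdifferentiable_discriminant.mul (mdifferentiable_comp_natScale mdifferentiable_discriminant)
  vadd z := by
    simp only [discProd, Pi.mul_apply, discScale, discriminant_eq_of_qPar_eq (qPar_vadd z),
      discriminant_eq_of_qPar_eq (qPar_natScale_vadd z)]
  bdd := isBoundedAtImInfty_iff_isBigO.2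
    (discProd_isTheta.1.trans (qPar_pow_isBigO (by positivity)))
  fricke z := by
    simp only [discProd, Pi.mul_apply, discriminant_fricke, discScale_fricke]
    have : frickeFactor N z ^ (24 : ℤ) = (frickeFactor N z ^ 2) ^ 12 := by
      rw [← pow_mul]; norm_cast
    rw [this, frickeFactor_sq]
    ring

/-- Valence bound: a form whose vanishing order at `i∞` exceeds `k (N + 1) / 24` vanishes. -/
theorem IsForm.eq_zero_of_isBigO (h4 : N < 4) (hN : N.Prime) {k : ℤ} {σ : ℂ} {f : ℍ → ℂ}
    (hf : IsForm N k σ f) (hσ : σ ^ 24 = 1) {m : ℤ} (hm : f =O[atImInfty] fun z => qPar z ^ m)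
    (h : k * (N + 1) < 24 * m) : f = 0 := by
  -- The function `f ^ 24 / discProd ^ k` has weight zero, and its order at the cusp is at least `24
  -- m - k (N + 1) ≥ 1`. The exponent 24 also kills the character.
  have hO : (fun z => f z ^ 24 * discProd N z ^ (-k)) =O[atImInfty] qPar := by
    have h1 := (hm.pow 24).mul (discProd_isTheta (N := N).zpow (-k)).1
    refine h1.trans ?_
    have h2 : (fun z => qPar z ^ (24 * m - k * (N + 1))) =O[atImInfty] fun z => qPar z ^ (1 : ℤ) :=
      qPar_pow_isBigO (by linarith)
    simp only [zpow_one] at h2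
    refine h2.congr_left fun z => ?_
    rw [← zpow_natCast (qPar z ^ m), ← zpow_mul, ← zpow_mul, ← zpow_add₀ (qPar_ne_zero z)]
    congr 1
    push_cast
    ring
  have hform : IsForm N 0 1 (fun z => f z ^ 24 * discProd N z ^ (-k)) := by
    refine ⟨⟨?_, fun z => by rw [hf.vadd, discProd_isForm.vadd], ?_⟩, fun z => ?_⟩
    · have h1 := (hf.pow 24).holo
      have h2 := (discProd_isForm (N := N)).holo
      rw [UpperHalfPlane.mdifferentiable_iff] at h1 h2 ⊢
      exact h1.mul (h2.zpow (Or.inl fun z _ => discProd_ne_zero _))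
    · exact isBoundedAtImInfty_iff_isBigO.2
        (hO.trans (by simpa using qPar_pow_isBigO zero_le_one))
    · rw [hf.fricke, discProd_isForm.fricke, mul_pow, mul_pow, hσ, one_mul, one_mul, mul_zpow,
        ← zpow_mul, ← zpow_natCast (_ ^ k), ← zpow_mul]
      have : frickeFactor N z ^ (k * (24 : ℕ)) * frickeFactor N z ^ (24 * -k) = 1 := by
        rw [← zpow_add₀ (frickeFactor_ne_zero N z)]
        have : k * (24 : ℕ) + 24 * -k = 0 := by push_cast; ring
        rw [this, zpow_zero]
      simp only [zpow_zero, one_mul]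
      linear_combination f z ^ 24 * discProd N z ^ (-k) * this
  obtain ⟨c, hc⟩ := hform.exists_const h4 hN
  have hc0 : c = 0 := by
    rw [hc] at hO
    exact tendsto_nhds_unique tendsto_const_nhds (hO.trans_tendsto tendsto_qPar)
  ext z
  have := congrFun hc z
  rw [hc0, mul_eq_zero] at this
  rcases this with h | h
  · simpa using h
  · exact absurd h (zpow_ne_zero _ (discProd_ne_zero z))

end

theorem frickeFactor_sq' {N : ℕ} (z : ℍ) : frickeFactor N z ^ (2 : ℤ) = N * (z : ℂ) ^ 2 := by
  rw [← frickeFactor_sq]; norm_cast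

section

variable {N : ℕ} [NeZero N]

/-! ### Logarithmic derivatives -/

theorem D_qPar_pow (m : ℕ) (z : ℍ) : D (qPar ^ m) z = m * qPar z ^ m := by
  have h1 : HasDerivAt (fun w : ℂ => Complex.exp (m * (2 * Real.pi * Complex.I * w)))
      (Complex.exp (m * (2 * Real.pi * Complex.I * z)) * (m * (2 * Real.pi * Complex.I * 1))) z :=
    (((hasDerivAt_id (z : ℂ)).const_mul (2 * Real.pi * Complex.I : ℂ)).const_mul (m : ℂ)).cexp
  have hq : ∀ w : ℍ, qPar w ^ m = Complex.exp (m * (2 * Real.pi * Complex.I * w)) := by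
    intro w
    rw [Complex.exp_nat_mul, qPar, Periodic.qParam]
    simp
  have h2 : HasDerivAt ((qPar ^ m) ∘ ofComplex)
      (Complex.exp (m * (2 * Real.pi * Complex.I * z)) * (m * (2 * Real.pi * Complex.I * 1))) z := by
    refine h1.congr_of_eventuallyEq ?_
    filter_upwards [isOpen_upperHalfPlaneSet.mem_nhds z.im_pos] with w hw
    rw [comp_apply, ofComplex_apply_of_im_pos hw, Pi.pow_apply, hq]
  rw [D_eq_of_hasDerivAt h2, hq]
  have := Complex.two_pi_I_ne_zero
  field_simp

/-- The logarithmic derivative of a nonvanishing function of order `m` at `i∞` tends to `m`. -/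
theorem logDeriv_isBigO {f : ℍ → ℂ} (hf : Regular f) (h0 : ∀ z, f z ≠ 0) {m : ℕ}
    (hm : f =Θ[atImInfty] fun z => qPar z ^ m) :
    (fun z => D f z / f z - m) =O[atImInfty] qPar := by
  set u : ℍ → ℂ := fun z => f z / (qPar ^ m) z with hu
  have hq0 : ∀ z, (qPar ^ m) z ≠ 0 := fun z => pow_ne_zero m (qPar_ne_zero z)
  have hqd : MDiff (qPar ^ m) := mdifferentiable_qPar.pow m
  have hu1 : Regular u := by
    refine ⟨mdifferentiable_div hf.holo hqd hq0, fun z => ?_, isBoundedAtImInfty_iff_isBigO.2 ?_⟩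
    · simp [hu, hf.vadd, qPar_vadd]
    · simp only [zpow_zero]
      have := hm.1.mul (isBigO_refl (fun z => (qPar z ^ m)⁻¹) atImInfty)
      refine (this.congr_left fun z => ?_).congr_right fun z => ?_
      · simp [hu, div_eq_mul_inv]
      · exact mul_inv_cancel₀ (hq0 z)
  have hfu : f = u * qPar ^ m := by
    ext z
    simp only [hu, Pi.mul_apply]
    rw [div_mul_cancel₀ _ (hq0 z)]
  have hD : ∀ z, D f z / f z - m = D u z * ((qPar ^ m) z / f z) := by
    intro z
    have h1 : D f z = D u z * (qPar ^ m) z + u z * (m * (qPar z ^ m)) := by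
      conv_lhs => rw [hfu, Derivative.normalizedDerivOfComplex_mul _ _ hu1.holo hqd]
      rw [Pi.add_apply, Pi.mul_apply, Pi.mul_apply, D_qPar_pow]
    have h2 : f z = u z * qPar z ^ m := congrFun hfu z
    have h3 := h0 z
    rw [h1]
    have h4 : qPar z ^ m ≠ 0 := hq0 z
    have h5 : u z ≠ 0 := by
      intro h; rw [h, zero_mul] at h2; exact h3 h2
    rw [h2, Pi.pow_apply]
    field_simp
    ring
  simp only [hD]
  have h1 : (fun z => (qPar ^ m) z / f z) =O[atImInfty] fun z => (1 : ℂ) := by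
    have := hm.2.mul (isBigO_refl (fun z => (f z)⁻¹) atImInfty)
    refine (this.congr_left fun z => ?_).congr_right fun z => ?_
    · rw [Pi.pow_apply, div_eq_mul_inv]
    · exact mul_inv_cancel₀ (h0 z)
  simpa using hu1.D_isBigO_qPar.mul h1

theorem logDeriv_regular {f : ℍ → ℂ} (hf : Regular f) (h0 : ∀ z, f z ≠ 0) {m : ℕ}
    (hm : f =Θ[atImInfty] fun z => qPar z ^ m) : Regular (fun z => D f z / f z) where
  holo := mdifferentiable_div (Derivative.normalizedDerivOfComplex_mdifferentiable hf.holo) hf.holo h0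
  vadd z := by rw [D_vadd hf.vadd, hf.vadd]
  bdd := by
    have h1 := (logDeriv_isBigO hf h0 hm).trans_tendsto tendsto_qPar
    have h2 : Tendsto (fun z => D f z / f z) atImInfty (𝓝 (0 + m)) := by
      simpa using h1.add_const (m : ℂ)
    exact h2.isBigO_one ℝ

/-! ### Behaviour under the Fricke involution -/

theorem D_frickeFactor_zpow_mul (c : ℂ) (k : ℤ) {g : ℍ → ℂ} {z : ℍ} {d : ℂ}
    (hg : HasDerivAt (g ∘ ofComplex) d z) :
    D (fun z => c * frickeFactor N z ^ k * g z) z =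
      c * frickeFactor N z ^ k * (2 * Real.pi * Complex.I)⁻¹ * (k / z * g z + d) := by
  have hz := z.ne_zero
  have hs := sqrt_ne_zero N
  have h1 : HasDerivAt (fun w : ℂ => ((√(N : ℝ) : ℝ) * w) ^ k)
      (k * ((√(N : ℝ) : ℝ) * (z : ℂ)) ^ (k - 1) * ((√(N : ℝ) : ℝ) * 1)) z := by
    have := (hasDerivAt_zpow k ((√(N : ℝ) : ℝ) * (z : ℂ)) (Or.inl (mul_ne_zero hs hz))).comp (z : ℂ)
      ((hasDerivAt_id (z : ℂ)).const_mul ((√(N : ℝ) : ℝ) : ℂ))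
    exact this
  have h2 := (h1.const_mul c).mul hg
  have h3 := h2.congr_of_eventuallyEq
      (f₁ := (fun z => c * frickeFactor N z ^ k * g z) ∘ ofComplex) <| by
    filter_upwards [isOpen_upperHalfPlaneSet.mem_nhds z.im_pos] with w hw
    simp only [comp_apply, ofComplex_apply_of_im_pos hw, Pi.mul_apply, frickeFactor]
  rw [D_eq_of_hasDerivAt h3]
  simp only [comp_apply, ofComplex_apply, frickeFactor]
  rw [zpow_sub_one₀ (mul_ne_zero hs hz)]
  have := Complex.two_pi_I_ne_zero
  field_simp

theorem IsForm.D_fricke {k : ℤ} {σ : ℂ} {f : ℍ → ℂ} (hf : IsForm N k σ f) (z : ℍ) :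
    D f (QuasiModular.fricke N z) = σ * frickeFactor N z ^ (k + 2) *
      (D f z + k * (2 * Real.pi * Complex.I)⁻¹ / z * f z) := by
  have hz := z.ne_zero
  have e : (fun z => f (QuasiModular.fricke N z)) = fun z => σ * frickeFactor N z ^ k * f z :=
    funext hf.fricke
  rw [D_comp_fricke N hf.holo, e, D_frickeFactor_zpow_mul σ k (hasDerivAt_comp_ofComplex hf.holo z),
    zpow_add₀ (frickeFactor_ne_zero N z), frickeFactor_sq']
  have := Complex.two_pi_I_ne_zero
  field_simp
  ring

theorem IsQuasi.D_fricke {k : ℤ} {σ : ℂ} {f₀ f₁ : ℍ → ℂ} (hf : IsQuasi N k σ f₀ f₁) (z : ℍ) :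
    D f₀ (QuasiModular.fricke N z) = σ * frickeFactor N z ^ (k + 2) *
      (D f₀ z + D f₁ z / z - (2 * Real.pi * Complex.I)⁻¹ * f₁ z / z ^ 2 +
        k * (2 * Real.pi * Complex.I)⁻¹ / z * (f₀ z + f₁ z / z)) := by
  have hz := z.ne_zero
  have e : (fun z => f₀ (QuasiModular.fricke N z)) =
    fun z => σ * frickeFactor N z ^ k * (f₀ z + f₁ z / z) := funext hf.fricke
  have h1 : HasDerivAt ((fun z : ℍ => f₀ z + f₁ z / z) ∘ ofComplex)
      (2 * Real.pi * Complex.I * D f₀ z + (2 * Real.pi * Complex.I * D f₁ z * z - f₁ z * 1) / z ^ 2)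
      z := by
    have h2 := (hasDerivAt_comp_ofComplex hf.holo z).add
      ((hasDerivAt_comp_ofComplex hf.snd.holo z).div (hasDerivAt_id (z : ℂ)) hz)
    simp only [comp_apply, ofComplex_apply, id] at h2
    refine h2.congr_of_eventuallyEq ?_
    filter_upwards [isOpen_upperHalfPlaneSet.mem_nhds z.im_pos] with w hw
    simp only [comp_apply, ofComplex_apply_of_im_pos hw, Pi.add_apply, Pi.div_apply, id]
  rw [D_comp_fricke N hf.holo, e, D_frickeFactor_zpow_mul σ k h1,
    zpow_add₀ (frickeFactor_ne_zero N z), frickeFactor_sq']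
  have := Complex.two_pi_I_ne_zero
  field_simp
  ring

/-- The logarithmic derivative of `Δ(z) Δ(N z)`. -/
def discLogDeriv (N : ℕ) [NeZero N] (z : ℍ) : ℂ := D (discProd N) z / discProd N z

theorem discProd_isTheta' : discProd N =Θ[atImInfty] fun z => qPar z ^ (N + 1) := by
  have := discProd_isTheta (N := N)
  simpa only [← zpow_natCast, Nat.cast_add, Nat.cast_one] using this

theorem discLogDeriv_regular : Regular (discLogDeriv N) :=
  logDeriv_regular discProd_isForm.toRegular discProd_ne_zero discProd_isTheta'

theorem discLogDeriv_isBigO : (fun z => discLogDeriv N z - (N + 1)) =O[atImInfty] qPar := by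
  simpa using! logDeriv_isBigO (discProd_isForm (N := N)).toRegular discProd_ne_zero discProd_isTheta'

theorem discLogDeriv_fricke (z : ℍ) : discLogDeriv N (fricke N z) =
    frickeFactor N z ^ (2 : ℤ) * (discLogDeriv N z + 24 * (2 * Real.pi * Complex.I)⁻¹ / z) := by
  have h0 := discProd_ne_zero (N := N) z
  have hz := z.ne_zero
  have h24 := zpow_ne_zero 24 (frickeFactor_ne_zero N z)
  rw [discLogDeriv, discProd_isForm.D_fricke, discProd_isForm.fricke, discLogDeriv,
    zpow_add₀ (frickeFactor_ne_zero N z)]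
  have := Complex.two_pi_I_ne_zero
  push_cast
  field_simp

/-- The quasimodular form of weight `2` attached to `Δ(z) Δ(N z)`. -/
def quasiWeightTwo (N : ℕ) [NeZero N] : ℍ → ℂ :=
  ((2 * Real.pi * Complex.I) / 24 : ℂ) • discLogDeriv N

/-- Modular forms of weight `k` and `k - 2` combine to a quasimodular form of weight `k`. -/
theorem IsForm.add_quasi {k : ℤ} {σ : ℂ} {g₀ g₁ : ℍ → ℂ} (h₀ : IsForm N k σ g₀)
    (h₁ : IsForm N (k - 2) σ g₁) : IsQuasi N k σ (g₀ + quasiWeightTwo N * g₁) g₁ where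
  toRegular := h₀.toRegular.add ((discLogDeriv_regular.smul _).mul h₁.toRegular)
  snd := h₁
  fricke z := by
    have hz := z.ne_zero
    have hj := frickeFactor_ne_zero N z
    have h2 := Complex.two_pi_I_ne_zero
    -- The normalisation `2 π i / 24` turns the anomaly `24 / (2 π i z)` of `discLogDeriv` into
    -- exactly `1 / z`.
    simp only [Pi.add_apply, Pi.mul_apply, quasiWeightTwo, Pi.smul_apply, smul_eq_mul, h₀.fricke,
      h₁.fricke, discLogDeriv_fricke, zpow_sub₀ hj]
    have := zpow_ne_zero 2 hj
    field_simp
    ring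

/-- The modular form of weight `k` underlying a quasimodular form of weight `k`. -/
theorem IsQuasi.exists_isForm {k : ℤ} {σ : ℂ} {f₀ f₁ : ℍ → ℂ} (hf : IsQuasi N k σ f₀ f₁) :
    ∃ g₀, IsForm N k σ g₀ ∧ f₀ = g₀ + quasiWeightTwo N * f₁ := by
  refine ⟨f₀ - quasiWeightTwo N * f₁, ⟨?_, fun z => ?_⟩, by simp⟩
  · exact hf.toRegular.sub ((discLogDeriv_regular.smul _).mul hf.snd.toRegular)
  · have hz := z.ne_zero
    have hj := frickeFactor_ne_zero N z
    have h2 := Complex.two_pi_I_ne_zero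
    simp only [Pi.sub_apply, Pi.mul_apply, quasiWeightTwo, Pi.smul_apply, smul_eq_mul, hf.fricke,
      hf.snd.fricke, discLogDeriv_fricke, zpow_sub₀ hj]
    have := zpow_ne_zero 2 hj
    field_simp
    ring

/-- The Serre derivative on `Γ₀⁺(N)`. -/
def serreD (N : ℕ) [NeZero N] (k : ℤ) (f : ℍ → ℂ) : ℍ → ℂ :=
  D f - ((k : ℂ) / 24) • (discLogDeriv N * f)

theorem IsForm.serreD {k : ℤ} {σ : ℂ} {f : ℍ → ℂ} (hf : IsForm N k σ f) :
    IsForm N (k + 2) σ (serreD N k f) where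
  toRegular := hf.toRegular.D.sub ((discLogDeriv_regular.mul hf.toRegular).smul _)
  fricke z := by
    have hz := z.ne_zero
    have hj := frickeFactor_ne_zero N z
    have h2 := Complex.two_pi_I_ne_zero
    simp only [QuasiModular.serreD, Pi.sub_apply, Pi.smul_apply, Pi.mul_apply, smul_eq_mul, hf.D_fricke,
      hf.fricke, discLogDeriv_fricke, zpow_add₀ hj]
    field_simp
    ring

/-! ### The Wronskian -/

/-- The Wronskian of `f₀` and `z f₀ + f₁`. -/
def wronskian (f₀ f₁ : ℍ → ℂ) : ℍ → ℂ :=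
  f₀ * f₀ + (2 * Real.pi * Complex.I : ℂ) • (f₀ * D f₁ - D f₀ * f₁)

/-- Under `S` the pair `(f₀, z f₀ + f₁)` is acted on by a constant matrix, with automorphy factor of
weight `k - 1`. The Wronskian of two functions thus has weight `2 (k - 1) + 2 = 2 k`. -/
theorem IsQuasi.wronskian_isForm {k : ℤ} {σ : ℂ} {f₀ f₁ : ℍ → ℂ} (hf : IsQuasi N k σ f₀ f₁) :
    IsForm N (2 * k) (σ ^ 2) (wronskian f₀ f₁) where
  toRegular := (hf.toRegular.mul hf.toRegular).add
    (((hf.toRegular.mul hf.snd.toRegular.D).sub (hf.toRegular.D.mul hf.snd.toRegular)).smul _)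
  fricke z := by
    have hz := z.ne_zero
    have hj := frickeFactor_ne_zero N z
    have h2 := Complex.two_pi_I_ne_zero
    have e : frickeFactor N z ^ (2 * k) = frickeFactor N z ^ k * frickeFactor N z ^ k := by
      rw [two_mul, zpow_add₀ hj]
    simp only [wronskian, Pi.add_apply, Pi.sub_apply, Pi.smul_apply, Pi.mul_apply, smul_eq_mul,
      hf.fricke, hf.D_fricke, hf.snd.fricke, hf.snd.D_fricke, e, sub_add_cancel]
    rw [zpow_add₀ hj, zpow_sub₀ hj]
    have := zpow_ne_zero 2 hj
    push_cast
    field_simp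
    ring

/-- Every term of the Wronskian contains `f₀` or `D f₀`, and `D` preserves the vanishing order. -/
theorem IsQuasi.wronskian_isBigO {k : ℤ} {σ : ℂ} {f₀ f₁ : ℍ → ℂ} (hf : IsQuasi N k σ f₀ f₁)
    {m : ℤ} (hm : f₀ =O[atImInfty] fun z => qPar z ^ m) :
    wronskian f₀ f₁ =O[atImInfty] fun z => qPar z ^ m := by
  have h1 := hm.mul hf.isBigO_one
  have h2 := hm.mul hf.snd.toRegular.D.isBigO_one
  have h3 := (D_isBigO hf.holo hm).mul hf.snd.isBigO_one
  simp only [zpow_zero, mul_one] at h1 h2 h3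
  exact h1.add ((h2.sub h3).const_smul_left _)

/-- A vanishing Wronskian makes `z + f₁ / f₀` locally constant, so `f₁ = (c - z) f₀` on all of `ℍ`.
This contradicts the periodicity of `f₀` and `f₁` unless `f₀ = 0`. -/
theorem IsQuasi.wronskian_ne_zero {k : ℤ} {σ : ℂ} {f₀ f₁ : ℍ → ℂ} (hf : IsQuasi N k σ f₀ f₁)
    (h0 : f₀ ≠ 0) : wronskian f₀ f₁ ≠ 0 := by
  intro hW
  obtain ⟨z₁, hz₁⟩ := Function.ne_iff.1 h0
  simp only [Pi.zero_apply] at hz₁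
  have hc : ContinuousAt (f₀ ∘ ofComplex) z₁ := (hasDerivAt_comp_ofComplex hf.holo z₁).continuousAt
  have hne : ∀ᶠ w in 𝓝 (z₁ : ℂ), (f₀ ∘ ofComplex) w ≠ 0 :=
    hc.eventually_ne (by simpa using hz₁)
  obtain ⟨ε, hε, hball⟩ := Metric.eventually_nhds_iff_ball.1
    (hne.and (isOpen_upperHalfPlaneSet.mem_nhds z₁.im_pos))
  set F : ℂ → ℂ := fun w => (f₁ ∘ ofComplex) w / (f₀ ∘ ofComplex) w + w with hF
  have hder : ∀ w ∈ Metric.ball (z₁ : ℂ) ε, HasDerivAt F 0 w := by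
    intro w hw
    obtain ⟨hw0, hwim⟩ := hball w hw
    set z : ℍ := ⟨w, hwim⟩ with hz
    have h1 := ((hasDerivAt_comp_ofComplex hf.snd.holo z).div
      (hasDerivAt_comp_ofComplex hf.holo z) hw0).add (hasDerivAt_id w)
    have hWz := congrFun hW z
    simp only [wronskian, Pi.add_apply, Pi.sub_apply, Pi.smul_apply, Pi.mul_apply, smul_eq_mul,
      Pi.zero_apply] at hWz
    have hw0' : f₀ z ≠ 0 := by
      rw [comp_apply, ofComplex_apply_of_im_pos hwim] at hw0; exact hw0
    refine h1.congr_deriv ?_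
    simp only [comp_apply, ofComplex_apply]
    field_simp
    linear_combination hWz
  have hconst : ∀ w ∈ Metric.ball (z₁ : ℂ) ε, F w = F z₁ := by
    intro w hw
    refine Metric.isOpen_ball.is_const_of_deriv_eq_zero (convex_ball _ _).isPreconnected
      (fun v hv => (hder v hv).differentiableAt.differentiableWithinAt)
      (fun v hv => (hder v hv).deriv) hw (Metric.mem_ball_self hε)
  set G : ℍ → ℂ := fun z => f₁ z + ((z : ℂ) - F z₁) * f₀ z with hG
  have hGd : MDiff G :=
    hf.snd.holo.add ((mdifferentiable_coe.sub mdifferentiable_const).mul hf.holo)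
  have hG0 : G = 0 := by
    refine UpperHalfPlane.eq_zero_of_frequently hGd (τ := z₁) (Eventually.frequently ?_)
    refine Filter.Eventually.filter_mono nhdsWithin_le_nhds ?_
    have hcoe : ContinuousAt (fun z : ℍ => (z : ℂ)) z₁ := UpperHalfPlane.continuous_coe.continuousAt
    filter_upwards [hcoe (Metric.ball_mem_nhds (z₁ : ℂ) hε)] with z hz
    have h1 := hconst z hz
    have h2 := (hball z hz).1
    simp only [hF, comp_apply, ofComplex_apply] at h1 h2
    simp only [hG, hF, comp_apply, ofComplex_apply]
    rw [← h1]
    field_simp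
    ring
  -- Subtracting the relation at `z₁` from the one at `z₁ + 1` leaves `f₀ z₁ = 0`.
  refine hz₁ ?_
  have h1 := congrFun hG0 z₁
  have h2 := congrFun hG0 ((1 : ℝ) +ᵥ z₁)
  simp only [hG, Pi.zero_apply, hf.snd.vadd, hf.vadd, coe_vadd] at h1 h2
  push_cast at h2
  linear_combination h2 - h1

end

/-! ### Extremal elements from bounds on the vanishing order -/

/-- The first `d` Fourier coefficients on a space of regular functions. -/
def coeffMap (M : Submodule ℂ (ℍ → ℂ)) (hM : ∀ f ∈ M, Regular f) (d : ℕ) : M →ₗ[ℂ] (Fin d → ℂ) where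
  toFun f i := (qExpansion 1 (f : ℍ → ℂ)).coeff i
  map_add' f g := by
    ext i
    rw [Submodule.coe_add, qExpansion_add (hM f f.2).analyticAt (hM g g.2).analyticAt]
    simp
  map_smul' c f := by
    ext i
    rw [Submodule.coe_smul, qExpansion_smul (hM f f.2).analyticAt]
    simp

theorem coeffMap_injective {M : Submodule ℂ (ℍ → ℂ)} (hM : ∀ f ∈ M, Regular f) {d : ℕ}
    (hd : ∀ f ∈ M, (f =O[atImInfty] fun z => qPar z ^ (d : ℤ)) → f = 0) :
    Injective (coeffMap M hM d) := by
  rw [← LinearMap.ker_eq_bot, LinearMap.ker_eq_bot']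
  intro f hf
  ext1
  refine hd f f.2 ((hM f f.2).isBigO_of_coeff d fun i hi => ?_)
  exact congrFun hf ⟨i, hi⟩

theorem finite_of_isBigO {M : Submodule ℂ (ℍ → ℂ)} (hM : ∀ f ∈ M, Regular f) {d : ℕ}
    (hd : ∀ f ∈ M, (f =O[atImInfty] fun z => qPar z ^ (d : ℤ)) → f = 0) : Module.Finite ℂ M :=
  Module.Finite.of_injective _ (coeffMap_injective hM hd)

/-- The order bound makes the map to the first `d + 1` coefficients injective, and the dimension
bound then makes it bijective. An extremal form is a preimage of the last basis vector. Two extremal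
forms have a linear combination of larger order, which must vanish. -/
theorem extremalExistsUnique_of_isBigO {M : Submodule ℂ (ℍ → ℂ)} (hM : ∀ f ∈ M, Regular f) {d : ℕ}
    (hd : ∀ f ∈ M, (f =O[atImInfty] fun z => qPar z ^ ((d + 1 : ℕ) : ℤ)) → f = 0)
    (hdim : d + 1 ≤ Module.finrank ℂ M) : ExtremalExistsUnique M := by
  have hfin := finite_of_isBigO hM hd
  have hinj := coeffMap_injective hM hd
  have hrank : Module.finrank ℂ M = d + 1 := by
    refine le_antisymm ?_ hdim
    simpa using LinearMap.finrank_le_finrank_of_injective hinj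
  have hsurj : Surjective (coeffMap M hM (d + 1)) :=
    (LinearMap.injective_iff_surjective_of_finrank_eq_finrank (by simpa using hrank)).1 hinj
  refine ⟨?_, ?_⟩
  · obtain ⟨f, hf⟩ := hsurj (Pi.single (Fin.last d) 1)
    refine ⟨f, f.2, d, ?_, hrank⟩
    rw [PowerSeries.order_eq_nat]
    refine ⟨?_, fun i hi => ?_⟩
    · have := congrFun hf (Fin.last d)
      simp only [coeffMap, LinearMap.coe_mk, AddHom.coe_mk, Fin.val_last, Pi.single_eq_same] at this
      rw [this]; exact one_ne_zero
    · have := congrFun hf ⟨i, by omega⟩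
      rw [Pi.single_eq_of_ne (by intro h; simp [Fin.ext_iff] at h; omega)] at this
      exact this
  · rintro f g ⟨hf, m, hm, hm'⟩ ⟨hg, n, hn, hn'⟩
    obtain rfl : m = d := by omega
    obtain rfl : n = m := by omega
    rw [PowerSeries.order_eq_nat] at hm hn
    refine ⟨(qExpansion 1 g).coeff n / (qExpansion 1 f).coeff n, div_ne_zero hn.1 hm.1, ?_⟩
    rw [← sub_eq_zero]
    set c := (qExpansion 1 g).coeff n / (qExpansion 1 f).coeff n
    have hmem := M.sub_mem hg (M.smul_mem c hf)
    refine hd _ hmem ((hM _ hmem).isBigO_of_coeff _ fun i hi => ?_)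
    rw [qExpansion_sub (hM g hg).analyticAt (hM _ (M.smul_mem c hf)).analyticAt,
      qExpansion_smul (hM f hf).analyticAt]
    simp only [map_sub, PowerSeries.coeff_smul, smul_eq_mul]
    rcases Nat.lt_succ_iff_lt_or_eq.1 hi with h | rfl
    · rw [hm.2 i h, hn.2 i h]; simp
    · rw [div_mul_cancel₀ _ hm.1, sub_self]

/-! ### The graded ring of forms on `Γ₀⁺(N)` for `N = 2, 3` -/

/-- A form `a` of weight `w` with value `1` at `i∞`, from which all forms on `Γ₀⁺(N)` can be
constructed; `N = 2`, `w = 2` or `N = 3`, `w = 1`. -/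
structure IsGenerator (N : ℕ) [NeZero N] (w h : ℕ) (ν : ℂ) (a : ℍ → ℂ) : Prop where
  level : N = h + 1
  weight : w * h = 2
  char : ν ^ h = -1
  form : IsForm N w ν a
  lim : Tendsto a atImInfty (𝓝 1)

/-- Forms of weight `w n` and character `s ν ^ n`. -/
def GForm (N : ℕ) [NeZero N] (w : ℕ) (ν : ℂ) (n : ℤ) (s : ℂ) (f : ℍ → ℂ) : Prop :=
  IsForm N (w * n) (ν ^ n * s) f

theorem Regular.exists_tendsto {f : ℍ → ℂ} (hf : Regular f) : ∃ c : ℂ, Tendsto f atImInfty (𝓝 c) := by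
  obtain ⟨c, hc⟩ := hf.exists_limit
  refine ⟨c, ?_⟩
  simpa using (hc.trans_tendsto tendsto_qPar).add_const c

namespace IsGenerator

variable {N : ℕ} [NeZero N] {w h : ℕ} {ν : ℂ} {a : ℍ → ℂ} (H : IsGenerator N w h ν a)
include H

theorem cases : (N = 2 ∧ h = 1 ∧ w = 2) ∨ (N = 3 ∧ h = 2 ∧ w = 1) := by
  have h1 := H.level
  have h2 := H.weight
  have h3 : h ∣ 2 := ⟨w, by rw [← h2, mul_comm]⟩
  have h4 := Nat.le_of_dvd two_pos h3
  interval_cases h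
  · simp at h2
  · left; omega
  · right; omega

theorem prime : N.Prime := by
  rcases H.cases with ⟨rfl, -⟩ | ⟨rfl, -⟩ <;> norm_num

theorem lt_four : N < 4 := by
  rcases H.cases with ⟨rfl, -⟩ | ⟨rfl, -⟩ <;> norm_num

/-- This numerical identity turns the valence bound `k (N + 1) / 24` for `k = w n` into `n / (2 h +
2)`, the form used for both levels from here on. -/
theorem weight_mul : w * (N + 1) * (2 * h + 2) = 24 := by
  rcases H.cases with ⟨rfl, rfl, rfl⟩ | ⟨rfl, rfl, rfl⟩ <;> norm_num

theorem weight_pos : 0 < w := by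
  rcases H.cases with ⟨-, -, rfl⟩ | ⟨-, -, rfl⟩ <;> norm_num

theorem char_ne_zero : ν ≠ 0 := by
  rintro rfl
  have h1 := H.char
  rcases H.cases with ⟨-, rfl, -⟩ | ⟨-, rfl, -⟩ <;> norm_num at h1

theorem char_pow_24 (n : ℤ) {s : ℂ} (hs : s ^ 2 = 1) : (ν ^ n * s) ^ 24 = 1 := by
  have h1 : ν ^ 24 = 1 := by
    have h2 := H.char
    rcases H.cases with ⟨-, rfl, -⟩ | ⟨-, rfl, -⟩
    · rw [pow_one] at h2; rw [h2]; norm_num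
    · rw [show 24 = 2 * 12 by norm_num, pow_mul, h2]; norm_num
  rw [mul_pow, show s ^ 24 = (s ^ 2) ^ 12 by ring, hs, one_pow, mul_one, ← zpow_natCast, ← zpow_mul,
    mul_comm, zpow_mul, zpow_natCast, h1, one_zpow]

theorem eq_zero_of_isBigO {n : ℤ} {s : ℂ} (hs : s ^ 2 = 1) {f : ℍ → ℂ} (hf : GForm N w ν n s f) {m : ℤ}
    (hm : f =O[atImInfty] fun z => qPar z ^ m) (hnm : n < (2 * h + 2) * m) : f = 0 := by
  refine IsForm.eq_zero_of_isBigO H.lt_four H.prime hf (H.char_pow_24 n hs) hm ?_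
  have h1 : ((w * (N + 1) * (2 * h + 2) : ℕ) : ℤ) = 24 := by exact_mod_cast H.weight_mul
  have h2 : (0 : ℤ) < w * (N + 1) := by have := H.weight_pos; positivity
  push_cast at h1
  rw [← h1]
  nlinarith

theorem eq_zero_of_neg {n : ℤ} {s : ℂ} (hs : s ^ 2 = 1) {f : ℍ → ℂ} (hf : GForm N w ν n s f)
    (hn : n < 0) : f = 0 :=
  H.eq_zero_of_isBigO hs hf hf.isBigO_one (by simpa using hn)

/-- The two signs give opposite laws under `S`; this separates `a ^ n` from the forms built with the
Serre derivative. -/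
theorem eq_zero_of_both {n : ℤ} {f : ℍ → ℂ} (h1 : GForm N w ν n 1 f) (h2 : GForm N w ν n (-1) f) :
    f = 0 := by
  ext z
  have e := (h1.fricke z).symm.trans (h2.fricke z)
  have h3 := zpow_ne_zero n H.char_ne_zero
  have h4 := zpow_ne_zero (w * n) (frickeFactor_ne_zero N z)
  have : 2 * (ν ^ n * frickeFactor N z ^ (w * n : ℤ)) * f z = 0 := by linear_combination e
  simpa [h3, h4] using this

theorem pow_form (n : ℕ) : GForm N w ν n 1 (a ^ n) := by
  have := H.form.pow n
  simpa [GForm] using! this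

theorem tendsto_pow (n : ℕ) : Tendsto (a ^ n) atImInfty (𝓝 1) := by
  simpa using! H.lim.pow n

omit H in
theorem _root_.QuasiModular.GForm.mul {m n : ℤ} {s t : ℂ} {f g : ℍ → ℂ} (h0 : ν ≠ 0) (hf : GForm N w ν m s f)
    (hg : GForm N w ν n t g) : GForm N w ν (m + n) (s * t) (f * g) := by
  have := IsForm.mul hf hg
  rw [GForm, zpow_add₀ h0]
  convert this using 1 <;> ring

/-- The second generator, of weight `w + 2`. -/
theorem serre_form : GForm N w ν (h + 1) (-1) (serreD N w a) := by
  have := H.form.serreD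
  rw [GForm]
  convert this using 1
  · have := H.weight
    rw [mul_add, mul_one, add_comm]; congr 1; exact_mod_cast this
  · rw [zpow_add_one₀ H.char_ne_zero, zpow_natCast, H.char]; ring

/-- At the cusp `D a` tends to 0, `a` to 1 and `discLogDeriv` to `N + 1`. The limit is nonzero, so
the Serre derivative can serve as the form of negative sign that does not vanish at the cusp. -/
theorem tendsto_serre : Tendsto (serreD N w a) atImInfty (𝓝 (-((w : ℂ) / 24 * (N + 1)))) := by
  have h1 := H.form.toRegular.D_isBigO_qPar.trans_tendsto tendsto_qPar
  have h2 : Tendsto (discLogDeriv N) atImInfty (𝓝 (N + 1)) := by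
    simpa using (discLogDeriv_isBigO (N := N).trans_tendsto tendsto_qPar).add_const ((N : ℂ) + 1)
  have h3 := h1.sub ((h2.mul H.lim).const_mul ((w : ℂ) / 24))
  simp only [mul_one, zero_sub] at h3
  exact h3

theorem serre_lim_ne_zero : -((w : ℂ) / 24 * (N + 1)) ≠ 0 := by
  have : (w : ℂ) ≠ 0 := by exact_mod_cast H.weight_pos.ne'
  have : (N : ℂ) + 1 ≠ 0 := by exact_mod_cast N.succ_ne_zero
  simp [*]

/-! ### The form with a simple zero at the cusp and no zeros in `ℍ` -/

omit H in
/-- The form of weight `2 w + 4` and order `1` at `i∞`. -/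
def _root_.QuasiModular.genDisc (N : ℕ) [NeZero N] (w h : ℕ) (a : ℍ → ℂ) : ℍ → ℂ :=
  a ^ (2 * h + 2) - ((-((w : ℂ) / 24 * (N + 1))) ^ 2)⁻¹ • (serreD N w a) ^ 2

theorem genDisc_form : GForm N w ν (2 * h + 2) 1 (genDisc N w h a) := by
  have h1 : GForm N w ν (2 * h + 2) 1 (a ^ (2 * h + 2)) := by
    simpa using H.pow_form (2 * h + 2)
  have h2 := GForm.mul H.char_ne_zero H.serre_form H.serre_form
  have h3 : GForm N w ν (2 * h + 2) 1 ((serreD N w a) ^ 2) := by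
    rw [sq]; convert h2 using 1 <;> ring
  exact IsForm.sub h1 (h3.smul _)

theorem genDisc_isBigO : genDisc N w h a =O[atImInfty] qPar := by
  refine H.genDisc_form.toRegular.isBigO_qPar_of_tendsto ?_
  have h1 := (H.tendsto_pow (2 * h + 2)).sub
    ((H.tendsto_serre.pow 2).const_mul ((-((w : ℂ) / 24 * (N + 1))) ^ 2)⁻¹)
  rw [inv_mul_cancel₀ (pow_ne_zero 2 H.serre_lim_ne_zero), sub_self] at h1
  exact h1

/-- `genDisc` is a difference of squares. If it vanished, `a ^ (h + 1)` would be a multiple of the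
Serre derivative and hence have both signs. -/
theorem genDisc_ne_zero' : genDisc N w h a ≠ 0 := by
  intro h0
  set c := -((w : ℂ) / 24 * (N + 1)) with hc
  have hc0 : c ≠ 0 := H.serre_lim_ne_zero
  have hp : GForm N w ν (h + 1) 1 (a ^ (h + 1)) := by simpa using H.pow_form (h + 1)
  have hs := H.serre_form
  have h1 : (a ^ (h + 1) - c⁻¹ • serreD N w a) * (a ^ (h + 1) + c⁻¹ • serreD N w a) = 0 := by
    rw [← h0, genDisc, ← hc]
    ext z
    simp only [Pi.mul_apply, Pi.sub_apply, Pi.add_apply, Pi.smul_apply, Pi.pow_apply, smul_eq_mul]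
    field_simp
    ring
  have hne : a ^ (h + 1) ≠ 0 := by
    intro h2
    have := H.tendsto_pow (h + 1)
    rw [h2] at this
    exact zero_ne_one (tendsto_nhds_unique tendsto_const_nhds this)
  rcases Regular.eq_zero_of_mul_eq_zero (hp.holo.sub (hs.smul c⁻¹).holo)
    (hp.holo.add (hs.smul c⁻¹).holo) h1 with h2 | h2
  · refine hne (H.eq_zero_of_both hp ?_)
    rw [sub_eq_zero.1 h2]
    exact hs.smul c⁻¹
  · refine hne (H.eq_zero_of_both hp ?_)
    rw [eq_neg_of_add_eq_zero_left h2, show -(c⁻¹ • serreD N w a) = (-c⁻¹) • serreD N w a from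
      (_root_.neg_smul _ _).symm]
    exact hs.smul (-c⁻¹)

/-- Both sides have the same weight, and the quotient is bounded at the cusp because both orders
there are compared with `q ^ 24`. A weight-zero form is constant, so `genDisc` inherits from
`discProd` the absence of zeros in `ℍ` and the exact order at the cusp. -/
theorem exists_genDisc_pow :
    ∃ c : ℂ, c ≠ 0 ∧ ∀ z, genDisc N w h a z ^ 24 = c * discProd N z ^ (w * (2 * h + 2)) := by
  have hd0 : ∀ z, (discProd N ^ (w * (2 * h + 2))) z ≠ 0 := fun z =>
    pow_ne_zero _ (discProd_ne_zero z)
  have h1 := (H.genDisc_form.pow 24).div ((discProd_isForm (N := N)).pow (w * (2 * h + 2))) hd0 (by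
    refine (H.genDisc_isBigO.pow 24).trans ?_
    refine ((discProd_isTheta' (N := N)).pow (w * (2 * h + 2))).2.congr_left fun z => ?_
    rw [← pow_mul]
    congr 1
    rw [← H.weight_mul]; ring)
  have e1 : (w * (2 * h + 2 : ℤ)) * (24 : ℕ) - 24 * (w * (2 * h + 2) : ℕ) = 0 := by push_cast; ring
  rw [e1, H.char_pow_24 _ (by norm_num), one_pow, div_one] at h1
  obtain ⟨c, hc⟩ := h1.exists_const H.lt_four H.prime
  have hz : ∀ z, genDisc N w h a z ^ 24 = c * discProd N z ^ (w * (2 * h + 2)) := by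
    intro z
    have := congrFun hc z
    rwa [div_eq_iff (hd0 z)] at this
  refine ⟨c, ?_, hz⟩
  rintro rfl
  refine H.genDisc_ne_zero' (funext fun z => ?_)
  simpa using hz z

theorem genDisc_ne_zero (z : ℍ) : genDisc N w h a z ≠ 0 := by
  obtain ⟨c, hc, hz⟩ := H.exists_genDisc_pow
  intro h0
  have := hz z
  rw [h0, zero_pow (by norm_num)] at this
  exact mul_ne_zero hc (pow_ne_zero _ (discProd_ne_zero z)) this.symm

theorem qPar_isBigO_genDisc : qPar =O[atImInfty] genDisc N w h a := by
  obtain ⟨c, hc, hz⟩ := H.exists_genDisc_pow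
  refine IsBigO.of_pow (n := 24) (by norm_num) ?_
  have h1 := ((discProd_isTheta' (N := N)).pow (w * (2 * h + 2))).2
  have h2 : (fun z => discProd N z ^ (w * (2 * h + 2))) =O[atImInfty]
      fun z => genDisc N w h a z ^ 24 := by
    simp only [hz]
    exact (isBigO_refl _ _).const_mul_right hc
  refine (h1.trans h2).congr_left fun z => ?_
  rw [← pow_mul, Pi.pow_apply]
  congr 1
  rw [← H.weight_mul]; ring

/-- Forms that vanish at `i∞` are divisible by `genDisc`. -/
theorem exists_eq_genDisc_mul {n : ℤ} {s : ℂ} {f : ℍ → ℂ} (hf : GForm N w ν n s f)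
    (h0 : Tendsto f atImInfty (𝓝 0)) :
    ∃ g, GForm N w ν (n - (2 * h + 2)) s g ∧ f = genDisc N w h a * g := by
  refine ⟨fun z => f z / genDisc N w h a z, ?_, ?_⟩
  · have := IsForm.div hf H.genDisc_form H.genDisc_ne_zero
      ((hf.toRegular.isBigO_qPar_of_tendsto h0).trans H.qPar_isBigO_genDisc)
    rw [GForm, zpow_sub₀ H.char_ne_zero]
    convert this using 1 <;> ring
  · ext z
    rw [Pi.mul_apply, mul_div_cancel₀ _ (H.genDisc_ne_zero z)]

/-- There is only one cusp, so one form `b` with nonzero limit suffices to remove the constant term;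
the remainder is divisible by `genDisc`. -/
theorem exists_decomp {n : ℤ} {s : ℂ} {f b : ℍ → ℂ} (hf : GForm N w ν n s f) (hb : GForm N w ν n s b)
    {β : ℂ} (hβ : β ≠ 0) (hbl : Tendsto b atImInfty (𝓝 β)) :
    ∃ c : ℂ, ∃ g, GForm N w ν (n - (2 * h + 2)) s g ∧ f = c • b + genDisc N w h a * g := by
  obtain ⟨L, hL⟩ := hf.toRegular.exists_tendsto
  obtain ⟨g, hg, e⟩ := H.exists_eq_genDisc_mul (f := f - (L / β) • b) (hf.sub (hb.smul _)) (by
    have := hL.sub (hbl.const_mul (L / β))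
    rw [div_mul_cancel₀ _ hβ, sub_self] at this
    exact this)
  exact ⟨L / β, g, hg, by rw [← e]; simp⟩

/-- There are no forms with negative sign in small weights. -/
theorem eq_zero_of_lt {n : ℤ} {f : ℍ → ℂ} (hf : GForm N w ν n (-1) f) (hn : n < h + 1) : f = 0 := by
  rcases lt_or_ge n 0 with hn0 | hn0
  · exact H.eq_zero_of_neg (by norm_num) hf hn0
  lift n to ℕ using hn0
  obtain ⟨L, hL⟩ := hf.toRegular.exists_tendsto
  have hp := H.pow_form n
  have h2 := GForm.mul H.char_ne_zero hf hf
  have h3 := GForm.mul H.char_ne_zero hp hp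
  norm_num only at h2 h3
  -- The square of `f` has positive sign, as has `a ^ (2 n)`. Their combination vanishes at the cusp
  -- in weight index `2 n < 2 h + 2`, too small for a nonzero form. Factoring it gives `f = ± L a ^
  -- n`, which then has both signs.
  have h4 : f * f - (L * L) • (a ^ n * a ^ n) = 0 := by
    have hfm := IsForm.sub h2 (h3.smul (L * L))
    refine H.eq_zero_of_isBigO (n := n + n) (s := 1) (m := 1) (by norm_num) (by simpa [GForm] using hfm)
      ?_ (by linarith)
    simp only [zpow_one]
    refine hfm.toRegular.isBigO_qPar_of_tendsto ?_
    have := (hL.mul hL).sub (((H.tendsto_pow n).mul (H.tendsto_pow n)).const_mul (L * L))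
    simp only [mul_one, sub_self] at this
    exact this
  have h5 : (f - L • a ^ n) * (f + L • a ^ n) = 0 := by
    rw [← h4]; ext z
    simp only [Pi.mul_apply, Pi.sub_apply, Pi.add_apply, Pi.smul_apply, smul_eq_mul]; ring
  rcases Regular.eq_zero_of_mul_eq_zero (hf.holo.sub (hp.smul L).holo)
    (hf.holo.add (hp.smul L).holo) h5 with h6 | h6
  · refine H.eq_zero_of_both ?_ hf
    rw [sub_eq_zero.1 h6]; exact hp.smul L
  · refine H.eq_zero_of_both ?_ hf
    rw [eq_neg_of_add_eq_zero_left h6, show -(L • a ^ n) = (-L) • a ^ n from (_root_.neg_smul _ _).symm]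
    exact hp.smul (-L)

/-- Forms of weight `w (n₀ + e j + r)`, for suitable `n₀` and `e = 2 h + 2`, are divisible by
`a ^ r`. -/
theorem exists_eq_pow_mul {s : ℂ} {n₀ : ℤ} {b : ℍ → ℂ} {β : ℂ} (hb : GForm N w ν n₀ s b) (hβ : β ≠ 0)
    (hbl : Tendsto b atImInfty (𝓝 β)) {r : ℕ}
    (h0 : ∀ g, GForm N w ν (n₀ + r - (2 * h + 2)) s g → g = 0) (j : ℕ) :
    ∀ f, GForm N w ν (n₀ + (2 * h + 2) * j + r) s f →
      ∃ g, GForm N w ν (n₀ + (2 * h + 2) * j) s g ∧ f = a ^ r * g := by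
  have hbp : ∀ m : ℕ, GForm N w ν (n₀ + m) s (b * a ^ m) := fun m => by
    simpa using GForm.mul H.char_ne_zero hb (H.pow_form m)
  have hbpl : ∀ m : ℕ, Tendsto (b * a ^ m) atImInfty (𝓝 β) := fun m => by
    simpa using! hbl.mul (H.tendsto_pow m)
  induction j with
  | zero =>
    intro f hf
    -- The remainder `g` lies in the space that vanishes by `h0`, so `f` is a multiple of `b a ^ r`.
    obtain ⟨c, g, hg, rfl⟩ := H.exists_decomp (n := n₀ + r) (by simpa using hf) (hbp r) hβ (hbpl r)
    refine ⟨c • b, by simpa using! hb.smul c, ?_⟩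
    rw [h0 g hg]
    ext z; simp; ring
  | succ j ih =>
    intro f hf
    have e : (n₀ + ((2 * h + 2) * (j + 1) + r : ℕ) : ℤ) = n₀ + (2 * h + 2) * (j + 1 : ℕ) + r := by
      push_cast; ring
    have e' : (n₀ + ((2 * h + 2) * (j + 1) : ℕ) : ℤ) = n₀ + (2 * h + 2) * (j + 1 : ℕ) := by
      push_cast; ring
    -- The comparison form `b a ^ ((2 h + 2) (j + 1) + r)` visibly contains `a ^ r`, and the
    -- cofactor of `genDisc` does so by induction.
    obtain ⟨c, g, hg, rfl⟩ := H.exists_decomp hf (by rw [← e]; exact hbp _) hβ (hbpl _)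
    obtain ⟨g', hg', rfl⟩ := ih g (by convert hg using 1; push_cast; ring)
    refine ⟨c • (b * a ^ ((2 * h + 2) * (j + 1))) + genDisc N w h a * g', ?_, ?_⟩
    · rw [← e']
      refine IsForm.add ((hbp _).smul c) ?_
      have := GForm.mul H.char_ne_zero H.genDisc_form hg'
      have e2 : (2 * h + 2 + (n₀ + (2 * h + 2) * j) : ℤ) = n₀ + (2 * h + 2) * (j + 1 : ℕ) := by
        push_cast; ring
      rwa [one_mul, e2, ← e'] at this
    · ext z; simp; ring

theorem exists_eq_pow_mul_of_pos {j r : ℕ} (hr : r < 2 * h + 2) {f : ℍ → ℂ}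
    (hf : GForm N w ν ((2 * h + 2) * j + r) 1 f) :
    ∃ g, GForm N w ν ((2 * h + 2) * j) 1 g ∧ f = a ^ r * g := by
  have := H.exists_eq_pow_mul (n₀ := 0) (by simpa using H.pow_form 0) one_ne_zero (H.tendsto_pow 0)
    (r := r) (fun g hg => H.eq_zero_of_neg (by norm_num) hg (by omega)) j f (by simpa using hf)
  simpa using this

theorem exists_eq_pow_mul_of_neg {j r : ℕ} (hr : r < 2 * h + 2) {f : ℍ → ℂ}
    (hf : GForm N w ν (h + 1 + (2 * h + 2) * j + r) (-1) f) :
    ∃ g, GForm N w ν (h + 1 + (2 * h + 2) * j) (-1) g ∧ f = a ^ r * g :=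
  H.exists_eq_pow_mul H.serre_form H.serre_lim_ne_zero H.tendsto_serre
    (r := r) (fun g hg => H.eq_zero_of_lt hg (by omega)) j f hf

/-! ### Dimensions -/

omit H in
/-- The space of forms of weight `w n` and character `s ν ^ n`. -/
def _root_.QuasiModular.gSpace (N : ℕ) [NeZero N] (w : ℕ) (ν : ℂ) (n : ℤ) (s : ℂ) : Submodule ℂ (ℍ → ℂ) where
  carrier := {f | GForm N w ν n s f}
  zero_mem' := IsForm.zero
  add_mem' hf hg := IsForm.add hf hg
  smul_mem' c _ hf := IsForm.smul c hf

theorem gSpace_finite (n : ℤ) {s : ℂ} (hs : s ^ 2 = 1) : Module.Finite ℂ (gSpace N w ν n s) := by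
  refine finite_of_isBigO (d := n.toNat + 1) (fun f hf => hf.toRegular) fun f hf hO => ?_
  refine H.eq_zero_of_isBigO hs hf hO ?_
  have := Int.self_le_toNat n
  push_cast
  nlinarith [n.toNat.zero_le]

/-- Multiples of `genDisc` vanish at the cusp and `b` does not, so `b` adds one dimension to the
image of multiplication by `genDisc`. -/
theorem finrank_gSpace_succ {n : ℤ} {s : ℂ} (hs : s ^ 2 = 1) {b : ℍ → ℂ}
    (hb : GForm N w ν (n + (2 * h + 2)) s b) {β : ℂ} (hβ : β ≠ 0) (hbl : Tendsto b atImInfty (𝓝 β)) :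
    Module.finrank ℂ (gSpace N w ν n s) + 1 ≤ Module.finrank ℂ (gSpace N w ν (n + (2 * h + 2)) s) := by
  have := H.gSpace_finite n hs
  have := H.gSpace_finite (n + (2 * h + 2)) hs
  let φ : (gSpace N w ν n s × ℂ) →ₗ[ℂ] gSpace N w ν (n + (2 * h + 2)) s :=
    { toFun := fun p => ⟨genDisc N w h a * (p.1 : ℍ → ℂ) + p.2 • b, by
        refine IsForm.add ?_ (hb.smul p.2)
        have := GForm.mul H.char_ne_zero H.genDisc_form p.1.2
        rw [one_mul, add_comm] at this
        exact this⟩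
      map_add' := fun p q => by ext z; simp; ring
      map_smul' := fun c p => by ext z; simp; ring }
  have hφ : Injective φ := by
    rw [← LinearMap.ker_eq_bot, LinearMap.ker_eq_bot']
    rintro ⟨g, c⟩ hp
    have h1 : genDisc N w h a * (g : ℍ → ℂ) + c • b = 0 := congrArg Subtype.val hp
    have hg : GForm N w ν n s g := g.2
    have h2 : Tendsto (genDisc N w h a * (g : ℍ → ℂ)) atImInfty (𝓝 0) := by
      have := H.genDisc_isBigO.mul hg.isBigO_one
      simp only [zpow_zero, mul_one] at this
      exact this.trans_tendsto tendsto_qPar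
    have hc : c = 0 := by
      have h3 := h2.add (hbl.const_mul c)
      have h4 : (fun z => (genDisc N w h a * (g : ℍ → ℂ)) z + c * b z) = fun _ => 0 := h1
      rw [h4] at h3
      have := tendsto_nhds_unique h3 tendsto_const_nhds
      simpa [hβ] using this
    rw [hc, zero_smul, add_zero] at h1
    have hg0 : (g : ℍ → ℂ) = 0 := by
      ext z
      have := congrFun h1 z
      simpa [H.genDisc_ne_zero z] using this
    ext1
    · exact Subtype.ext hg0
    · exact hc
  have := LinearMap.finrank_le_finrank_of_injective hφ
  rwa [Module.finrank_prod, Module.finrank_self] at this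

/-- The hypothesis says `n = (2 h + 2) (j - 1) + r`; shifting it lets the induction start from the
trivial bound at `j = 0`. Each step uses a power of `a` as the form not vanishing at the cusp. -/
theorem le_finrank_pos (j r : ℕ) {n : ℤ} (hn : n + (2 * h + 2) = (2 * h + 2) * j + r) :
    j ≤ Module.finrank ℂ (gSpace N w ν n 1) := by
  induction j generalizing n with
  | zero => exact Nat.zero_le _
  | succ j ih =>
    have h1 := ih (n := n - (2 * h + 2)) (by push_cast at hn ⊢; linarith)
    have h2 := H.finrank_gSpace_succ (n := n - (2 * h + 2)) (s := 1) (by norm_num)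
      (b := a ^ ((2 * h + 2) * j + r)) (by
        convert H.pow_form ((2 * h + 2) * j + r) using 1
        push_cast at hn ⊢; linarith) one_ne_zero (H.tendsto_pow _)
    rw [sub_add_cancel] at h2
    omega

/-- As for positive sign, with the Serre derivative times a power of `a` as the nonvanishing form;
its index `h + 1` accounts for the shift. -/
theorem le_finrank_neg (j r : ℕ) {n : ℤ} (hn : n + (h + 1) = (2 * h + 2) * j + r) :
    j ≤ Module.finrank ℂ (gSpace N w ν n (-1)) := by
  induction j generalizing n with
  | zero => exact Nat.zero_le _
  | succ j ih =>
    have h1 := ih (n := n - (2 * h + 2)) (by push_cast at hn ⊢; linarith)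
    have h2 := H.finrank_gSpace_succ (n := n - (2 * h + 2)) (s := -1) (by norm_num)
      (b := serreD N w a * a ^ ((2 * h + 2) * j + r)) (by
        have := GForm.mul H.char_ne_zero H.serre_form (H.pow_form ((2 * h + 2) * j + r))
        rw [mul_one] at this
        convert this using 1
        push_cast at hn ⊢; linarith) H.serre_lim_ne_zero
      (by simpa using! H.tendsto_serre.mul (H.tendsto_pow _))
    rw [sub_add_cancel] at h2
    omega

end IsGenerator

namespace IsGenerator

variable {N : ℕ} [NeZero N] {w h : ℕ} {ν : ℂ} {a : ℍ → ℂ} (H : IsGenerator N w h ν a)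
include H

/-! ### Vanishing orders of quasimodular forms -/

/-- Because `w h = 2` and `ν ^ h = -1`, lowering the weight by 2 lowers the index by `h` and flips
the sign. -/
theorem isForm_sub_two_iff {n : ℤ} {s t : ℂ} (ht : t = -s) {f : ℍ → ℂ} :
    IsForm N (w * n - 2) (ν ^ n * s) f ↔ GForm N w ν (n - h) t f := by
  have e1 : (w * (n - h) : ℤ) = w * n - 2 := by
    have : ((w * h : ℕ) : ℤ) = 2 := by rw [H.weight]; rfl
    push_cast at this
    linear_combination -this
  have e2 : ν ^ (n - h : ℤ) * t = ν ^ n * s := by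
    rw [zpow_sub₀ H.char_ne_zero, zpow_natCast, H.char, ht]; ring
  rw [GForm, e1, e2]

/-- The valence bound is applied to the Wronskian, whose index is `2 n` and whose sign is positive
since `s² = 1`. -/
theorem quasi_eq_zero {n : ℤ} {s : ℂ} (hs : s ^ 2 = 1) {f₀ f₁ : ℍ → ℂ}
    (hf : IsQuasi N (w * n) (ν ^ n * s) f₀ f₁) {m : ℤ} (hO : f₀ =O[atImInfty] fun z => qPar z ^ m)
    (hnm : 2 * n < (2 * h + 2) * m) : f₀ = 0 := by
  by_contra h0
  refine hf.wronskian_ne_zero h0 (H.eq_zero_of_isBigO (n := 2 * n) (s := 1) (by norm_num) ?_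
    (hf.wronskian_isBigO hO) hnm)
  have := hf.wronskian_isForm
  rw [GForm]
  convert this using 1
  · ring
  · rw [mul_pow, hs, mul_comm 2 n, zpow_mul]; rfl

/-- If both modular components contain `a ^ r`, then `f₀` is `a ^ r` times a quasimodular form of
index `n`. Since `a` tends to 1 the order at the cusp is unchanged, so the condition on `m` involves
`n` instead of `n + r`. -/
theorem quasi_eq_zero_of_dvd {n : ℤ} {r : ℕ} {s t : ℂ} (hs : s ^ 2 = 1) (ht : t = -s)
    (h0 : ∀ g, GForm N w ν (n + r) s g → ∃ g', GForm N w ν n s g' ∧ g = a ^ r * g')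
    (h1 : ∀ g, GForm N w ν (n + r - h) t g → ∃ g', GForm N w ν (n - h) t g' ∧ g = a ^ r * g')
    {f₀ f₁ : ℍ → ℂ} (hf : IsQuasi N (w * (n + r)) (ν ^ (n + r : ℤ) * s) f₀ f₁) {m : ℤ}
    (hO : f₀ =O[atImInfty] fun z => qPar z ^ m) (hnm : 2 * n < (2 * h + 2) * m) : f₀ = 0 := by
  obtain ⟨g₀, hg₀, rfl⟩ := hf.exists_isForm
  obtain ⟨g₁, hg₁, rfl⟩ := h1 f₁ ((H.isForm_sub_two_iff ht).1 hf.snd)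
  obtain ⟨g₀, hg, rfl⟩ := h0 g₀ hg₀
  have e : a ^ r * g₀ + quasiWeightTwo N * (a ^ r * g₁) = a ^ r * (g₀ + quasiWeightTwo N * g₁) := by
    ring
  rw [e] at hO ⊢
  rw [H.quasi_eq_zero hs (IsForm.add_quasi hg ((H.isForm_sub_two_iff ht).2 hg₁)) ?_ hnm, mul_zero]
  have h2 : (fun _ : ℍ => (1 : ℂ)) =O[atImInfty] (a ^ r) := by
    refine (isBigO_const_left_iff_pos_le_norm one_ne_zero).2 ⟨1 / 2, by norm_num, ?_⟩
    exact (H.tendsto_pow r).norm.eventually_const_le (by norm_num)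
  have h3 := h2.mul (isBigO_refl (g₀ + quasiWeightTwo N * g₁) atImInfty)
  simp only [one_mul] at h3
  exact h3.trans hO

/-- Divisibility by `a ^ r` extends from `a ^ (r + 1)`. -/
theorem exists_eq_pow_mul_of_succ {n n' : ℤ} (hn : n = n' + 1) {s : ℂ} {r : ℕ} {f : ℍ → ℂ}
    (hf : ∃ g, GForm N w ν n' s g ∧ f = a ^ (r + 1) * g) : ∃ g, GForm N w ν n s g ∧ f = a ^ r * g := by
  obtain ⟨g, hg, rfl⟩ := hf
  refine ⟨a * g, ?_, by ring⟩
  have := GForm.mul H.char_ne_zero (by simpa using H.pow_form 1) hg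
  rwa [one_mul, add_comm, ← hn] at this

/-- The map `(g₀, g₁) ↦ g₀ + φ g₁` is injective: if the sum is zero, the law of the zero function
under `S` reads `g₁ / z = 0`. -/
theorem le_finrank_quasi {n : ℤ} {s t : ℂ} (ht : t = -s) {M : Submodule ℂ (ℍ → ℂ)}
    (hM : ∀ f, f ∈ M ↔ ∃ f₁, IsQuasi N (w * n) (ν ^ n * s) f f₁) [Module.Finite ℂ M]
    (hs : s ^ 2 = 1) :
    Module.finrank ℂ (gSpace N w ν n s) + Module.finrank ℂ (gSpace N w ν (n - h) t) ≤
      Module.finrank ℂ M := by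
  have hq : ∀ (g₀ : gSpace N w ν n s) (g₁ : gSpace N w ν (n - h) t),
      IsQuasi N (w * n) (ν ^ n * s) ((g₀ : ℍ → ℂ) + quasiWeightTwo N * (g₁ : ℍ → ℂ)) g₁ :=
    fun g₀ g₁ => IsForm.add_quasi g₀.2 ((H.isForm_sub_two_iff ht).2 g₁.2)
  have := H.gSpace_finite n hs
  have := H.gSpace_finite (n - h) (s := t) (by rw [ht, neg_sq, hs])
  let φ : (gSpace N w ν n s × gSpace N w ν (n - h) t) →ₗ[ℂ] M :=
    { toFun := fun p => ⟨(p.1 : ℍ → ℂ) + quasiWeightTwo N * (p.2 : ℍ → ℂ),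
        (hM _).2 ⟨_, hq p.1 p.2⟩⟩
      map_add' := fun p q => by ext z; simp [mul_add]; ring
      map_smul' := fun c p => by ext z; simp }
  have hφ : Injective φ := by
    rw [← LinearMap.ker_eq_bot, LinearMap.ker_eq_bot']
    rintro ⟨g₀, g₁⟩ hp
    have h1 : (g₀ : ℍ → ℂ) + quasiWeightTwo N * (g₁ : ℍ → ℂ) = 0 := congrArg Subtype.val hp
    have h2 := hq g₀ g₁
    rw [h1] at h2
    have hg₁ : (g₁ : ℍ → ℂ) = 0 := by
      ext z
      have h3 := h2.fricke z
      have h4 := zpow_ne_zero (w * n) (frickeFactor_ne_zero N z)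
      have h5 := zpow_ne_zero n H.char_ne_zero
      have h6 : s ≠ 0 := by rintro rfl; norm_num at hs
      simpa [h4, h5, h6, z.ne_zero] using h3.symm
    rw [hg₁, mul_zero, add_zero] at h1
    ext1
    · exact Subtype.ext h1
    · exact Subtype.ext hg₁
  have := LinearMap.finrank_le_finrank_of_injective hφ
  rwa [Module.finrank_prod] at this

/-! ### Matching order bounds and dimensions in each residue class of the weight -/

theorem extremal_of_le {n : ℤ} {s t : ℂ} (hs : s ^ 2 = 1) (ht : t = -s) {M : Submodule ℂ (ℍ → ℂ)}
    (hM : ∀ f, f ∈ M ↔ ∃ f₁, IsQuasi N (w * n) (ν ^ n * s) f f₁) {d d₀ d₁ : ℕ}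
    (hd : d + 1 ≤ d₀ + d₁) (h₀ : d₀ ≤ Module.finrank ℂ (gSpace N w ν n s))
    (h₁ : d₁ ≤ Module.finrank ℂ (gSpace N w ν (n - h) t))
    (hO : ∀ f₀ f₁, IsQuasi N (w * n) (ν ^ n * s) f₀ f₁ →
      (f₀ =O[atImInfty] fun z => qPar z ^ ((d + 1 : ℕ) : ℤ)) → f₀ = 0) : ExtremalExistsUnique M := by
  have hreg : ∀ f ∈ M, Regular f := fun f hf => by
    obtain ⟨f₁, h1⟩ := (hM f).1 hf
    exact h1.toRegular
  have hz : ∀ f ∈ M, (f =O[atImInfty] fun z => qPar z ^ ((d + 1 : ℕ) : ℤ)) → f = 0 := fun f hf => by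
    obtain ⟨f₁, h1⟩ := (hM f).1 hf
    exact hO f f₁ h1
  have := finite_of_isBigO hreg hz
  refine extremalExistsUnique_of_isBigO hreg hz ?_
  have := H.le_finrank_quasi ht hM hs
  omega

/-- Write `n = (2 h + 2) j + r`. The component of index `n` contributes `j + 1` dimensions. The one
of index `n - h` and negative sign contributes `j`, or `j + 1` when `r = 2 h + 1`. In the first case
the factor `a ^ r` is removed, and the Wronskian bound at index `(2 h + 2) j` is exactly `2 j`; in
the second case the bound at index `n` already rounds down to `2 j + 1`. -/
theorem extremal_pos {n : ℤ} (hn : 0 ≤ n) {M : Submodule ℂ (ℍ → ℂ)}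
    (hM : ∀ f, f ∈ M ↔ ∃ f₁, IsQuasi N (w * n) (ν ^ n * 1) f f₁) : ExtremalExistsUnique M := by
  lift n to ℕ using hn
  obtain ⟨j, r, hr, rfl⟩ : ∃ j r, r < 2 * h + 2 ∧ n = (2 * h + 2) * j + r :=
    ⟨n / (2 * h + 2), n % (2 * h + 2), Nat.mod_lt _ (by omega), (Nat.div_add_mod _ _).symm⟩
  have hd₀ := H.le_finrank_pos (j + 1) r (n := ((2 * h + 2) * j + r : ℕ)) (by push_cast; ring)
  rcases Nat.lt_succ_iff_lt_or_eq.1 hr with hr' | rfl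
  · refine H.extremal_of_le (s := 1) (t := -1) (d := 2 * j) (by norm_num) rfl hM (by omega) hd₀
      (H.le_finrank_neg j (r + 1) (by push_cast; ring)) fun f₀ f₁ hf hO => ?_
    push_cast at hf
    refine H.quasi_eq_zero_of_dvd (s := 1) (t := -1) (by norm_num) rfl
      (fun g hg => H.exists_eq_pow_mul_of_pos hr hg) (fun g hg => ?_) hf hO (by push_cast; linarith)
    cases j with
    | zero =>
      rw [H.eq_zero_of_lt hg (by push_cast; omega)]
      exact ⟨0, IsForm.zero, by simp⟩
    | succ j =>
      -- For the second component the residue is one larger, so it even contains `a ^ (r + 1)`; one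
      -- factor is given back.
      refine H.exists_eq_pow_mul_of_succ (n' := h + 1 + (2 * h + 2) * j) (by push_cast; ring)
        (H.exists_eq_pow_mul_of_neg (by omega) ?_)
      convert hg using 1
      push_cast; ring
  · refine H.extremal_of_le (s := 1) (t := -1) (d := 2 * j + 1) (by norm_num) rfl hM (by omega) hd₀
      (H.le_finrank_neg (j + 1) 0 (by push_cast; ring)) fun f₀ f₁ hf hO =>
        H.quasi_eq_zero (by norm_num) hf hO (by push_cast; linarith)

/-- Write `n = h + (2 h + 2) j + r`. The second component now has positive sign and contributes `j +
1` dimensions. The first contributes `j` if `r = 0` and `j + 1` otherwise. For `r > 0` removing `a ^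
(r - 1)` leads to index `h + 1 + (2 h + 2) j`, where the Wronskian bound is exactly `2 j + 1`. For
`n < h` both components vanish, whence the hypothesis. -/
theorem extremal_neg {n : ℤ} (hn : h ≤ n) {M : Submodule ℂ (ℍ → ℂ)}
    (hM : ∀ f, f ∈ M ↔ ∃ f₁, IsQuasi N (w * n) (ν ^ n * (-1)) f f₁) : ExtremalExistsUnique M := by
  obtain ⟨n, rfl⟩ : ∃ m : ℕ, n = h + m := ⟨(n - h).toNat, by omega⟩
  obtain ⟨j, r, hr, rfl⟩ : ∃ j r, r < 2 * h + 2 ∧ n = (2 * h + 2) * j + r :=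
    ⟨n / (2 * h + 2), n % (2 * h + 2), Nat.mod_lt _ (by omega), (Nat.div_add_mod _ _).symm⟩
  have hd₁ := H.le_finrank_pos (j + 1) r (n := h + ((2 * h + 2) * j + r : ℕ) - h)
    (by push_cast; ring)
  cases r with
  | zero =>
    refine H.extremal_of_le (s := -1) (t := 1) (d := 2 * j) (by norm_num) (by norm_num) hM
      (d₀ := j) (by omega)
      (H.le_finrank_neg j (2 * h + 1) (by push_cast; ring)) hd₁ fun f₀ f₁ hf hO =>
        H.quasi_eq_zero (by norm_num) hf hO (by push_cast; linarith)
  | succ r =>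
    refine H.extremal_of_le (s := -1) (t := 1) (d := 2 * j + 1) (by norm_num) (by norm_num) hM
      (d₀ := j + 1) (by omega)
      (H.le_finrank_neg (j + 1) r (by push_cast; ring)) hd₁ fun f₀ f₁ hf hO => ?_
    have e : (h + ((2 * h + 2) * j + (r + 1) : ℕ) : ℤ) = h + 1 + (2 * h + 2) * j + r := by
      push_cast; ring
    rw [e] at hf
    refine H.quasi_eq_zero_of_dvd (s := -1) (t := 1) (by norm_num) (by norm_num)
      (fun g hg => H.exists_eq_pow_mul_of_neg (by omega) hg) (fun g hg => ?_) hf hO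
      (by push_cast; linarith)
    refine H.exists_eq_pow_mul_of_succ (n' := (2 * h + 2) * j) (by ring)
      (H.exists_eq_pow_mul_of_pos hr ?_)
    convert hg using 1
    push_cast; ring

end IsGenerator

/-! ### The generator for level two -/

/-- The quotient `Δ(2 z) / Δ(z)`. -/
def discQuot (z : ℍ) : ℂ := discScale 2 z / discriminant z

theorem discQuot_ne_zero (z : ℍ) : discQuot z ≠ 0 :=
  div_ne_zero (discriminant_ne_zero _) (discriminant_ne_zero _)

theorem discQuot_isTheta : discQuot =Θ[atImInfty] fun z => qPar z ^ 1 := by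
  refine ((discScale_isTheta (N := 2)).div discriminant_isTheta).trans_eventuallyEq
    (Eventually.of_forall fun z => ?_)
  have := qPar_ne_zero z
  simp only
  field_simp

theorem discQuot_regular : Regular discQuot where
  holo := mdifferentiable_div (mdifferentiable_comp_natScale mdifferentiable_discriminant)
    mdifferentiable_discriminant fun z => discriminant_ne_zero z
  vadd z := by
    simp only [discQuot, discScale, discriminant_eq_of_qPar_eq (qPar_vadd z),
      discriminant_eq_of_qPar_eq (qPar_natScale_vadd z)]
  bdd := isBoundedAtImInfty_iff_isBigO.2 (discQuot_isTheta.1.trans (by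
    simpa using qPar_pow_isBigO zero_le_one))

theorem discQuot_fricke (z : ℍ) : discQuot (fricke 2 z) = (2 ^ 12 * discQuot z)⁻¹ := by
  have := z.ne_zero
  have := discriminant_ne_zero z
  rw [discQuot, discQuot, discScale_fricke, discriminant_fricke]
  push_cast
  field_simp

/-- The form `2 E₂(2 z) - E₂(z)`, as a logarithmic derivative. -/
def genTwo (z : ℍ) : ℂ := D discQuot z / discQuot z

/-- The Fricke involution sends `Δ(2z) / Δ(z)` to a constant times its inverse, so its logarithmic
derivative is modular of weight 2 with sign `-1`. The limit 1 is the order of the quotient at the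
cusp. -/
theorem isGenerator_two : IsGenerator 2 2 1 (-1) genTwo where
  level := rfl
  weight := rfl
  char := by norm_num
  lim := by
    have := (logDeriv_isBigO discQuot_regular discQuot_ne_zero discQuot_isTheta).trans_tendsto
      tendsto_qPar
    simpa using! this.add_const (1 : ℂ)
  form :=
    { toRegular := logDeriv_regular discQuot_regular discQuot_ne_zero discQuot_isTheta
      fricke := fun z => by
        have h0 := discQuot_ne_zero z
        have hd := hasDerivAt_comp_ofComplex discQuot_regular.holo z
        have h1 : HasDerivAt ((fun z => discQuot (fricke 2 z)) ∘ ofComplex)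
            (-(2 ^ 12 * (2 * Real.pi * Complex.I * D discQuot z)) / (2 ^ 12 * discQuot z) ^ 2) z := by
          have h2 := (hd.const_mul (2 ^ 12 : ℂ)).inv (by simpa using h0)
          simp only [comp_apply, ofComplex_apply] at h2
          refine h2.congr_of_eventuallyEq (Eventually.of_forall fun w => ?_)
          simp only [comp_apply, discQuot_fricke, Pi.inv_apply]
        rw [genTwo, D_comp_fricke 2 discQuot_regular.holo, D_eq_of_hasDerivAt h1, discQuot_fricke,
          genTwo]
        have := Complex.two_pi_I_ne_zero
        have hf : frickeFactor 2 z ^ (((2 : ℕ) : ℤ)) = 2 * (z : ℂ) ^ 2 := by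
          rw [zpow_natCast, frickeFactor_sq]; norm_num
        rw [hf]
        push_cast
        field_simp }

/-! ### The generator for level three -/

theorem jacobiTheta_of_eq {τ τ' : ℂ} (hτ : 0 < τ.im) (h : τ' = -1 / τ) :
    jacobiTheta τ' = (-Complex.I * τ) ^ (1 / 2 : ℂ) * jacobiTheta τ := by
  have h1 := jacobiTheta_S_smul ⟨τ, hτ⟩
  rw [UpperHalfPlane.modular_S_smul] at h1
  rw [← show ((⟨τ, hτ⟩ : ℍ) : ℂ) = τ from rfl, ← h1, h]
  congr 1
  change -1 / τ = (-τ)⁻¹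
  rw [neg_div, one_div, inv_neg]

theorem neg_I_mul_cpow_half {c : ℝ} (hc : 0 < c) {τ : ℂ} (hτ : τ ≠ 0) :
    (-Complex.I * (c * τ)) ^ (1 / 2 : ℂ) = √c * (-Complex.I * τ) ^ (1 / 2 : ℂ) := by
  have h0 : -Complex.I * τ ≠ 0 := mul_ne_zero (neg_ne_zero.2 Complex.I_ne_zero) hτ
  have e : -Complex.I * (c * τ) = c * (-Complex.I * τ) := by ring
  have hc' : (c : ℂ) ≠ 0 := by exact_mod_cast hc.ne'
  rw [e, Complex.cpow_def_of_ne_zero (mul_ne_zero hc' h0), Complex.log_ofReal_mul hc h0, add_mul,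
    Complex.exp_add, ← Complex.cpow_def_of_ne_zero h0, Real.sqrt_eq_rpow, Complex.ofReal_cpow hc.le,
    Complex.cpow_def_of_ne_zero hc', Complex.ofReal_log hc.le]
  norm_num

/-- The odd part of the theta series. -/
def thetaOdd (τ : ℂ) : ℂ := jacobiTheta τ - jacobiTheta (4 * τ)

theorem hasSum_thetaOdd {τ : ℂ} (hτ : 0 < τ.im) :
    HasSum (fun n : ℤ => Complex.exp (Real.pi * Complex.I * (2 * n + 1) ^ 2 * τ)) (thetaOdd τ) := by
  have h1 : ∀ {τ : ℂ}, 0 < τ.im →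
      HasSum (fun n : ℤ => Complex.exp (Real.pi * Complex.I * n ^ 2 * τ)) (jacobiTheta τ) := by
    intro τ hτ
    rw [jacobiTheta_eq_jacobiTheta₂]
    simpa [jacobiTheta₂_term] using hasSum_jacobiTheta₂_term 0 hτ
  have h2 := h1 (τ := 4 * τ) (by simpa using hτ)
  have hs : Summable fun n : ℤ => Complex.exp (Real.pi * Complex.I * (2 * n + 1) ^ 2 * τ) := by
    have := (h1 hτ).summable.comp_injective (i := fun n : ℤ => 2 * n + 1) (fun a b h => by
      simpa using h)
    simpa [comp_def] using this
  have h3 : HasSum (fun n : ℤ => Complex.exp (Real.pi * Complex.I * n ^ 2 * τ))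
      (jacobiTheta (4 * τ) + ∑' n : ℤ, Complex.exp (Real.pi * Complex.I * (2 * n + 1) ^ 2 * τ)) := by
    have hi : Injective fun n : ℤ => 2 * n := fun a b h => by simpa using h
    have hi' : Injective fun n : ℤ => 2 * n + 1 := fun a b h => by simpa using h
    have hc : IsCompl (Set.range fun n : ℤ => 2 * n) (Set.range fun n : ℤ => 2 * n + 1) := by
      rw [range_two_mul, range_two_mul_add_one]
      exact Int.isCompl_even_odd
    set F : ℤ → ℂ := fun n => Complex.exp (Real.pi * Complex.I * n ^ 2 * τ)
    have a1 : HasSum (F ∘ fun n : ℤ => 2 * n) (jacobiTheta (4 * τ)) := by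
      convert! h2 using 2 with n
      simp only [F, comp_apply]
      congr 1
      push_cast
      ring
    have a2 : HasSum (F ∘ fun n : ℤ => 2 * n + 1)
        (∑' n : ℤ, Complex.exp (Real.pi * Complex.I * (2 * n + 1) ^ 2 * τ)) := by
      convert! hs.hasSum using 2 with n
      simp [F]
    exact HasSum.add_isCompl hc ((Injective.hasSum_range_iff (f := F) hi).2 a1)
      ((Injective.hasSum_range_iff (f := F) hi').2 a2)
  have h4 := (h1 hτ).unique h3
  rw [thetaOdd, h4, add_sub_cancel_left]
  exact hs.hasSum

/-- All exponents are odd squares, which are congruent to 1 modulo 8, so every term picks up the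
same factor `exp (π i / 2)`. -/
theorem thetaOdd_add_half {τ : ℂ} (hτ : 0 < τ.im) : thetaOdd (τ + 1 / 2) = Complex.I * thetaOdd τ := by
  have h1 := (hasSum_thetaOdd hτ).mul_left Complex.I
  refine (hasSum_thetaOdd (τ := τ + 1 / 2) (by simpa using hτ)).unique ?_
  convert! h1 using 2 with n
  have e : (Real.pi * Complex.I * (2 * n + 1) ^ 2 * (τ + 1 / 2) : ℂ) =
      ((n * (n + 1) : ℤ) : ℂ) * (2 * Real.pi * Complex.I) + (Real.pi / 2 * Complex.I) +
        Real.pi * Complex.I * (2 * n + 1) ^ 2 * τ := by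
    push_cast; ring
  rw [e, Complex.exp_add, Complex.exp_add, Complex.exp_int_mul_two_pi_mul_I, Complex.exp_pi_div_two_mul_I,
    one_mul]

/-- The theta function `∑ q ^ (m² + m n + n²)` in terms of one-dimensional theta functions. -/
def genThree (z : ℍ) : ℂ :=
  jacobiTheta (2 * z) * jacobiTheta (6 * z) + thetaOdd (z / 2) * thetaOdd (3 * z / 2)

theorem im_ofReal_mul_pos {c : ℝ} (hc : 0 < c) (z : ℍ) : 0 < (c * z : ℂ).im := by
  rw [Complex.im_ofReal_mul]
  exact mul_pos hc z.im_pos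

theorem tendsto_jacobiTheta {c : ℝ} (hc : 0 < c) :
    Tendsto (fun z : ℍ => jacobiTheta (c * z)) atImInfty (𝓝 1) := by
  have h1 : Tendsto (fun z : ℍ => (c * z : ℂ)) atImInfty (comap Complex.im atTop) := by
    rw [tendsto_comap_iff]
    have : (Complex.im ∘ fun z : ℍ => (c * z : ℂ)) = fun z : ℍ => c * z.im := by
      ext z; simp
    rw [this]
    exact tendsto_comap.const_mul_atTop hc
  have h2 : Tendsto (fun τ : ℂ => Real.exp (-Real.pi * τ.im)) (comap Complex.im atTop) (𝓝 0) :=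
    Real.tendsto_exp_atBot.comp (tendsto_comap.const_mul_atTop_of_neg (neg_neg_of_pos Real.pi_pos))
  have h3 := (isBigO_at_im_infty_jacobiTheta_sub_one.trans_tendsto h2).comp h1
  simpa using! h3.add_const (1 : ℂ)

theorem mdifferentiable_jacobiTheta {c : ℝ} (hc : 0 < c) :
    MDiff (fun z : ℍ => jacobiTheta (c * z)) := by
  rw [UpperHalfPlane.mdifferentiable_iff]
  have : DifferentiableOn ℂ (fun w : ℂ => jacobiTheta (c * w)) upperHalfPlaneSet := fun w hw =>
    ((differentiableAt_jacobiTheta (im_ofReal_mul_pos hc ⟨w, hw⟩)).comp w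
      (by fun_prop)).differentiableWithinAt
  exact this.congr fun w hw => by simp only [comp_apply, ofComplex_apply_of_im_pos hw]

/-- The expanded form suits the Fricke involution and the limit at the cusp, both known for single
theta functions. Periodicity is read off from the form with odd parts. -/
theorem genThree_eq : genThree = fun z : ℍ =>
    2 * (jacobiTheta ((2 : ℝ) * z) * jacobiTheta ((6 : ℝ) * z)) +
      jacobiTheta ((1 / 2 : ℝ) * z) * jacobiTheta ((3 / 2 : ℝ) * z) -
      jacobiTheta ((1 / 2 : ℝ) * z) * jacobiTheta ((6 : ℝ) * z) -
      jacobiTheta ((2 : ℝ) * z) * jacobiTheta ((3 / 2 : ℝ) * z) := by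
  ext z
  have e1 : (4 * (z / 2) : ℂ) = 2 * z := by ring
  have e2 : (4 * (3 * z / 2) : ℂ) = 6 * z := by ring
  have e3 : (1 / 2 * z : ℂ) = z / 2 := by ring
  have e4 : (3 / 2 * z : ℂ) = 3 * z / 2 := by ring
  push_cast
  rw [genThree, thetaOdd, thetaOdd, e1, e2, e3, e4]
  ring

theorem genThree_vadd (z : ℍ) : genThree ((1 : ℝ) +ᵥ z) = genThree z := by
  have hz : 0 < ((z : ℂ) / 2).im := by simpa using z.im_pos
  have hz' : 0 < (3 * (z : ℂ) / 2).im := by simpa using z.im_pos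
  have e1 : (2 * ((((1 : ℝ) +ᵥ z : ℍ)) : ℂ)) = 2 + 2 * z := by simp; ring
  have e2 : (6 * ((((1 : ℝ) +ᵥ z : ℍ)) : ℂ)) = 2 + (2 + (2 + 6 * z)) := by simp; ring
  have e3 : (((((1 : ℝ) +ᵥ z : ℍ)) : ℂ) / 2) = z / 2 + 1 / 2 := by simp; ring
  have e4 : (3 * ((((1 : ℝ) +ᵥ z : ℍ)) : ℂ) / 2) = 3 * z / 2 + 1 / 2 + 1 / 2 + 1 / 2 := by
    simp; ring
  rw [genThree, e1, e2, e3, e4, jacobiTheta_two_add, jacobiTheta_two_add, jacobiTheta_two_add,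
    jacobiTheta_two_add, thetaOdd_add_half hz, thetaOdd_add_half (by simpa using hz'),
    thetaOdd_add_half (by simpa using hz'), thetaOdd_add_half hz', genThree]
  -- The odd parts contribute `i` and `i³`, whose product is 1.
  linear_combination (thetaOdd (z / 2) * thetaOdd (3 * z / 2)) * (Complex.I * Complex.I - 1) *
    Complex.I_mul_I

theorem tendsto_genThree : Tendsto genThree atImInfty (𝓝 1) := by
  have h1 := tendsto_jacobiTheta (c := 1 / 2) (by norm_num)
  have h2 := tendsto_jacobiTheta (c := 2) (by norm_num)
  have h3 := tendsto_jacobiTheta (c := 3 / 2) (by norm_num)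
  have h4 := tendsto_jacobiTheta (c := 6) (by norm_num)
  have := ((((h2.mul h4).const_mul 2).add (h1.mul h3)).sub (h1.mul h4)).sub (h2.mul h3)
  norm_num only at this
  rw [genThree_eq]
  exact_mod_cast this

theorem jacobiTheta_fricke_three {c d : ℝ} (hc : 0 < c) (hd : c * d = 3) (z : ℍ) :
    jacobiTheta (c * fricke 3 z) =
      √d * (-Complex.I * z) ^ (1 / 2 : ℂ) * jacobiTheta (d * z) := by
  have hd0 : 0 < d := by
    by_contra! h
    nlinarith
  have hz := z.ne_zero
  have hd' : (d : ℂ) ≠ 0 := by exact_mod_cast hd0.ne'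
  have hcd : (c : ℂ) * d = 3 := by exact_mod_cast hd
  rw [jacobiTheta_of_eq (im_ofReal_mul_pos hd0 z), neg_I_mul_cpow_half hd0 hz]
  rw [coe_fricke]
  push_cast
  field_simp
  rw [hcd]

/-- The involution exchanges the scales `2 ↔ 3/2` and `6 ↔ 1/2`. It therefore swaps the first two
products in `genThree_eq`, with the coefficient 2 compensated by the square roots, and fixes the
other two up to the common factor `-i √3 z`. -/
theorem isGenerator_three : IsGenerator 3 1 2 (-Complex.I) genThree where
  level := rfl
  weight := rfl
  char := by simp
  lim := tendsto_genThree
  form :=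
    { holo := by
        rw [genThree_eq]
        have h1 := mdifferentiable_jacobiTheta (c := 1 / 2) (by norm_num)
        have h2 := mdifferentiable_jacobiTheta (c := 2) (by norm_num)
        have h3 := mdifferentiable_jacobiTheta (c := 3 / 2) (by norm_num)
        have h4 := mdifferentiable_jacobiTheta (c := 6) (by norm_num)
        exact (((mdifferentiable_const.mul (h2.mul h4)).add (h1.mul h3)).sub (h1.mul h4)).sub
          (h2.mul h3)
      vadd := genThree_vadd
      bdd := tendsto_genThree.isBigO_one ℝ
      fricke := fun z => by
        rw [genThree_eq]
        simp only
        rw [jacobiTheta_fricke_three (c := 2) (d := 3 / 2) (by norm_num) (by norm_num),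
          jacobiTheta_fricke_three (c := 6) (d := 1 / 2) (by norm_num) (by norm_num),
          jacobiTheta_fricke_three (c := 1 / 2) (d := 6) (by norm_num) (by norm_num),
          jacobiTheta_fricke_three (c := 3 / 2) (d := 2) (by norm_num) (by norm_num)]
        have hu : (-Complex.I * z) ^ (1 / 2 : ℂ) * (-Complex.I * z) ^ (1 / 2 : ℂ) = -Complex.I * z := by
          rw [← sq, ← Complex.cpow_nat_mul]
          norm_num
        have hs : ∀ {x y t : ℝ}, 0 ≤ x → 0 ≤ t → x * y = 3 * t ^ 2 →
            ((√x : ℝ) : ℂ) * (√y : ℝ) = (√((3 : ℕ) : ℝ) : ℝ) * (t : ℝ) := by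
          intro x y t hx ht h
          rw [← Complex.ofReal_mul, ← Real.sqrt_mul hx, h, Real.sqrt_mul (by norm_num), Real.sqrt_sq ht]
          push_cast; rfl
        have s1 := hs (x := 3 / 2) (y := 1 / 2) (t := 1 / 2) (by norm_num) (by norm_num) (by norm_num)
        have s2 := hs (x := 6) (y := 2) (t := 2) (by norm_num) (by norm_num) (by norm_num)
        have s3 := hs (x := 6) (y := 1 / 2) (t := 1) (by norm_num) (by norm_num) (by norm_num)
        have s4 := hs (x := 3 / 2) (y := 2) (t := 1) (by norm_num) (by norm_num) (by norm_num)
        rw [frickeFactor, Nat.cast_one, zpow_one]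
        generalize (-Complex.I * z) ^ (1 / 2 : ℂ) = u at hu
        generalize ((√(3 / 2 : ℝ) : ℝ) : ℂ) = x1 at *
        generalize ((√(1 / 2 : ℝ) : ℝ) : ℂ) = x2 at *
        generalize ((√(6 : ℝ) : ℝ) : ℂ) = x3 at *
        generalize ((√(2 : ℝ) : ℝ) : ℂ) = x4 at *
        generalize ((√((3 : ℕ) : ℝ) : ℝ) : ℂ) = x5 at *
        generalize jacobiTheta ((2 : ℝ) * z) = y1
        generalize jacobiTheta ((6 : ℝ) * z) = y2
        generalize jacobiTheta ((1 / 2 : ℝ) * z) = y3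
        generalize jacobiTheta ((3 / 2 : ℝ) * z) = y4
        push_cast at s1 s2 s3 s4
        linear_combination (2 * x1 * x2 * y3 * y4 + x3 * x4 * y1 * y2 - x3 * x2 * y2 * y3 -
          x1 * x4 * y4 * y1) * hu + (-Complex.I * z) * (2 * y3 * y4 * s1 + y1 * y2 * s2 -
          y2 * y3 * s3 - y4 * y1 * s4) }

/-! ### Nearly holomorphic functions of depth one -/

/-- The function `f₀(z) + f₁(z) / (z - z̄)`. -/
def nearly (f₀ f₁ : ℍ → ℂ) (z : ℍ) : ℂ := f₀ z + f₁ z / ((z : ℂ) - (starRingEnd ℂ) (z : ℂ))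

theorem nearlySum_one (F : ℕ → ℍ → ℂ) : nearlySum 1 F = nearly (F 0) (F 1) := by
  ext z
  simp [nearlySum, nearly, Finset.sum_range_succ]

theorem sub_conj_eq (z : ℍ) : (z : ℂ) - (starRingEnd ℂ) (z : ℂ) = 2 * z.im * Complex.I := by
  rw [Complex.sub_conj]; push_cast; rfl

theorem sub_conj_ne_zero (z : ℍ) : (z : ℂ) - (starRingEnd ℂ) (z : ℂ) ≠ 0 := by
  rw [sub_conj_eq]
  have : (z.im : ℂ) ≠ 0 := by exact_mod_cast z.im_ne_zero
  simp [this]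

/-- A holomorphic function that vanishes on a horizontal line vanishes. -/
theorem eq_zero_of_horizontal {g : ℍ → ℂ} (hg : MDiff g) {y : ℝ} (hy : 0 < y)
    (h : ∀ z : ℍ, z.im = y → g z = 0) : g = 0 := by
  have ha : AnalyticOnNhd ℂ (g ∘ ofComplex) upperHalfPlaneSet :=
    (UpperHalfPlane.mdifferentiable_iff.1 hg).analyticOnNhd isOpen_upperHalfPlaneSet
  have hpre : IsPreconnected upperHalfPlaneSet := (convex_halfSpace_im_gt 0).isPreconnected
  have h0 : (y * Complex.I) ∈ upperHalfPlaneSet := by simpa [upperHalfPlaneSet] using hy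
  have hfreq : ∃ᶠ z in 𝓝[≠] (y * Complex.I : ℂ), (g ∘ ofComplex) z = 0 := by
    have ht : Tendsto (fun t : ℝ => (y * Complex.I + t : ℂ)) (𝓝[≠] 0) (𝓝[≠] (y * Complex.I)) := by
      refine tendsto_nhdsWithin_iff.2 ⟨?_, ?_⟩
      · have : Continuous fun t : ℝ => (y * Complex.I + t : ℂ) := by fun_prop
        have := this.tendsto 0
        simp only [Complex.ofReal_zero, add_zero] at this
        exact this.mono_left nhdsWithin_le_nhds
      · filter_upwards [self_mem_nhdsWithin] with t ht
        simpa using ht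
    refine ht.frequently (Eventually.frequently (Eventually.of_forall fun t => ?_))
    have him : (y * Complex.I + t : ℂ).im = y := by simp
    have hpos : 0 < (y * Complex.I + t : ℂ).im := by rw [him]; exact hy
    rw [comp_apply, ofComplex_apply_of_im_pos hpos]
    exact h _ him
  have := ha.eqOn_zero_of_preconnected_of_frequently_eq_zero hpre h0 hfreq
  ext z
  have h1 := this z.im_pos
  simpa using h1

/-- On the line of height `y` the denominator is the constant `2 i y`, so the holomorphic function
`2 i y a + b` vanishes on that line and hence everywhere. Two values of `y` separate `a` from `b`.
-/
theorem nearly_eq_zero {a b : ℍ → ℂ} (ha : MDiff a) (hb : MDiff b) (h : ∀ z, nearly a b z = 0) :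
    a = 0 ∧ b = 0 := by
  have key : ∀ y : ℝ, 0 < y → (2 * y * Complex.I : ℂ) • a + b = 0 := by
    intro y hy
    refine eq_zero_of_horizontal ((ha.const_smul _).add hb) hy fun z hz => ?_
    have h1 := h z
    have h2 := sub_conj_ne_zero z
    rw [nearly] at h1
    field_simp at h1
    rw [sub_conj_eq, hz] at h1
    rw [Pi.add_apply, Pi.smul_apply, smul_eq_mul]
    linear_combination h1
  have h1 := key 1 one_pos
  have h2 := key 2 two_pos
  have ha0 : a = 0 := by
    ext z
    have e1 := congrFun h1 z
    have e2 := congrFun h2 z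
    simp only [Pi.add_apply, Pi.smul_apply, smul_eq_mul, Pi.zero_apply] at e1 e2
    push_cast at e1 e2
    have : (2 * Complex.I) * a z = 0 := by linear_combination e2 - e1
    simpa using this
  refine ⟨ha0, ?_⟩
  rw [ha0, smul_zero, zero_add] at h1
  exact h1

theorem nearly_ext {a b c d : ℍ → ℂ} (ha : MDiff a) (hb : MDiff b) (hc : MDiff c) (hd : MDiff d)
    (h : ∀ z, nearly a b z = nearly c d z) : a = c ∧ b = d := by
  have := nearly_eq_zero (ha.sub hc) (hb.sub hd) fun z => by
    have := h z
    simp only [nearly, Pi.sub_apply, sub_div] at this ⊢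
    linear_combination this
  exact ⟨sub_eq_zero.1 this.1, sub_eq_zero.1 this.2⟩

theorem sub_conj_vadd (z : ℍ) : ((((1 : ℝ) +ᵥ z : ℍ) : ℂ)) - (starRingEnd ℂ) ((((1 : ℝ) +ᵥ z : ℍ) : ℂ)) =
    (z : ℂ) - (starRingEnd ℂ) (z : ℂ) := by
  simp

theorem mdifferentiable_comp_vadd {f : ℍ → ℂ} (hf : MDiff f) : MDiff (fun z : ℍ => f ((1 : ℝ) +ᵥ z)) := by
  rw [UpperHalfPlane.mdifferentiable_iff] at hf ⊢
  have h1 : DifferentiableOn ℂ (fun w : ℂ => (f ∘ ofComplex) (1 + w)) upperHalfPlaneSet :=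
    hf.comp (by fun_prop) fun w hw => by simpa [upperHalfPlaneSet] using hw
  refine h1.congr fun w hw => ?_
  have : (1 + w : ℂ) = (((1 : ℝ) +ᵥ (⟨w, hw⟩ : ℍ) : ℍ) : ℂ) := by simp
  simp only [comp_apply, this, ofComplex_apply, ofComplex_apply_of_im_pos hw]

section

variable {N : ℕ} [NeZero N]

theorem mdifferentiable_comp_fricke {f : ℍ → ℂ} (hf : MDiff f) : MDiff fun z => f (fricke N z) := by
  rw [UpperHalfPlane.mdifferentiable_iff] at hf ⊢
  have hN : (N : ℂ) ≠ 0 := NeZero.ne _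
  have h1 : DifferentiableOn ℂ (fun w : ℂ => (f ∘ ofComplex) (-1 / (N * w))) upperHalfPlaneSet := by
    refine hf.comp (fun w hw => ?_) fun w hw => (fricke N ⟨w, hw⟩).im_pos
    have : w ≠ 0 := (⟨w, hw⟩ : ℍ).ne_zero
    exact ((differentiableAt_const _).div (by fun_prop) (mul_ne_zero hN this)).differentiableWithinAt
  refine h1.congr fun w hw => ?_
  have : (-1 / (N * w) : ℂ) = (fricke N ⟨w, hw⟩ : ℂ) := rfl
  simp only [comp_apply, this, ofComplex_apply, ofComplex_apply_of_im_pos hw]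

theorem mdifferentiable_coe : MDiff fun z : ℍ => (z : ℂ) := by
  rw [UpperHalfPlane.mdifferentiable_iff]
  refine differentiableOn_id.congr fun w hw => ?_
  simp only [comp_apply, ofComplex_apply_of_im_pos hw, id]

theorem mdifferentiable_frickeFactor_zpow (k : ℤ) : MDiff fun z : ℍ => frickeFactor N z ^ k := by
  rw [UpperHalfPlane.mdifferentiable_iff]
  have h1 : DifferentiableOn ℂ (fun w : ℂ => ((√(N : ℝ) : ℝ) * w) ^ k) upperHalfPlaneSet :=
    DifferentiableOn.zpow (by fun_prop) (Or.inl fun w hw => frickeFactor_ne_zero N ⟨w, hw⟩)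
  refine h1.congr fun w hw => ?_
  simp only [comp_apply, ofComplex_apply_of_im_pos hw, frickeFactor]

/-- This rests on `N z z̄ / (z - z̄) = N z² / (z - z̄) - N z`. -/
theorem nearly_fricke (f₀ f₁ : ℍ → ℂ) (z : ℍ) : nearly f₀ f₁ (fricke N z) =
    nearly (fun z => f₀ (fricke N z) - N * z * f₁ (fricke N z))
      (fun z => N * (z : ℂ) ^ 2 * f₁ (fricke N z)) z := by
  have hz := z.ne_zero
  have hN : (N : ℂ) ≠ 0 := NeZero.ne _
  have hz' : (starRingEnd ℂ) (z : ℂ) ≠ 0 := (map_ne_zero _).2 hz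
  have hs := sub_conj_ne_zero z
  have e : (fricke N z : ℂ) - (starRingEnd ℂ) (fricke N z : ℂ) =
      ((z : ℂ) - (starRingEnd ℂ) (z : ℂ)) / (N * z * (starRingEnd ℂ) (z : ℂ)) := by
    rw [coe_fricke]
    simp only [map_div₀, map_neg, map_one, map_mul, map_natCast]
    field_simp
    ring
  rw [nearly, nearly, e]
  field_simp
  ring

/-! ### Growth of the components -/

/-- Cauchy's integral formula on a circle, where `z̄` is a rational function, bounds `f₁`. -/
theorem norm_le_of_nearly_le {f₀ f₁ : ℍ → ℂ} (h₀ : MDiff f₀) (h₁ : MDiff f₁) {C : ℝ} (z₀ : ℍ)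
    (hC : ∀ z : ℍ, z₀.im / 5 ≤ z.im → ‖nearly f₀ f₁ z‖ ≤ C) (z : ℍ)
    (hz : (z : ℂ) = z₀ - (2 / 5 * z₀.im : ℝ) * Complex.I) : ‖f₁ z‖ ≤ 12 / 5 * z₀.im * C := by
  set y := z₀.im with hy
  have hy0 : 0 < y := z₀.im_pos
  have him : ∀ w ∈ Metric.closedBall (z₀ : ℂ) (4 / 5 * y), y / 5 ≤ w.im := by
    intro w hw
    have h1 : |(w - z₀).im| ≤ 4 / 5 * y :=
      (Complex.abs_im_le_norm _).trans (by simpa [dist_eq_norm] using hw)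
    rw [Complex.sub_im, abs_le, coe_im] at h1
    linarith [h1.1]
  have hpos : ∀ w ∈ Metric.closedBall (z₀ : ℂ) (4 / 5 * y), 0 < w.im := fun w hw =>
    lt_of_lt_of_le (by positivity) (him w hw)
  have hr : (0 : ℝ) < 4 / 5 * y := by positivity
  have hd : ∀ {f : ℍ → ℂ}, MDiff f →
      DifferentiableOn ℂ (f ∘ ofComplex) (Metric.closedBall (z₀ : ℂ) (4 / 5 * y)) := fun hf =>
    (UpperHalfPlane.mdifferentiable_iff.1 hf).mono hpos
  have hcl : ∀ {f : ℂ → ℂ}, DifferentiableOn ℂ f (Metric.closedBall (z₀ : ℂ) (4 / 5 * y)) →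
      DiffContOnCl ℂ f (Metric.ball (z₀ : ℂ) (4 / 5 * y)) := fun hf =>
    DifferentiableOn.diffContOnCl (by rwa [closure_ball _ hr.ne'])
  -- On the circle of radius `4 y / 5` about `z₀`, `w̄ = z̄₀ + (4 y / 5)² / (w - z₀)`, so `w - w̄ =
  -- (w - z) (w - p) / (w - z₀)`. The root `z` lies inside the circle and `p` outside; the 3-4-5
  -- triangle makes both roots rational multiples of `y`. Integrating thus kills `f₀` and evaluates
  -- `f₁` at `z`.
  set p : ℂ := z₀ - (8 / 5 * y : ℝ) * Complex.I with hp
  have hpne : ∀ w ∈ Metric.closedBall (z₀ : ℂ) (4 / 5 * y), w - p ≠ 0 := by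
    intro w hw h
    have h1 := him w hw
    rw [sub_eq_zero.1 h, hp] at h1
    simp at h1
    linarith
  set g : ℂ → ℂ := fun w => (f₁ ∘ ofComplex) w * ((w - z₀) / (w - p)) with hg
  have hgd : DifferentiableOn ℂ g (Metric.closedBall (z₀ : ℂ) (4 / 5 * y)) :=
    (hd h₁).mul ((by fun_prop : DifferentiableOn ℂ (fun w : ℂ => w - (z₀ : ℂ)) _).div
      (by fun_prop) hpne)
  have hzball : (z : ℂ) ∈ Metric.ball (z₀ : ℂ) (4 / 5 * y) := by
    rw [hz, mem_ball_iff_norm]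
    simp [abs_of_pos hy0]
    linarith
  have hI0 : (∮ w in C(z₀, 4 / 5 * y), (f₀ ∘ ofComplex) w) = 0 :=
    (hcl (hd h₀)).circleIntegral_eq_zero hr.le
  have hI1 := (hcl hgd).circleIntegral_sub_inv_smul hzball
  have hzne : ∀ w ∈ Metric.sphere (z₀ : ℂ) (4 / 5 * y), w - z ≠ 0 := by
    intro w hw h
    rw [sub_eq_zero.1 h] at hw
    rw [mem_ball_iff_norm] at hzball
    rw [mem_sphere_iff_norm] at hw
    exact hzball.ne hw
  have hsub := Metric.sphere_subset_closedBall (x := (z₀ : ℂ)) (ε := 4 / 5 * y)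
  have hci : ∀ {f : ℂ → ℂ}, ContinuousOn f (Metric.sphere (z₀ : ℂ) (4 / 5 * y)) →
      CircleIntegrable f z₀ (4 / 5 * y) := fun hf => hf.circleIntegrable hr.le
  have hadd := circleIntegral.integral_add (hci ((hd h₀).continuousOn.mono hsub))
    (hci (f := fun w => (w - z)⁻¹ • g w)
      (((by fun_prop : ContinuousOn (fun w : ℂ => w - (z : ℂ)) _).inv₀ hzne).smul
        (hgd.continuousOn.mono hsub)))
  rw [hI0, hI1, zero_add] at hadd
  have hbound : ‖∮ w in C(z₀, 4 / 5 * y), ((f₀ ∘ ofComplex) w + (w - z)⁻¹ • g w)‖ ≤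
      2 * Real.pi * (4 / 5 * y) * C := by
    refine circleIntegral.norm_integral_le_of_norm_le_const hr.le fun w hw => ?_
    have hw' := hsub hw
    refine le_of_eq_of_le ?_ (hC ⟨w, hpos w hw'⟩ (him w hw'))
    congr 1
    rw [nearly, hg]
    simp only [comp_apply, ofComplex_apply_of_im_pos (hpos w hw'), smul_eq_mul]
    have hs := sub_conj_ne_zero ⟨w, hpos w hw'⟩
    have hs' := hzne w hw
    have hs'' := hpne w hw'
    have hn : (w - z₀) * (starRingEnd ℂ) (w - z₀) = ((4 / 5 * y : ℝ) : ℂ) ^ 2 := by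
      rw [Complex.mul_conj, Complex.normSq_eq_norm_sq, mem_sphere_iff_norm.1 hw]
      push_cast; rfl
    have hc := sub_conj_eq z₀
    rw [map_sub] at hn
    have e : (starRingEnd ℂ) (z₀ : ℂ) = z₀ - 2 * y * Complex.I := by linear_combination -hc
    rw [e] at hn
    have key : (w - z₀) * (w - (starRingEnd ℂ) w) = (w - z) * (w - p) := by
      rw [hz, hp]
      push_cast at hn ⊢
      linear_combination -hn - (16 / 25 * y ^ 2 : ℂ) * Complex.I_mul_I
    change _ = _ + _ / (w - (starRingEnd ℂ) w)
    change w - (starRingEnd ℂ) w ≠ 0 at hs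
    field_simp
    linear_combination (f₁ ⟨w, hpos w hw'⟩) * key
  rw [hadd] at hbound
  have hgz : g z = -(1 / 3) * f₁ z := by
    have hyc : (y : ℂ) ≠ 0 := by exact_mod_cast hy0.ne'
    have : ((z : ℂ) - z₀) / (z - p) = -(1 / 3) := by
      rw [hz, hp]
      have h1 : (z₀ - (2 / 5 * y : ℝ) * Complex.I - (z₀ - (8 / 5 * y : ℝ) * Complex.I) : ℂ) =
        6 / 5 * y * Complex.I := by push_cast; ring
      rw [h1]
      have := Complex.I_ne_zero
      push_cast
      field_simp
      ring
    rw [hg]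
    simp only [comp_apply, ofComplex_apply]
    rw [this]; ring
  have e1 : ‖(2 * Real.pi * Complex.I : ℂ)‖ = 2 * Real.pi := by
    simp [abs_of_pos Real.pi_pos]
  have e2 : ‖(-(1 / 3) : ℂ)‖ = 1 / 3 := by norm_num
  rw [hgz, norm_smul, e1, norm_mul, e2, mul_assoc (2 * Real.pi)] at hbound
  have := le_of_mul_le_mul_left hbound (by positivity)
  linarith

end

section

variable {N : ℕ} [NeZero N]

/-- The circle estimate only gives linear growth of `f₁` in `Im z`. A periodic holomorphic function
growing slower than `‖q‖⁻¹` has no pole at the cusp, hence is bounded. -/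
theorem isBoundedAtImInfty_of_nearly {f₀ f₁ : ℍ → ℂ} (h₀ : MDiff f₀) (h₁ : MDiff f₁)
    (hT : ∀ z, f₁ ((1 : ℝ) +ᵥ z) = f₁ z) (hb : IsBoundedAtImInfty (nearly f₀ f₁)) :
    IsBoundedAtImInfty f₁ := by
  obtain ⟨C, A, hC⟩ := isBoundedAtImInfty_iff.1 hb
  have hlin : ∀ z : ℍ, 3 * A ≤ z.im → ‖f₁ z‖ ≤ 4 * C * z.im := by
    intro z hz
    have hz0 := z.im_pos
    have him : 0 < ((z : ℂ) + (2 / 3 * z.im : ℝ) * Complex.I).im := by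
      simp; linarith
    have him' : ((z : ℂ) + (2 / 3 * z.im : ℝ) * Complex.I).im = 5 / 3 * z.im := by
      simp; ring
    refine (norm_le_of_nearly_le h₀ h₁ (C := C) ⟨_, him⟩ (fun w hw => hC w ?_) z ?_).trans_eq ?_
    · change ((z : ℂ) + (2 / 3 * z.im : ℝ) * Complex.I).im / 5 ≤ w.im at hw
      rw [him'] at hw
      linarith
    · change (z : ℂ) = (z : ℂ) + (2 / 3 * z.im : ℝ) * Complex.I -
        (2 / 5 * ((z : ℂ) + (2 / 3 * z.im : ℝ) * Complex.I).im : ℝ) * Complex.I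
      rw [him']; push_cast; ring
    · change 12 / 5 * ((z : ℂ) + (2 / 3 * z.im : ℝ) * Complex.I).im * C = _
      rw [him']; ring
  have htend : Tendsto (qPar * f₁) atImInfty (𝓝 0) := by
    have h2 : Tendsto (fun z : ℍ => 2 * Real.pi * z.im) atImInfty atTop :=
      tendsto_comap.const_mul_atTop Real.two_pi_pos
    have h3 := ((Real.tendsto_pow_mul_exp_neg_atTop_nhds_zero 1).comp h2).const_mul
      (4 * C / (2 * Real.pi))
    rw [mul_zero] at h3
    refine squeeze_zero_norm' ?_ h3
    refine (atImInfty_mem _).2 ⟨3 * A, fun z hz => ?_⟩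
    change ‖qPar z * f₁ z‖ ≤ 4 * C / (2 * Real.pi) * ((2 * Real.pi * z.im) ^ 1 *
      Real.exp (-(2 * Real.pi * z.im)))
    rw [norm_mul, norm_qPar]
    have e : 4 * C / (2 * Real.pi) * ((2 * Real.pi * z.im) ^ 1 *
      Real.exp (-(2 * Real.pi * z.im))) = Real.exp (-2 * Real.pi * z.im) * (4 * C * z.im) := by
      have := Real.pi_ne_zero
      field_simp
    rw [e]
    exact mul_le_mul_of_nonneg_left (hlin z hz) (Real.exp_pos _).le
  -- Since `q f₁` is regular and tends to 0, it is `O(q)`; cancelling `q` bounds `f₁`.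
  have hreg : Regular (qPar * f₁) := ⟨mdifferentiable_qPar.mul h₁, fun z => by
    rw [Pi.mul_apply, Pi.mul_apply, hT, qPar_vadd], htend.isBigO_one ℝ⟩
  obtain ⟨c, hc⟩ := (hreg.isBigO_qPar_of_tendsto htend).bound
  refine .of_bound c ?_
  filter_upwards [hc] with z hz
  rw [Pi.mul_apply, norm_mul, mul_comm] at hz
  simpa using le_of_mul_le_mul_right hz (norm_pos_iff.2 (qPar_ne_zero z))

theorem tendsto_div_sub_conj {f : ℍ → ℂ} (hf : IsBoundedAtImInfty f) :
    Tendsto (fun z : ℍ => f z / ((z : ℂ) - (starRingEnd ℂ) (z : ℂ))) atImInfty (𝓝 0) := by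
  obtain ⟨C, A, hC⟩ := isBoundedAtImInfty_iff.1 hf
  have h1 : Tendsto (fun z : ℍ => C * (2 * z.im)⁻¹) atImInfty (𝓝 (C * 0)) :=
    (tendsto_inv_atTop_zero.comp (tendsto_comap.const_mul_atTop two_pos)).const_mul C
  rw [mul_zero] at h1
  refine squeeze_zero_norm' ((atImInfty_mem _).2 ⟨A, fun z hz => ?_⟩) h1
  change ‖f z / ((z : ℂ) - (starRingEnd ℂ) (z : ℂ))‖ ≤ C * (2 * z.im)⁻¹
  rw [norm_div, sub_conj_eq, div_eq_mul_inv]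
  have : ‖(2 * z.im * Complex.I : ℂ)‖ = 2 * z.im := by
    simp [abs_of_pos z.im_pos]
  rw [this]
  exact mul_le_mul_of_nonneg_right (hC z hz) (by have := z.im_pos; positivity)

/-- The components of a nearly holomorphic function are unique, so invariance under `T` and the law
under `S` can be compared componentwise. Boundedness of `f₁` comes first; `f₀` is then a difference
of bounded functions. -/
theorem isQuasi_of_nearly {k : ℤ} {σ : ℂ} {f₀ f₁ : ℍ → ℂ} (h₀ : MDiff f₀) (h₁ : MDiff f₁)
    (hT : ∀ z, nearly f₀ f₁ ((1 : ℝ) +ᵥ z) = nearly f₀ f₁ z)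
    (hS : ∀ z, nearly f₀ f₁ (fricke N z) = σ * frickeFactor N z ^ k * nearly f₀ f₁ z)
    (hb : IsBoundedAtImInfty (nearly f₀ f₁)) : IsQuasi N k σ f₀ f₁ := by
  have hN : (N : ℂ) ≠ 0 := NeZero.ne _
  obtain ⟨t₀, t₁⟩ := nearly_ext (mdifferentiable_comp_vadd h₀) (mdifferentiable_comp_vadd h₁) h₀ h₁
    fun z => by
      have := hT z
      rw [nearly, sub_conj_vadd] at this
      exact this
  have hzd := mdifferentiable_coe
  have hj := mdifferentiable_frickeFactor_zpow (N := N) k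
  have hc : ∀ c : ℂ, MDiff (fun _ : ℍ => c) := fun c => mdifferentiable_const
  obtain ⟨s₀, s₁⟩ := nearly_ext
    (a := fun z => f₀ (fricke N z) - N * z * f₁ (fricke N z))
    (b := fun z => N * (z : ℂ) ^ 2 * f₁ (fricke N z))
    (c := fun z => σ * frickeFactor N z ^ k * f₀ z) (d := fun z => σ * frickeFactor N z ^ k * f₁ z)
    ((mdifferentiable_comp_fricke h₀).sub (((hc N).mul hzd).mul (mdifferentiable_comp_fricke h₁)))
    (((hc N).mul (hzd.pow 2)).mul (mdifferentiable_comp_fricke h₁))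
    (((hc σ).mul hj).mul h₀) (((hc σ).mul hj).mul h₁) fun z => by
      rw [← nearly_fricke, hS, nearly, nearly]
      ring
  have hb₁ := isBoundedAtImInfty_of_nearly h₀ h₁ (congrFun t₁) hb
  have hb₀ : IsBoundedAtImInfty f₀ := by
    have h2 := hb.sub ((tendsto_div_sub_conj hb₁).isBigO_one ℝ)
    refine h2.congr_left fun z => ?_
    simp [nearly]
  have hf₁ : ∀ z, f₁ (fricke N z) = σ * frickeFactor N z ^ (k - 2) * f₁ z := by
    intro z
    have := congrFun s₁ z
    have hz := z.ne_zero
    rw [zpow_sub₀ (frickeFactor_ne_zero N z), zpow_ofNat, frickeFactor_sq]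
    field_simp
    linear_combination this
  refine ⟨⟨h₀, congrFun t₀, hb₀⟩, ⟨⟨h₁, congrFun t₁, hb₁⟩, hf₁⟩, fun z => ?_⟩
  have e₀ := congrFun s₀ z
  have e₁ := congrFun s₁ z
  have hz := z.ne_zero
  field_simp
  linear_combination z * e₀ + e₁

namespace IsQuasi

variable {k : ℤ} {σ : ℂ} {f₀ f₁ : ℍ → ℂ}

theorem nearly_vadd (hf : IsQuasi N k σ f₀ f₁) (z : ℍ) :
    nearly f₀ f₁ ((1 : ℝ) +ᵥ z) = nearly f₀ f₁ z := by
  rw [nearly, sub_conj_vadd, hf.vadd, hf.snd.vadd, nearly]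

theorem nearly_fricke (hf : IsQuasi N k σ f₀ f₁) (z : ℍ) :
    nearly f₀ f₁ (QuasiModular.fricke N z) = σ * frickeFactor N z ^ k * nearly f₀ f₁ z := by
  have hz := z.ne_zero
  have hN : (N : ℂ) ≠ 0 := NeZero.ne _
  rw [QuasiModular.nearly_fricke, nearly, nearly, hf.fricke, hf.snd.fricke,
    zpow_sub₀ (frickeFactor_ne_zero N z), zpow_ofNat, frickeFactor_sq]
  field_simp
  ring

theorem exists_tendsto_nearly (hf : IsQuasi N k σ f₀ f₁) :
    ∃ L : ℂ, Tendsto (nearly f₀ f₁) atImInfty (𝓝 L) := by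
  obtain ⟨L, hL⟩ := hf.toRegular.exists_tendsto
  exact ⟨L + 0, hL.add (tendsto_div_sub_conj hf.snd.bdd)⟩

end IsQuasi

/-! ### Limits at all cusps -/

theorem tendsto_smul_of_upper {u : SL(2, ℝ)} (hu : u 1 0 = 0) :
    Tendsto (fun z : ℍ => u • z) atImInfty atImInfty := by
  have hdet : u 0 0 * u 1 1 = 1 := by
    have := u.det_coe
    rwa [Matrix.det_fin_two, hu, mul_zero, sub_zero] at this
  have h1 : u 1 1 ≠ 0 := right_ne_zero_of_mul_eq_one hdet
  rw [atImInfty, tendsto_comap_iff]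
  have e : (im ∘ fun z : ℍ => u • z) = fun z => (u 1 1 ^ 2)⁻¹ * z.im := by
    ext z
    rw [comp_apply, ← im_smul_of_upper hu z]
    field_simp
  rw [e]
  exact tendsto_comap.const_mul_atTop (by positivity)

/-- With a single cusp, any `γ` is an element of `Γ₀⁺(N)` times an upper triangular matrix, and the
latter preserves limits at `i∞`. -/
theorem exists_tendsto_slash (hN : N.Prime) {f : ℍ → ℂ} {k : ℤ} {ψ : SL(2, ℝ) → ℂ}
    (hf : ∀ g ∈ Gamma0Plus N, f ∣[k] (g : GL (Fin 2) ℝ) = ψ g • f)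
    (hL : ∃ L : ℂ, Tendsto f atImInfty (𝓝 L)) (γ : SL(2, ℤ)) :
    ∃ L : ℂ, Tendsto (f ∣[k] γ) atImInfty (𝓝 L) := by
  obtain ⟨L, hL⟩ := hL
  obtain ⟨g, hg, u, hu, -, e⟩ := exists_coset hN γ
  have h1 : f ∣[k] γ = ψ g • f ∣[k] (u : GL (Fin 2) ℝ) := by
    have : f ∣[k] γ = f ∣[k] ((Matrix.SpecialLinearGroup.map (Int.castRingHom ℝ) γ : SL(2, ℝ)) :
      GL (Fin 2) ℝ) := rfl
    rw [this, e, map_mul, SlashAction.slash_mul, hf g hg, smul_slash_SL]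
  refine ⟨ψ g * (L * (u 1 1 : ℂ) ^ (-k)), ?_⟩
  rw [h1]
  refine Tendsto.const_mul (ψ g) ?_
  have h2 : (f ∣[k] (u : GL (Fin 2) ℝ)) = fun z => f (u • z) * (u 1 1 : ℂ) ^ (-k) := by
    ext z
    rw [slash_apply_SL, hu]
    simp
  rw [h2]
  exact (hL.comp (tendsto_smul_of_upper hu)).mul_const _

/-! ### Description of the spaces of quasimodular forms -/

theorem exists_isQuasi_of_mem {k : ℤ} {σ : ℂ} {F : ℕ → ℍ → ℂ} (hF : ∀ j, MDiff (F j))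
    (hS : nearlySum 1 F ∣[k] (frickeS N : GL (Fin 2) ℝ) = σ • nearlySum 1 F)
    (hT : nearlySum 1 F ∣[k] (transT : GL (Fin 2) ℝ) = nearlySum 1 F)
    (hL : ∀ γ : SL(2, ℤ), ∃ L : ℂ, Tendsto (nearlySum 1 F ∣[k] γ) atImInfty (𝓝 L)) :
    ∃ f₁, IsQuasi N k σ (F 0) f₁ := by
  rw [nearlySum_one] at hS hT hL
  refine ⟨F 1, isQuasi_of_nearly (hF 0) (hF 1) (slash_transT_eq_iff.1 hT)
    (slash_frickeS_eq_smul_iff.1 hS) ?_⟩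
  obtain ⟨L, hL⟩ := hL 1
  rw [SlashAction.slash_one] at hL
  exact hL.isBigO_one ℝ

theorem IsQuasi.slash_eq_of_generators (h1 : 1 < N) (h4 : N < 4) {k : ℤ} {σ : ℂ} {f₀ f₁ : ℍ → ℂ}
    (hf : IsQuasi N k σ f₀ f₁) {ψ : SL(2, ℝ) → ℂ} (ψ1 : ψ 1 = 1)
    (ψS : ∀ g ∈ Gamma0Plus N, ψ (g * frickeS N) = ψ g * σ)
    (ψT : ∀ g ∈ Gamma0Plus N, ∀ m : ℤ, ψ (g * transT ^ m) = ψ g) :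
    ∀ g ∈ Gamma0Plus N, nearly f₀ f₁ ∣[k] (g : GL (Fin 2) ℝ) = ψ g • nearly f₀ f₁ :=
  QuasiModular.slash_eq_of_generators h1 h4 ψ1 ψS ψT
    (slash_frickeS_eq_smul_iff.2 hf.nearly_fricke) (slash_transT_eq_iff.2 hf.nearly_vadd)

/-- The sequence `f₀, f₁, 0, 0, …`. -/
def pairSeq (f₀ f₁ : ℍ → ℂ) (j : ℕ) : ℍ → ℂ := if j = 0 then f₀ else if j = 1 then f₁ else 0

theorem mdifferentiable_pairSeq {f₀ f₁ : ℍ → ℂ} (h₀ : MDiff f₀) (h₁ : MDiff f₁) (j : ℕ) :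
    MDiff (pairSeq f₀ f₁ j) := by
  unfold pairSeq
  split_ifs
  · exact h₀
  · exact h₁
  · exact mdifferentiable_const

theorem mem_quasimodularForms_iff (hN : N.Prime) (h4 : N < 4) {χ : Gamma0Plus N →* ℂˣ} {k : ℤ}
    (hT : χ ⟨transT, Or.inl transT_mem⟩ = 1) (f : ℍ → ℂ) :
    f ∈ quasimodularForms (Gamma0Plus N) χ k 1 ↔
      ∃ f₁, IsQuasi N k (χ ⟨frickeS N, Or.inr frickeS_mem⟩ : ℂˣ) f f₁ := by
  constructor
  · rintro ⟨F, hF, rfl, hV, hL⟩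
    refine exists_isQuasi_of_mem hF (hV ⟨frickeS N, Or.inr frickeS_mem⟩) ?_ hL
    have := hV ⟨transT, Or.inl transT_mem⟩
    rwa [hT, Units.val_one, one_smul] at this
  · rintro ⟨f₁, hf⟩
    classical
    -- The character is extended by 0 to all of `SL(2, ℝ)`; only its values on the group are used.
    let ψ : SL(2, ℝ) → ℂ := fun g => if h : g ∈ Gamma0Plus N then (χ ⟨g, h⟩ : ℂˣ) else 0
    have hψ : ∀ g (h : g ∈ Gamma0Plus N), ψ g = (χ ⟨g, h⟩ : ℂˣ) := fun g h => dif_pos h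
    have hmul : ∀ g (hg : g ∈ Gamma0Plus N) g' (hg' : g' ∈ Gamma0Plus N),
        ψ (g * g') = ψ g * (χ ⟨g', hg'⟩ : ℂˣ) := by
      intro g hg g' hg'
      rw [hψ _ (mul_mem hg hg'), hψ g hg, ← Units.val_mul, ← map_mul]
      rfl
    have key := hf.slash_eq_of_generators hN.one_lt h4 (ψ := ψ)
      (by rw [hψ 1 (one_mem _)]; exact congrArg Units.val (map_one χ))
      (fun g hg => hmul g hg _ (Or.inr frickeS_mem)) fun g hg m => by
        rw [hmul g hg _ (zpow_mem (Or.inl transT_mem) m)]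
        have : (⟨transT ^ m, zpow_mem (Or.inl transT_mem) m⟩ : Gamma0Plus N) =
          ⟨transT, Or.inl transT_mem⟩ ^ m := rfl
        rw [this, map_zpow, hT, one_zpow, Units.val_one, mul_one]
    refine ⟨pairSeq f f₁, mdifferentiable_pairSeq hf.holo hf.snd.holo, rfl, ?_⟩
    rw [nearlySum_one]
    refine ⟨fun γ => (key γ γ.2).trans ?_, exists_tendsto_slash hN key hf.exists_tendsto_nearly⟩
    rw [hψ γ γ.2]
    rfl

theorem mul_frickeS_mem {g : SL(2, ℝ)} (hg : g ∈ atkinLehnerSet N) : g * frickeS N ∈ Gamma0R N := by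
  obtain ⟨hs, a, b, c, d, -, g00, g01, g10, g11⟩ := mem_atkinLehnerSet hg
  have hs' := hs.ne'
  have hsq : √(N : ℝ) * √(N : ℝ) = N := natCast_sqrt_sq
  refine mem_Gamma0R_of (a := b) (b := -a) (c := d) (d := -c) ?_ ?_ ?_ ?_ <;>
    rw [sl_mul_apply] <;> simp [g00, g01, g10, g11, frickeS]
  all_goals field_simp
  linear_combination (d : ℝ) * hsq

theorem frickeS_notMem (hN : N.Prime) : frickeS N ∉ Gamma0R N := by
  intro h
  obtain ⟨a, b, c, d, -, -, -, h10, -⟩ := mem_Gamma0R_entries h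
  refine hN.irrational_sqrt.ne_int (c * N) ?_
  push_cast
  rw [← h10]
  simp [frickeS]

theorem notMem_Gamma0R_of_mem (hN : N.Prime) {g : SL(2, ℝ)} (hg : g ∈ atkinLehnerSet N) :
    g ∉ Gamma0R N := fun h =>
  frickeS_notMem hN ((Subgroup.mul_mem_cancel_left _ h).1 (mul_frickeS_mem hg))

theorem mem_quasimodularEigenspace_iff (hN : N.Prime) (h4 : N < 4) {s : ℤˣ} {k : ℤ} (f : ℍ → ℂ) :
    f ∈ quasimodularEigenspace N s k 1 ↔ ∃ f₁, IsQuasi N k ((s : ℤ) : ℂ) f f₁ := by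
  constructor
  · rintro ⟨F, hF, rfl, ⟨hV, hL⟩, hW⟩
    refine exists_isQuasi_of_mem hF (hW _ frickeS_mem) ?_ hL
    have := hV ⟨transT, transT_mem⟩
    rwa [MonoidHom.one_apply, Units.val_one, one_smul] at this
  · rintro ⟨f₁, hf⟩
    classical
    -- On `Γ₀⁺(N)` this is the character of the quotient by `Γ₀(N)`, a group of order two since `W_N
    -- S ⊆ Γ₀(N)`.
    let ψ : SL(2, ℝ) → ℂ := fun g => if g ∈ Gamma0R N then 1 else ((s : ℤ) : ℂ)
    have hs : ((s : ℤ) : ℂ) * ((s : ℤ) : ℂ) = 1 := by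
      rcases Int.units_eq_one_or s with rfl | rfl <;> norm_num
    have key := hf.slash_eq_of_generators hN.one_lt h4 (ψ := ψ) (if_pos (one_mem _))
      (fun g hg => by
        rcases hg with hg | hg
        · have h2 : g * frickeS N ∉ Gamma0R N := fun h =>
            frickeS_notMem hN ((Subgroup.mul_mem_cancel_left _ hg).1 h)
          simp only [ψ, if_pos hg, if_neg h2, one_mul]
        · simp only [ψ, if_neg (notMem_Gamma0R_of_mem hN hg), if_pos (mul_frickeS_mem hg), hs])
      (fun g hg m => by
        simp only [ψ, Subgroup.mul_mem_cancel_right _ (zpow_mem transT_mem m)])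
    refine ⟨pairSeq f f₁, mdifferentiable_pairSeq hf.holo hf.snd.holo, rfl, ?_⟩
    rw [nearlySum_one]
    refine ⟨⟨fun γ => (key γ (Or.inl γ.2)).trans ?_,
      exists_tendsto_slash hN key hf.exists_tendsto_nearly⟩,
      fun w hw => (key w (Or.inr hw)).trans ?_⟩
    · simp only [ψ, if_pos γ.2]
      rfl
    · simp only [ψ, if_neg (notMem_Gamma0R_of_mem hN hw)]
      rfl

end

/-! ### The spaces of the main theorem -/

theorem chi_transT : chi ⟨transT, Or.inl transT_mem⟩ = 1 := by
  ext
  change chiFun transT = 1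
  rw [chiFun_left (d := 1) transT_mem (by simp [transT])]
  simp

theorem chi_frickeS : (chi ⟨frickeS 3, Or.inr frickeS_mem⟩ : ℂ) = -Complex.I := by
  change chiFun (frickeS 3) = _
  rw [chiFun_right (c := 1) frickeS_mem (by simp [frickeS])]
  simp

theorem chiBar_transT : chiBar ⟨transT, Or.inl transT_mem⟩ = 1 := by
  rw [chiBar, MonoidHom.comp_apply, chi_transT, map_one]

theorem chiBar_frickeS : (chiBar ⟨frickeS 3, Or.inr frickeS_mem⟩ : ℂ) = Complex.I := by
  rw [chiBar, MonoidHom.comp_apply, Units.coe_map, chi_frickeS]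
  simp

/-- Existence and uniqueness of extremal forms in terms of a generator: the character is `ν ^ n`,
or `-ν ^ n` if the weight is at least two. -/
theorem IsGenerator.extremal {N : ℕ} [NeZero N] {w h : ℕ} {ν : ℂ} {a : ℍ → ℂ}
    (H : IsGenerator N w h ν a) {n k : ℤ} (hk : k = w * n) {σ : ℂ} (h0 : 0 ≤ n)
    (hσ : σ = ν ^ n ∨ σ = -ν ^ n ∧ (h : ℤ) ≤ n) {M : Submodule ℂ (ℍ → ℂ)}
    (hM : ∀ f, f ∈ M ↔ ∃ f₁, IsQuasi N k σ f f₁) : ExtremalExistsUnique M := by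
  subst hk
  rcases hσ with rfl | ⟨rfl, hn⟩
  · exact H.extremal_pos h0 (by simpa using hM)
  · exact H.extremal_neg hn (by simpa using hM)

theorem neg_I_sq_zpow : (-Complex.I) ^ (2 : ℤ) = -1 := by
  rw [zpow_ofNat, neg_sq, Complex.I_sq]

theorem neg_I_zpow_odd (m : ℤ) : (-Complex.I) ^ (2 * m + 1) = -Complex.I ∨
    (-Complex.I) ^ (2 * m + 1) = Complex.I := by
  rw [zpow_add_one₀ (neg_ne_zero.2 Complex.I_ne_zero), zpow_mul, neg_I_sq_zpow]
  rcases Int.even_or_odd m with h | h <;> rw [h.neg_one_zpow] <;> simp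

theorem extremalExistsUnique_eigenspace {N : ℕ} (hN : N = 2 ∨ N = 3) {k : ℤ} (hk : 0 < k)
    (hk2 : Even k) (s : ℤˣ) : ExtremalExistsUnique (quasimodularEigenspace N s k 1) := by
  obtain ⟨m, rfl⟩ := hk2
  rcases hN with rfl | rfl
  · refine isGenerator_two.extremal (n := m) (by push_cast; ring) (by omega) ?_
      (mem_quasimodularEigenspace_iff Nat.prime_two (by norm_num))
    rcases Int.units_eq_one_or s with rfl | rfl <;> rcases Int.even_or_odd m with h | h <;>
      rw [h.neg_one_zpow] <;> simp <;> omega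
  · refine isGenerator_three.extremal (n := m + m) (by push_cast; ring) (by omega) ?_
      (mem_quasimodularEigenspace_iff Nat.prime_three (by norm_num))
    rw [← two_mul, zpow_mul, neg_I_sq_zpow]
    rcases Int.units_eq_one_or s with rfl | rfl <;> rcases Int.even_or_odd m with h | h <;>
      rw [h.neg_one_zpow] <;> simp <;> omega

theorem extremalExistsUnique_chi {k : ℤ} (hk : 0 < k) (hk2 : Odd k) :
    ExtremalExistsUnique (quasimodularForms (Gamma0Plus 3) chi k 1) := by
  obtain ⟨m, rfl⟩ := hk2
  refine isGenerator_three.extremal (n := 2 * m + 1) (by push_cast; ring) (by omega) ?_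
    (mem_quasimodularForms_iff Nat.prime_three (by norm_num) chi_transT)
  rw [chi_frickeS]
  -- In weight 1 the index is below `h = 2`, so the negative sign is not allowed; there `χ(S) = -i`
  -- is `ν` itself.
  rcases eq_or_ne m 0 with rfl | hm
  · left; simp
  rcases neg_I_zpow_odd m with h | h <;> rw [h]
  · exact Or.inl rfl
  · exact Or.inr ⟨rfl, by push_cast; omega⟩

/-- Weight 1 is excluded because there `χ̄(S) = i = -ν` is the negative sign with index `1 < h`, and
the space is zero. -/
theorem extremalExistsUnique_chiBar {k : ℤ} (hk : 1 < k) (hk2 : Odd k) :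
    ExtremalExistsUnique (quasimodularForms (Gamma0Plus 3) chiBar k 1) := by
  obtain ⟨m, rfl⟩ := hk2
  refine isGenerator_three.extremal (n := 2 * m + 1) (by push_cast; ring) (by omega) ?_
    (mem_quasimodularForms_iff Nat.prime_three (by norm_num) chiBar_transT)
  rw [chiBar_frickeS]
  rcases neg_I_zpow_odd m with h | h <;> rw [h]
  · exact Or.inr ⟨(neg_neg _).symm, by push_cast; omega⟩
  · exact Or.inl rfl

end QuasiModular

end

theorem mainTheorem8 :
    (∀ N : ℕ, N = 2 ∨ N = 3 → ∀ k : ℤ, 0 < k → Even k → ∀ s : ℤˣ,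
      QuasiModular.ExtremalExistsUnique (QuasiModular.quasimodularEigenspace N s k 1)) ∧
    (∀ k : ℤ, 0 < k → Odd k →
      QuasiModular.ExtremalExistsUnique
        (QuasiModular.quasimodularForms (QuasiModular.Gamma0Plus 3) QuasiModular.chi k 1)) ∧
    (∀ k : ℤ, 1 < k → Odd k →
      QuasiModular.ExtremalExistsUnique
        (QuasiModular.quasimodularForms (QuasiModular.Gamma0Plus 3) QuasiModular.chiBar k 1)) :=
  ⟨fun _ hN _ hk hk2 s => QuasiModular.extremalExistsUnique_eigenspace hN hk hk2 s,
    fun _ hk hk2 => QuasiModular.extremalExistsUnique_chi hk hk2,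
    fun _ hk hk2 => QuasiModular.extremalExistsUnique_chiBar hk hk2⟩
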